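/- Let $n\ge 1$, let $\mathbb H_n=\{Z=X+iY : X,Y\in\mathrm{Sym}_n(\mathbb R),\ Y>0\}$ be the Siegel upper half-space, on which $\gamma=\begin{pmatrix}A&B\\C&D\end{pmatrix}\in\mathrm{Sp}_n(\mathbb R)$ acts by $\gamma Z=(AZ+B)(CZ+D)^{-1}$, and let $d\mu_n(Z)=\det(Y)^{-(n+1)}\prod_{j\le k}dx_{j,k}\,dy_{j,k}$. Put $(\partial/\partial X)_{j,k}=\frac{1+\delta_{j,k}}2\,\partial/\partial x_{j,k}$, $(\partial/\partial Y)_{j,k}=\frac{1+\delta_{j,k}}2\,\partial/\partial y_{j,k}$, $\partial/\partial Z=\frac12(\partial/\partial X-i\,\partial/\partial Y)$, $\partial/\partial\overline Z=\frac12(\partial/\partial X+i\,\partial/\partial Y)$. For $\alpha,\beta\in\mathbb R$ define the $(n\times n)$-matrices of differential operators $$K_\alpha=(Z-\overline Z)\frac{\partial}{\partial Z}+\alpha 1_n,\qquad \Lambda_\beta=(Z-\overline Z)\frac{\partial}{\partial\overline Z}-\beta 1_n,\qquad \Omega_{\alpha,\beta}=\Lambda_{\beta-(n+1)/2}K_\alpha+\alpha\Big(\beta-\frac{n+1}2\Big)1_n,$$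 and the Siegel–Maaß Laplacian $\Delta_{\alpha,\beta}=-\mathrm{tr}(\Omega_{\alpha,\beta})$. Let $\Gamma\subset\mathrm{Sp}_n(\mathbb R)$ be a subgroup commensurable with $\mathrm{Sp}_n(\mathbb Z)$. For every $\gamma\in\mathrm{Sp}_n(\mathbb R)$ fix a continuous branch $\ell_\gamma$ of $\log\det(CZ+D)$ on $\mathbb H_n$ and read $\det(CZ+D)^\alpha=e^{\alpha\ell_\gamma(Z)}$, $\det(C\overline Z+D)^\beta=e^{\beta\overline{\ell_\gamma(Z)}}$ (if $\alpha-\beta\in\mathbb Z$, their product is $\det(CZ+D)^{\alpha-\beta}|\det(CZ+D)|^{2\beta}$, whatever the branch). Integrals over $\Gamma\backslash\mathbb H_n$ are integrals over an arbitrary measurable fundamental domain for the action of $\Gamma$ on $\mathbb H_n$. For $r\in\{\infty,\omega\}$ let $\mathcal H$ be the space of all functions $\varphi\colon\mathbb H_n\to\mathbb C$ such that 1. $\varphi$ is of class $C^r$ ($C^\omega$ means real-analytic); 2. $\varphi(\gamma Z)=\det(CZ+D)^\alpha\det(C\overline Z+D)^\beta\varphi(Z)$ for all $\gamma\in\Gamma$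 and $Z\in\mathbb H_n$; 3. for all $\gamma\in\mathrm{Sp}_n(\mathbb Z)$ and all real symmetric $Y_0>0$ there are $M>0$ and $N\in\mathbb N$ with $|\det(CZ+D)^{-\alpha}\det(C\overline Z+D)^{-\beta}\varphi(\gamma Z)|\le M\,\mathrm{tr}(Y)^N$ for all $Z=X+iY\in\mathbb H_n$ with $Y\ge Y_0$; 4. $\int_{\Gamma\backslash\mathbb H_n}\det(Y)^{\alpha+\beta}|\varphi(Z)|^2\,d\mu_n(Z)<\infty$. For $r=\omega$ this is the space $\mathcal H_{\alpha,\beta}^n(\Gamma)$ of automorphic forms of weight $(\alpha,\beta)$ and degree $n$ for $\Gamma$. Put $\langle\varphi,\psi\rangle=\int_{\Gamma\backslash\mathbb H_n}\det(Y)^{\alpha+\beta}\varphi(Z)\overline{\psi(Z)}\,d\mu_n(Z)$. **Theorem.** Let $\varphi,\psi\in\mathcal H$ be compactly supported modulo $\Gamma$, that is, their supports have compact image in $\Gamma\backslash\mathbb H_n$. Then $$\langle-\Delta_{\alpha,\beta}\varphi,\psi\rangle=\int_{\Gamma\backslash\mathbb H_n}\det(Y)^{\alpha+\beta}\,\mathrm{tr}\big(\Lambda_\beta\varphi(Z)\,\overline{\Lambda_\beta\psi(Z)}\big)\,d\mu_n(Z)+n\beta\Big(\alpha-\frac{n+1}2\Big)\langle\varphi,\psi\rangle,$$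 where $\overline{\Lambda_\beta\psi}=\overline\Lambda_\beta\overline\psi$ is the entrywise complex conjugate and all the integrals converge absolutely. Moreover, $\Delta_{\alpha,\beta}\varphi$ again lies in $\mathcal H$ and is compactly supported modulo $\Gamma$, and $\langle\Delta_{\alpha,\beta}\varphi,\psi\rangle=\langle\varphi,\Delta_{\alpha,\beta}\psi\rangle$, so that $\Delta_{\alpha,\beta}$ acts as a symmetric operator on the compactly supported elements of $\mathcal H$. -/

import Mathlib

open MeasureTheory Matrix
open scoped ContDiff ComplexConjugate

noncomputable section

namespace SiegelMaass

variable {n : ℕ}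

/-- The symmetric matrix `(z_{j,k})` with the coordinates `z_{j,k} = z_{k,j}`, which are indexed by
the unordered pairs `s(j, k)`, that is, by the pairs `1 ≤ j ≤ k ≤ n`. -/
def symMatrix (z : Sym2 (Fin n) → ℂ) : Matrix (Fin n) (Fin n) ℂ :=
  Matrix.of fun j k => z s(j, k)

/-- The Siegel upper half-space of degree `n`: the complex symmetric matrices `Z = X + iY`, given by
their coordinates `z_{j,k} = x_{j,k} + i y_{j,k}`, whose imaginary part `Y` is positive definite. -/
abbrev HalfSpace (n : ℕ) : Type :=
  {z : Sym2 (Fin n) → ℂ // ((symMatrix z).map Complex.im).PosDef}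

/-- The point `Z` as a complex symmetric matrix. -/
def HalfSpace.mat (Z : HalfSpace n) : Matrix (Fin n) (Fin n) ℂ := symMatrix Z.1

/-- `Y = Im Z`. -/
def HalfSpace.Y (Z : HalfSpace n) : Matrix (Fin n) (Fin n) ℝ := Z.mat.map Complex.im

/-- `Z - conj Z`. -/
def HalfSpace.subConj (Z : HalfSpace n) : Matrix (Fin n) (Fin n) ℂ := Z.mat - Z.mat.map conj

/-- The real symplectic group `Sp_n(ℝ)` of `2n × 2n` matrices. -/
abbrev Sp (n : ℕ) : Type := symplecticGroup (Fin n) ℝ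

/-- The inclusion of `Sp_n(ℤ)` into `Sp_n(ℝ)`. -/
def intSpHom (n : ℕ) : symplecticGroup (Fin n) ℤ →* Sp n where
  toFun M := ⟨M.1.map (Int.castRingHom ℝ), SymplecticGroup.map_mem M.2 (Int.castRingHom ℝ)⟩
  map_one' := by
    apply Subtype.ext
    exact Matrix.map_one (Int.castRingHom ℝ) (map_zero _) (map_one _)
  map_mul' M N := by
    apply Subtype.ext
    exact Matrix.map_mul

/-- The Siegel modular group `Sp_n(ℤ)` as a subgroup of `Sp_n(ℝ)`. -/
def SpZ (n : ℕ) : Subgroup (Sp n) := (intSpHom n).range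

/-! ### The symplectic action -/

/-- `A Z + B` for `γ = (A B; C D)`. -/
def numer (γ : Sp n) (Z : Matrix (Fin n) (Fin n) ℂ) : Matrix (Fin n) (Fin n) ℂ :=
  γ.1.toBlocks₁₁.map Complex.ofReal * Z + γ.1.toBlocks₁₂.map Complex.ofReal

/-- `C Z + D` for `γ = (A B; C D)`. -/
def denom (γ : Sp n) (Z : Matrix (Fin n) (Fin n) ℂ) : Matrix (Fin n) (Fin n) ℂ :=
  γ.1.toBlocks₂₁.map Complex.ofReal * Z + γ.1.toBlocks₂₂.map Complex.ofReal

theorem symMatrix_transpose (z : Sym2 (Fin n) → ℂ) : (symMatrix z)ᵀ = symMatrix z := by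
  ext j k
  simp [symMatrix, Sym2.eq_swap]

/-- The coordinates of a symmetric matrix. -/
def coords (M : Matrix (Fin n) (Fin n) ℂ) (hM : Mᵀ = M) : Sym2 (Fin n) → ℂ :=
  Sym2.lift ⟨fun j k => M j k, fun j k => congrFun (congrFun hM k) j⟩

theorem symMatrix_coords (M : Matrix (Fin n) (Fin n) ℂ) (hM : Mᵀ = M) :
    symMatrix (coords M hM) = M := by
  ext j k
  simp [symMatrix, coords]

theorem symMatrix_injective : Function.Injective (symMatrix (n := n)) := by
  intro z w h
  funext p
  induction p using Sym2.ind with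
  | _ j k => exact congrFun (congrFun h j) k

theorem block_rels (γ : Sp n) :
    γ.1.toBlocks₁₁ᵀ * γ.1.toBlocks₂₁ = γ.1.toBlocks₂₁ᵀ * γ.1.toBlocks₁₁ ∧
    γ.1.toBlocks₁₂ᵀ * γ.1.toBlocks₂₂ = γ.1.toBlocks₂₂ᵀ * γ.1.toBlocks₁₂ ∧
    γ.1.toBlocks₁₁ᵀ * γ.1.toBlocks₂₂ - γ.1.toBlocks₂₁ᵀ * γ.1.toBlocks₁₂ = 1 := by
  have h := γ.2
  rw [← Matrix.fromBlocks_toBlocks γ.1] at h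
  exact SymplecticGroup.fromBlocks_mem_iff.1 h

theorem block_rels_complex (γ : Sp n) :
    (γ.1.toBlocks₁₁.map Complex.ofReal)ᵀ * γ.1.toBlocks₂₁.map Complex.ofReal =
      (γ.1.toBlocks₂₁.map Complex.ofReal)ᵀ * γ.1.toBlocks₁₁.map Complex.ofReal ∧
    (γ.1.toBlocks₁₂.map Complex.ofReal)ᵀ * γ.1.toBlocks₂₂.map Complex.ofReal =
      (γ.1.toBlocks₂₂.map Complex.ofReal)ᵀ * γ.1.toBlocks₁₂.map Complex.ofReal ∧
    (γ.1.toBlocks₁₁.map Complex.ofReal)ᵀ * γ.1.toBlocks₂₂.map Complex.ofReal -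
      (γ.1.toBlocks₂₁.map Complex.ofReal)ᵀ * γ.1.toBlocks₁₂.map Complex.ofReal = 1 := by
  have hm : ∀ M N : Matrix (Fin n) (Fin n) ℝ,
      (M.map Complex.ofReal)ᵀ * N.map Complex.ofReal = (Mᵀ * N).map Complex.ofReal := by
    intro M N
    ext i j
    simp [Matrix.mul_apply]
  obtain ⟨h1, h2, h3⟩ := block_rels γ
  refine ⟨by rw [hm, hm, h1], by rw [hm, hm, h2], ?_⟩
  rw [hm, hm]
  ext i j
  have := congrFun (congrFun h3 i) j
  simp only [Matrix.sub_apply, Matrix.map_apply] at this ⊢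
  rw [← Complex.ofReal_sub, this]
  by_cases hij : i = j <;> simp [Matrix.one_apply, hij]

/-- `(C W + D)ᵗ (A Z + B) - (A W + B)ᵗ (C Z + D) = Z - W` for symmetric `W`. -/
theorem denom_numer (γ : Sp n) (W Z : Matrix (Fin n) (Fin n) ℂ) (hW : Wᵀ = W) :
    (denom γ W)ᵀ * numer γ Z - (numer γ W)ᵀ * denom γ Z = Z - W := by
  obtain ⟨h1, h2, h3⟩ := block_rels_complex γ
  simp only [denom, numer, Matrix.transpose_add, Matrix.transpose_mul, hW]
  set A := γ.1.toBlocks₁₁.map Complex.ofReal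
  set B := γ.1.toBlocks₁₂.map Complex.ofReal
  set C := γ.1.toBlocks₂₁.map Complex.ofReal
  set D := γ.1.toBlocks₂₂.map Complex.ofReal
  have h4 : Dᵀ * A - Bᵀ * C = 1 := by
    have := congrArg Matrix.transpose h3
    simpa using this
  have e : (W * Cᵀ + Dᵀ) * (A * Z + B) - (W * Aᵀ + Bᵀ) * (C * Z + D) =
      W * (Cᵀ * A - Aᵀ * C) * Z + (Dᵀ * A - Bᵀ * C) * Z - W * (Aᵀ * D - Cᵀ * B)
        + (Dᵀ * B - Bᵀ * D) := by
    noncomm_ring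
  rw [e, h1, h2, h3, h4]
  simp

theorem map_conj_symm (Z : HalfSpace n) : (Z.mat.map conj)ᵀ = Z.mat.map conj := by
  rw [← Matrix.transpose_map, HalfSpace.mat, symMatrix_transpose]

theorem denom_conj (γ : Sp n) (M : Matrix (Fin n) (Fin n) ℂ) :
    denom γ (M.map conj) = (denom γ M).map conj := by
  ext i j
  simp [denom, Matrix.mul_apply]

theorem numer_conj (γ : Sp n) (M : Matrix (Fin n) (Fin n) ℂ) :
    numer γ (M.map conj) = (numer γ M).map conj := by
  ext i j
  simp [numer, Matrix.mul_apply]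

theorem subConj_eq (Z : HalfSpace n) :
    Z.subConj = (2 * Complex.I) • Z.Y.map Complex.ofReal := by
  ext i j
  simp [HalfSpace.subConj, HalfSpace.Y, Complex.sub_conj]
  ring

/-- A real positive definite matrix is positive on non-zero complex vectors. -/
theorem posDef_complex {Y : Matrix (Fin n) (Fin n) ℝ} (hY : Y.PosDef) (v : Fin n → ℂ)
    (hv : v ≠ 0) : 0 < (star v ⬝ᵥ (Y.map Complex.ofReal) *ᵥ v).re := by
  have h := fun w => (Matrix.posDef_iff_dotProduct_mulVec.1 hY).2 (x := w)
  have hs : (star v ⬝ᵥ (Y.map Complex.ofReal) *ᵥ v).re =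
      star (fun i => (v i).re) ⬝ᵥ Y *ᵥ (fun i => (v i).re) +
      star (fun i => (v i).im) ⬝ᵥ Y *ᵥ (fun i => (v i).im) := by
    simp [dotProduct, Matrix.mulVec, Finset.sum_add_distrib]
  rw [hs]
  have hnn : ∀ w : Fin n → ℝ, 0 ≤ star w ⬝ᵥ Y *ᵥ w := by
    intro w
    by_cases hw : w = 0
    · simp [hw]
    · exact (h w hw).le
  by_cases hre : (fun i => (v i).re) = 0
  · have him : (fun i => (v i).im) ≠ 0 := by
      intro him
      apply hv
      funext i
      exact Complex.ext (congrFun hre i) (congrFun him i)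
    exact add_pos_of_nonneg_of_pos (hnn _) (h _ him)
  · exact add_pos_of_pos_of_nonneg (h _ hre) (hnn _)

theorem denom_hermitian (γ : Sp n) (Z : HalfSpace n) :
    (denom γ Z.mat)ᴴ * numer γ Z.mat - (numer γ Z.mat)ᴴ * denom γ Z.mat =
      (2 * Complex.I) • Z.Y.map Complex.ofReal := by
  rw [← subConj_eq, HalfSpace.subConj, ← denom_numer γ _ _ (map_conj_symm Z), denom_conj,
    numer_conj]
  rfl

theorem isUnit_det_denom (γ : Sp n) (Z : HalfSpace n) : IsUnit (denom γ Z.mat).det := by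
  rw [isUnit_iff_ne_zero]
  intro h0
  obtain ⟨v, hv, hv0⟩ := Matrix.exists_mulVec_eq_zero_iff.2 h0
  have h := congrArg (fun M => star v ⬝ᵥ M *ᵥ v) (denom_hermitian γ Z)
  simp only [Matrix.sub_mulVec, ← Matrix.mulVec_mulVec, hv0, Matrix.mulVec_zero, sub_zero,
    Matrix.smul_mulVec, dotProduct_smul] at h
  rw [Matrix.dotProduct_mulVec, ← Matrix.star_mulVec, hv0, star_zero, zero_dotProduct] at h
  have hp := posDef_complex Z.2 v hv
  have hz : star v ⬝ᵥ (Z.Y.map Complex.ofReal) *ᵥ v = 0 := by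
    have h2 : (2 * Complex.I) ≠ 0 := by simp
    exact (smul_eq_zero.1 h.symm).resolve_left h2
  change 0 < (star v ⬝ᵥ (Z.Y.map Complex.ofReal) *ᵥ v).re at hp
  rw [hz] at hp
  simp at hp

/-- `(A Z + B) (C Z + D)⁻¹`. -/
def actMatrix (γ : Sp n) (Z : HalfSpace n) : Matrix (Fin n) (Fin n) ℂ :=
  numer γ Z.mat * (denom γ Z.mat)⁻¹

theorem actMatrix_mul (γ : Sp n) (Z : HalfSpace n) :
    actMatrix γ Z * denom γ Z.mat = numer γ Z.mat := by
  rw [actMatrix, Matrix.mul_assoc, Matrix.nonsing_inv_mul _ (isUnit_det_denom γ Z), Matrix.mul_one]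

theorem actMatrix_symm (γ : Sp n) (Z : HalfSpace n) : (actMatrix γ Z)ᵀ = actMatrix γ Z := by
  have hu := (Matrix.isUnit_iff_isUnit_det _).2 (isUnit_det_denom γ Z)
  have hut : IsUnit (denom γ Z.mat)ᵀ := by
    rw [Matrix.isUnit_iff_isUnit_det, Matrix.det_transpose]
    exact isUnit_det_denom γ Z
  have h := denom_numer γ Z.mat Z.mat (symMatrix_transpose Z.1)
  rw [sub_self, sub_eq_zero, ← actMatrix_mul, Matrix.transpose_mul, ← Matrix.mul_assoc] at h
  exact (hut.mul_left_cancel (by simpa [Matrix.mul_assoc] using hu.mul_right_cancel h)).symm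

theorem actMatrix_posDef (γ : Sp n) (Z : HalfSpace n) :
    ((actMatrix γ Z).map Complex.im).PosDef := by
  have hsymm := actMatrix_symm γ Z
  have hH : (actMatrix γ Z)ᴴ = (actMatrix γ Z).map conj := by
    rw [Matrix.conjTranspose, hsymm]
    rfl
  rw [Matrix.posDef_iff_dotProduct_mulVec]
  refine ⟨?_, fun {x} hx => ?_⟩
  · ext i j
    have := congrFun (congrFun hsymm i) j
    simp only [Matrix.transpose_apply] at this
    simp [this]
  · set Q := denom γ Z.mat with hQ
    have hQu := isUnit_det_denom γ Z
    rw [← hQ] at hQu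
    set v : Fin n → ℂ := fun i => (x i : ℂ) with hvdef
    set u := Q⁻¹ *ᵥ v with hu
    have hv : Q *ᵥ u = v := by
      rw [hu, Matrix.mulVec_mulVec, Matrix.mul_nonsing_inv _ hQu, Matrix.one_mulVec]
    have hu0 : u ≠ 0 := by
      intro h0
      rw [h0, Matrix.mulVec_zero] at hv
      apply hx
      funext i
      have := congrFun hv i
      simpa [hvdef] using this.symm
    have h := denom_hermitian γ Z
    rw [← actMatrix_mul, ← hQ, Matrix.conjTranspose_mul, hH] at h
    have h2 : Qᴴ * (actMatrix γ Z * Q) - Qᴴ * (actMatrix γ Z).map conj * Q =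
        (2 * Complex.I) • (Qᴴ * ((actMatrix γ Z).map Complex.im).map Complex.ofReal * Q) := by
      have : actMatrix γ Z = (actMatrix γ Z).map conj +
          (2 * Complex.I) • ((actMatrix γ Z).map Complex.im).map Complex.ofReal := by
        ext i j
        have := Complex.sub_conj (actMatrix γ Z i j)
        simp only [Matrix.add_apply, Matrix.map_apply, Matrix.smul_apply, smul_eq_mul]
        rw [Complex.ofReal_mul, Complex.ofReal_ofNat] at this
        linear_combination this
      have h5 : Qᴴ * (actMatrix γ Z * Q) - Qᴴ * (actMatrix γ Z).map conj * Q =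
          Qᴴ * (actMatrix γ Z - (actMatrix γ Z).map conj) * Q := by
        noncomm_ring
      rw [h5, sub_eq_iff_eq_add'.2 this, Matrix.mul_smul, Matrix.smul_mul]
    rw [h2] at h
    have h3 := smul_right_injective _ (by simp : (2 * Complex.I) ≠ 0) h
    have h4 := congrArg (fun M => (star u ⬝ᵥ M *ᵥ u).re) h3
    simp only [← Matrix.mulVec_mulVec, hv] at h4
    rw [Matrix.dotProduct_mulVec, ← Matrix.star_mulVec, hv] at h4
    have hp := posDef_complex Z.2 u hu0
    change 0 < (star u ⬝ᵥ (Z.Y.map Complex.ofReal) *ᵥ u).re at hp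
    rw [← h4] at hp
    simpa [dotProduct, Matrix.mulVec, hvdef] using hp

/-- `Z ↦ γZ = (A Z + B) (C Z + D)⁻¹`. -/
def act (γ : Sp n) (Z : HalfSpace n) : HalfSpace n :=
  ⟨coords (actMatrix γ Z) (actMatrix_symm γ Z), by
    rw [symMatrix_coords]
    exact actMatrix_posDef γ Z⟩

theorem act_mat (γ : Sp n) (Z : HalfSpace n) : (act γ Z).mat = actMatrix γ Z :=
  symMatrix_coords _ (actMatrix_symm γ Z)

theorem mat_injective : Function.Injective (HalfSpace.mat (n := n)) := fun _ _ h =>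
  Subtype.ext (symMatrix_injective h)

theorem toBlocks_mul (γ δ : Sp n) :
    (γ * δ).1 = Matrix.fromBlocks
      (γ.1.toBlocks₁₁ * δ.1.toBlocks₁₁ + γ.1.toBlocks₁₂ * δ.1.toBlocks₂₁)
      (γ.1.toBlocks₁₁ * δ.1.toBlocks₁₂ + γ.1.toBlocks₁₂ * δ.1.toBlocks₂₂)
      (γ.1.toBlocks₂₁ * δ.1.toBlocks₁₁ + γ.1.toBlocks₂₂ * δ.1.toBlocks₂₁)
      (γ.1.toBlocks₂₁ * δ.1.toBlocks₁₂ + γ.1.toBlocks₂₂ * δ.1.toBlocks₂₂) := by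
  rw [← Matrix.fromBlocks_multiply, Matrix.fromBlocks_toBlocks, Matrix.fromBlocks_toBlocks]
  rfl

theorem map_mul_add (M N P Q : Matrix (Fin n) (Fin n) ℝ) :
    (M * N + P * Q).map Complex.ofReal =
      M.map Complex.ofReal * N.map Complex.ofReal + P.map Complex.ofReal * Q.map Complex.ofReal := by
  ext i j
  simp [Matrix.mul_apply]

theorem numer_mul (γ δ : Sp n) (Z : HalfSpace n) :
    numer (γ * δ) Z.mat = numer γ (act δ Z).mat * denom δ Z.mat := by
  rw [act_mat, numer, numer, Matrix.add_mul, Matrix.mul_assoc, actMatrix_mul, toBlocks_mul,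
    Matrix.toBlocks_fromBlocks₁₁, Matrix.toBlocks_fromBlocks₁₂, map_mul_add, map_mul_add, numer,
    denom]
  noncomm_ring

theorem denom_mul (γ δ : Sp n) (Z : HalfSpace n) :
    denom (γ * δ) Z.mat = denom γ (act δ Z).mat * denom δ Z.mat := by
  rw [act_mat, denom, denom, Matrix.add_mul, Matrix.mul_assoc, actMatrix_mul, toBlocks_mul,
    Matrix.toBlocks_fromBlocks₂₁, Matrix.toBlocks_fromBlocks₂₂, map_mul_add, map_mul_add, numer,
    denom]
  noncomm_ring

theorem one_toBlocks : ((1 : Sp n) : Matrix (Fin n ⊕ Fin n) (Fin n ⊕ Fin n) ℝ) =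
    Matrix.fromBlocks 1 0 0 1 := by
  rw [Matrix.fromBlocks_one]
  rfl

/-- The symplectic action of `Sp_n(ℝ)` on the Siegel upper half-space. -/
instance : MulAction (Sp n) (HalfSpace n) where
  smul := act
  one_smul Z := by
    apply mat_injective
    change (act 1 Z).mat = _
    rw [act_mat, actMatrix, numer, denom, one_toBlocks, Matrix.toBlocks_fromBlocks₁₁,
      Matrix.toBlocks_fromBlocks₁₂, Matrix.toBlocks_fromBlocks₂₁, Matrix.toBlocks_fromBlocks₂₂,
      Matrix.map_zero _ Complex.ofReal_zero, Matrix.map_one _ Complex.ofReal_zero Complex.ofReal_one]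
    simp
  mul_smul γ δ Z := by
    apply mat_injective
    change (act (γ * δ) Z).mat = (act γ (act δ Z)).mat
    rw [act_mat, act_mat, actMatrix, actMatrix, numer_mul, denom_mul, Matrix.mul_inv_rev,
      Matrix.mul_assoc, ← Matrix.mul_assoc (denom δ Z.mat),
      Matrix.mul_nonsing_inv _ (isUnit_det_denom δ Z), Matrix.one_mul]

theorem smul_mat (γ : Sp n) (Z : HalfSpace n) :
    (γ • Z).mat = numer γ Z.mat * (denom γ Z.mat)⁻¹ := act_mat γ Z

/-! ### The invariant measure and the quotient -/

/-- The measure `dμ_n = det(Y)^{-(n+1)} ∏_{j ≤ k} dx_{j,k} dy_{j,k}`. -/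
def siegelMeasure (n : ℕ) : Measure (HalfSpace n) :=
  (Measure.comap Subtype.val (volume : Measure (Sym2 (Fin n) → ℂ))).withDensity
    fun Z : HalfSpace n => ENNReal.ofReal ((HalfSpace.Y Z).det ^ (n + 1))⁻¹

/-- The group of transformations of the Siegel upper half-space which is induced by `Γ`. (If `-1`
is in `Γ`, then it acts trivially.) -/
def transformationGroup (Γ : Subgroup (Sp n)) : Subgroup (Equiv.Perm (HalfSpace n)) :=
  (MulAction.toPermHom Γ (HalfSpace n)).range

/-- `F` is a (measurable) fundamental domain for the action of `Γ`. The integral over `Γ \ H_n` of a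
`Γ`-invariant function is its integral over such a domain. -/
def IsFundDomain (Γ : Subgroup (Sp n)) (F : Set (HalfSpace n)) : Prop :=
  IsFundamentalDomain (transformationGroup Γ) F (siegelMeasure n)

/-! ### Differential operators -/

/-- The function on the coordinate space that extends `f` by `0`. The half-space is open, so that
derivatives at its points do not depend on the extension. -/
def ext (f : HalfSpace n → ℂ) : (Sym2 (Fin n) → ℂ) → ℂ := Function.extend Subtype.val f 0

/-- `(∂/∂X)_{j,k} = (1 + δ_{j,k})/2 · ∂/∂x_{j,k}`. -/
def dX (f : HalfSpace n → ℂ) (Z : HalfSpace n) : Matrix (Fin n) (Fin n) ℂ :=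
  Matrix.of fun j k => (1 + if j = k then 1 else 0) / 2 *
    fderiv ℝ (ext f) Z.1 (Pi.single s(j, k) 1)

/-- `(∂/∂Y)_{j,k} = (1 + δ_{j,k})/2 · ∂/∂y_{j,k}`. -/
def dY (f : HalfSpace n → ℂ) (Z : HalfSpace n) : Matrix (Fin n) (Fin n) ℂ :=
  Matrix.of fun j k => (1 + if j = k then 1 else 0) / 2 *
    fderiv ℝ (ext f) Z.1 (Pi.single s(j, k) Complex.I)

/-- `∂/∂Z = (∂/∂X - i ∂/∂Y) / 2`. -/
def dZ (f : HalfSpace n → ℂ) (Z : HalfSpace n) : Matrix (Fin n) (Fin n) ℂ :=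
  (1 / 2 : ℂ) • (dX f Z - Complex.I • dY f Z)

/-- `∂/∂(conj Z) = (∂/∂X + i ∂/∂Y) / 2`. -/
def dZbar (f : HalfSpace n → ℂ) (Z : HalfSpace n) : Matrix (Fin n) (Fin n) ℂ :=
  (1 / 2 : ℂ) • (dX f Z + Complex.I • dY f Z)

/-- `K_α = (Z - conj Z) ∂/∂Z + α 1_n`. -/
def opK (α : ℝ) (f : HalfSpace n → ℂ) (Z : HalfSpace n) : Matrix (Fin n) (Fin n) ℂ :=
  Z.subConj * dZ f Z + ((α : ℂ) * f Z) • (1 : Matrix (Fin n) (Fin n) ℂ)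

/-- `Λ_β = (Z - conj Z) ∂/∂(conj Z) - β 1_n`. -/
def opLambda (β : ℝ) (f : HalfSpace n → ℂ) (Z : HalfSpace n) : Matrix (Fin n) (Fin n) ℂ :=
  Z.subConj * dZbar f Z - ((β : ℂ) * f Z) • (1 : Matrix (Fin n) (Fin n) ℂ)

/-- `Ω_{α,β} = Λ_{β-(n+1)/2} K_α + α (β - (n+1)/2) 1_n`, where the product is the product of matrices
of differential operators: its `(j,k)` entry is `∑_l (Λ_{β-(n+1)/2})_{j,l} (K_α)_{l,k}`. -/
def opOmega (α β : ℝ) (f : HalfSpace n → ℂ) (Z : HalfSpace n) : Matrix (Fin n) (Fin n) ℂ :=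
  (Matrix.of fun j k => ∑ l, opLambda (β - (n + 1) / 2) (fun W => opK α f W l k) Z j l) +
    ((α * (β - (n + 1) / 2) : ℝ) * f Z) • (1 : Matrix (Fin n) (Fin n) ℂ)

/-- The Siegel–Maaß Laplacian `Δ_{α,β} = - tr Ω_{α,β}` of weight `(α, β)`. -/
def laplacian (α β : ℝ) (f : HalfSpace n → ℂ) (Z : HalfSpace n) : ℂ :=
  -(opOmega α β f Z).trace

/-! ### Automorphic forms -/

/-- `ℓ γ` is a continuous branch of `log det(C Z + D)` on the half-space, for each `γ`. -/
def IsLogBranch (ℓ : Sp n → HalfSpace n → ℂ) : Prop :=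
  ∀ γ, Continuous (ℓ γ) ∧ ∀ Z, Complex.exp (ℓ γ Z) = (denom γ Z.mat).det

/-- `det(C Z + D)^α det(C (conj Z) + D)^β`, with the powers `e^{α ℓ}` and `e^{β (conj ℓ)}` which are
given by the branch `ℓ` of `log det(C Z + D)`. For integral `α - β` it does not depend on `ℓ`: it is
then equal to `det(C Z + D)^{α-β} |det(C Z + D)|^{2β}`. -/
def autFactor (ℓ : Sp n → HalfSpace n → ℂ) (α β : ℝ) (γ : Sp n) (Z : HalfSpace n) : ℂ :=
  Complex.exp (α * ℓ γ Z) * Complex.exp (β * conj (ℓ γ Z))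

/-- The functions of class `C^r` in the space of automorphic forms of weight `(α, β)` for `Γ`; for
`r = ω` this is the space of real-analytic automorphic forms. -/
structure IsAutomorphicForm (r : WithTop ℕ∞) (Γ : Subgroup (Sp n)) (F : Set (HalfSpace n))
    (ℓ : Sp n → HalfSpace n → ℂ) (α β : ℝ) (φ : HalfSpace n → ℂ) : Prop where
  regular : ContDiffOn ℝ r (ext φ) (Set.range (Subtype.val : HalfSpace n → Sym2 (Fin n) → ℂ))
  automorphy : ∀ γ ∈ Γ, ∀ Z, φ (γ • Z) = autFactor ℓ α β γ Z * φ Z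
  growth : ∀ γ ∈ SpZ n, ∀ Y₀ : Matrix (Fin n) (Fin n) ℝ, Y₀.PosDef → ∃ M : ℝ, 0 < M ∧ ∃ N : ℕ,
    ∀ Z : HalfSpace n, (Z.Y - Y₀).PosSemidef →
      ‖(autFactor ℓ α β γ Z)⁻¹ * φ (γ • Z)‖ ≤ M * Z.Y.trace ^ N
  finite_norm : IntegrableOn (fun Z => Z.Y.det ^ (α + β) * ‖φ Z‖ ^ 2) F (siegelMeasure n)

/-- The support of the form `φ` has compact image in `Γ \ H_n` or, equivalently, it is contained in
the union of the `Γ`-translates of a compact set. -/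
def HasCompactSupportMod (Γ : Subgroup (Sp n)) (φ : HalfSpace n → ℂ) : Prop :=
  ∃ K : Set (HalfSpace n), IsCompact K ∧ ∀ Z, φ Z ≠ 0 → ∃ γ ∈ Γ, γ • Z ∈ K

/-- The integrand `det(Y)^{α+β} φ (conj ψ)` of the inner product. -/
def pairingIntegrand (α β : ℝ) (φ ψ : HalfSpace n → ℂ) (Z : HalfSpace n) : ℂ :=
  (Z.Y.det ^ (α + β) : ℝ) * (φ Z * conj (ψ Z))

/-- The inner product `⟨φ, ψ⟩`, an integral over `Γ \ H_n`, where `F` is a fundamental domain. -/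
def pairing (F : Set (HalfSpace n)) (α β : ℝ) (φ ψ : HalfSpace n → ℂ) : ℂ :=
  ∫ Z in F, pairingIntegrand α β φ ψ Z ∂(siegelMeasure n)

/-- The integrand `det(Y)^{α+β} tr(Λ_β φ · conj(Λ_β ψ))`, where `conj(Λ_β ψ)` is the entrywise
complex conjugate, which is the operator conjugate to `Λ_β` applied to `conj ψ`. -/
def lambdaIntegrand (α β : ℝ) (φ ψ : HalfSpace n → ℂ) (Z : HalfSpace n) : ℂ :=
  (Z.Y.det ^ (α + β) : ℝ) * (opLambda β φ Z * (opLambda β ψ Z).map conj).trace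

end SiegelMaass

end

noncomputable section

namespace SiegelMaass

variable {n : ℕ}

/-! ### The coordinate space -/

/-! The formula is Green's identity for a second-order operator that factors through `Λ_β`. By
definition `tr Ω` is a trace of `Λ K` plus a constant. Exchanging the factors gives `tr Ω_{α,β} = tr
(K_{α-(n+1)/2} Λ_β) + n β (α - (n+1)/2)` (`trace_opOmega`): the second-order terms agree because
second derivatives commute, and the derivatives of `Z - conj Z` produce multiples of `(n+1)/2`,
which the shifts of the parameters absorb.

For the weight `det(Y)^{α+β} dμ_n` the operators `K_{α-(n+1)/2}` and `Λ_β` are formally adjoint. The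
difference of the two integrands is the divergence of an explicit vector field (`sum_dZ_field`),
since `(Z - conj Z) ∂/∂Z` multiplies `det(Y)^s` by `s` and the divergence of `Z - conj Z` is
`(n+1)/2`. Against a compactly supported `C^1` function the divergence integrates to zero, and the
formula follows on the whole half-space (`integral_opOmega_test`), without any automorphy.

The passage to the quotient needs two facts. The first is equivariance. For `Λ_β` it is a direct
computation (`opLambda_smul`), which makes `det(Y)^{α+β} tr(Λ_β φ conj(Λ_β ψ))` invariant
(`lambdaIntegrand_smul`). For `Δ` no computation with `K` is needed: the formula on the half-space
determines `Δφ` weakly through invariant expressions, so `Δφ` inherits the automorphy of `φ`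
(`laplacian_smul`). The invariance of the measure, used here, comes from the Jacobian of the action
(`det_congrMap`, `hasFDerivAt_actCoord`).

The second fact is proper discontinuity (`finite_of_commensurable`). It makes the translates of a
compact set locally finite, so there is a compactly supported `w` whose translates sum to `1` on the
support of `ψ` (`exists_partition`). Replacing `ψ` by `w ψ` turns integrals over a fundamental
domain into integrals over the half-space (`exists_unfolding`), where the formula is known.

The integrals converge because an invariant continuous function supported on the translates of a
compact set is bounded and lives on a part of the domain of finite measure
(`integrableOn_of_invariant`). The same boundedness gives the growth condition for `Δφ`
(`growth_of_bound`). Symmetry results from exchanging `φ` and `ψ` and conjugating: the `Λ`-term is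
Hermitian and the constant is real. -/

/-- The Siegel upper half-space as a subset of the coordinate space. -/
def upper (n : ℕ) : Set (Sym2 (Fin n) → ℂ) :=
  Set.range (Subtype.val : HalfSpace n → Sym2 (Fin n) → ℂ)

theorem mem_upper {z : Sym2 (Fin n) → ℂ} :
    z ∈ upper n ↔ ((symMatrix z).map Complex.im).PosDef := by
  simp [upper]

theorem val_mem_upper (Z : HalfSpace n) : Z.1 ∈ upper n := ⟨Z, rfl⟩

theorem im_symm (z : Sym2 (Fin n) → ℂ) :
    ((symMatrix z).map Complex.im)ᵀ = (symMatrix z).map Complex.im := by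
  rw [← Matrix.transpose_map, symMatrix_transpose]

theorem continuous_symMatrix_im :
    Continuous fun z : Sym2 (Fin n) → ℂ => (symMatrix z).map Complex.im := by
  refine continuous_matrix fun i j => ?_
  simp only [Matrix.map_apply, symMatrix, Matrix.of_apply]
  fun_prop

/-- By homogeneity positive definiteness only has to be tested on the unit sphere. Since the sphere
is compact, strict positivity there persists under small changes of `z`. -/
theorem isOpen_upper : IsOpen (upper n) := by
  have hS : IsCompact (Metric.sphere (0 : Fin n → ℝ) 1) := isCompact_sphere _ _
  have hiff : ∀ z : Sym2 (Fin n) → ℂ, z ∈ upper n ↔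
      ∀ v ∈ Metric.sphere (0 : Fin n → ℝ) 1, 0 < v ⬝ᵥ ((symMatrix z).map Complex.im) *ᵥ v := by
    intro z
    rw [mem_upper, Matrix.posDef_iff_dotProduct_mulVec]
    constructor
    · rintro ⟨-, h⟩ v hv
      have hv0 : v ≠ 0 := by
        rintro rfl
        simp at hv
      simpa using h hv0
    · intro h
      refine ⟨?_, fun {v} hv => ?_⟩
      · rw [Matrix.IsHermitian, Matrix.conjTranspose, im_symm]
        ext i j
        simp
      · have hn : ‖v‖ ≠ 0 := norm_ne_zero_iff.2 hv
        have h1 := h (‖v‖⁻¹ • v) (by simp [norm_smul, hn])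
        rw [Matrix.mulVec_smul, dotProduct_smul, smul_dotProduct] at h1
        have hp : (0 : ℝ) < ‖v‖⁻¹ := by positivity
        simpa using (smul_pos_iff_of_pos_left hp).1 ((smul_pos_iff_of_pos_left hp).1 h1)
  rw [isOpen_iff_eventually]
  intro z hz
  simp only [hiff] at hz ⊢
  refine hS.eventually_forall_of_forall_eventually fun v hv => ?_
  have hc : Continuous fun p : (Sym2 (Fin n) → ℂ) × (Fin n → ℝ) =>
      p.2 ⬝ᵥ ((symMatrix p.1).map Complex.im) *ᵥ p.2 :=
    continuous_snd.dotProduct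
      ((continuous_symMatrix_im.comp continuous_fst).matrix_mulVec continuous_snd)
  exact hc.continuousAt.eventually (lt_mem_nhds (hz v hv))

theorem upper_mem_nhds (Z : HalfSpace n) : upper n ∈ nhds Z.1 :=
  isOpen_upper.mem_nhds (val_mem_upper Z)

theorem ext_val (f : HalfSpace n → ℂ) (Z : HalfSpace n) : ext f Z.1 = f Z :=
  Subtype.val_injective.extend_apply _ _ _

theorem ext_of_notMem (f : HalfSpace n → ℂ) {z : Sym2 (Fin n) → ℂ} (hz : z ∉ upper n) :
    ext f z = 0 :=
  Function.extend_apply' _ _ _ hz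

/-- To compare functions near a point of the half-space, one compares them on the half-space. -/
theorem eventuallyEq_of_upper {β : Type*} {f g : (Sym2 (Fin n) → ℂ) → β} {Z : HalfSpace n}
    (h : ∀ W : HalfSpace n, f W.1 = g W.1) : f =ᶠ[nhds Z.1] g := by
  filter_upwards [upper_mem_nhds Z]
  rintro _ ⟨W, rfl⟩
  exact h W

/-! ### Wirtinger derivatives of real-linear maps -/

/-- The coefficient matrix of the holomorphic part of a real-linear form. -/
def wirt (L : (Sym2 (Fin n) → ℂ) →L[ℝ] ℂ) : Matrix (Fin n) (Fin n) ℂ :=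
  Matrix.of fun j k => (1 + if j = k then 1 else 0) / 4 *
    (L (Pi.single s(j, k) 1) - Complex.I * L (Pi.single s(j, k) Complex.I))

/-- The coefficient matrix of the antiholomorphic part of a real-linear form. -/
def wirtBar (L : (Sym2 (Fin n) → ℂ) →L[ℝ] ℂ) : Matrix (Fin n) (Fin n) ℂ :=
  Matrix.of fun j k => (1 + if j = k then 1 else 0) / 4 *
    (L (Pi.single s(j, k) 1) + Complex.I * L (Pi.single s(j, k) Complex.I))

theorem dZ_eq (f : HalfSpace n → ℂ) (Z : HalfSpace n) :
    dZ f Z = wirt (fderiv ℝ (ext f) Z.1) := by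
  ext j k
  simp only [dZ, dX, dY, wirt, Matrix.smul_apply, Matrix.sub_apply, Matrix.of_apply, smul_eq_mul]
  ring

theorem dZbar_eq (f : HalfSpace n → ℂ) (Z : HalfSpace n) :
    dZbar f Z = wirtBar (fderiv ℝ (ext f) Z.1) := by
  ext j k
  simp only [dZbar, dX, dY, wirtBar, Matrix.smul_apply, Matrix.add_apply, Matrix.of_apply,
    smul_eq_mul]
  ring

theorem wirt_transpose (L : (Sym2 (Fin n) → ℂ) →L[ℝ] ℂ) : (wirt L)ᵀ = wirt L := by
  ext j k
  simp [wirt, Sym2.eq_swap (a := k), eq_comm (a := k)]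

theorem wirtBar_transpose (L : (Sym2 (Fin n) → ℂ) →L[ℝ] ℂ) : (wirtBar L)ᵀ = wirtBar L := by
  ext j k
  simp [wirtBar, Sym2.eq_swap (a := k), eq_comm (a := k)]

/-- An off-diagonal coordinate vector fills two matrix entries and a diagonal one only one. The
factor `1 + δ` in the definition of the operators `∂/∂X` and `∂/∂Y` compensates for this. -/
theorem trace_mul_symMatrix_single {A : Matrix (Fin n) (Fin n) ℂ} (hA : Aᵀ = A) (j k : Fin n)
    (c : ℂ) : (1 + if j = k then 1 else 0) * (A * symMatrix (Pi.single s(j, k) c)).trace =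
      2 * (c * A j k) := by
  have hA' : A k j = A j k := congrFun (congrFun hA j) k
  have hs : symMatrix (Pi.single s(j, k) c) =
      if j = k then Matrix.single j k c else Matrix.single j k c + Matrix.single k j c := by
    ext a b
    by_cases hjk : j = k
    · subst hjk
      simp only [symMatrix, Matrix.of_apply, Pi.single_apply, if_true, Matrix.single_apply,
        Sym2.eq_iff]
      exact if_congr ⟨fun h => by tauto, fun h => by tauto⟩ rfl rfl
    · simp only [symMatrix, Matrix.of_apply, Pi.single_apply, hjk, if_false, Matrix.add_apply,
        Matrix.single_apply, Sym2.eq_iff]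
      grind
  rw [hs]
  by_cases hjk : j = k
  · subst hjk
    simp [Matrix.trace_mul_single]
    ring
  · simp [hjk, Matrix.mul_add, Matrix.trace_mul_single, hA']
    ring

theorem symMatrix_map_conj (z : Sym2 (Fin n) → ℂ) :
    (symMatrix z).map conj = symMatrix fun p => conj (z p) := rfl

theorem symMatrix_conj_single (p : Sym2 (Fin n)) (c : ℂ) :
    (symMatrix (Pi.single p c)).map conj = symMatrix (Pi.single p (conj c)) := by
  rw [symMatrix_map_conj]
  congr 1
  funext q
  by_cases h : q = p
  · subst h
    simp
  · simp [h]

/-- The values at the coordinate vectors times `1` and `i` separate the complex-linear part from the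
antilinear one. Symmetry of `A` and `B` makes them unique, so Wirtinger matrices can be read off
from any formula for the differential. -/
theorem wirt_eq_wirtBar_eq {L : (Sym2 (Fin n) → ℂ) →L[ℝ] ℂ} {A B : Matrix (Fin n) (Fin n) ℂ}
    (hA : Aᵀ = A) (hB : Bᵀ = B)
    (h : ∀ v, L v = (A * symMatrix v).trace + (B * (symMatrix v).map conj).trace) :
    wirt L = A ∧ wirtBar L = B := by
  have key : ∀ (j k : Fin n) (c : ℂ), (1 + if j = k then 1 else 0) * L (Pi.single s(j, k) c) =
      2 * (c * A j k + conj c * B j k) := by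
    intro j k c
    rw [h, symMatrix_conj_single, mul_add, trace_mul_symMatrix_single hA,
      trace_mul_symMatrix_single hB]
    ring
  constructor
  · ext j k
    have h1 := key j k 1
    have h2 := key j k Complex.I
    simp only [map_one, Complex.conj_I] at h1 h2
    simp only [wirt, Matrix.of_apply]
    linear_combination (1 / 4) * h1 - (Complex.I / 4) * h2 - A j k / 2 * Complex.I_sq +
      B j k / 2 * Complex.I_sq
  · ext j k
    have h1 := key j k 1
    have h2 := key j k Complex.I
    simp only [map_one, Complex.conj_I] at h1 h2
    simp only [wirtBar, Matrix.of_apply]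
    linear_combination (1 / 4) * h1 + (Complex.I / 4) * h2 + A j k / 2 * Complex.I_sq -
      B j k / 2 * Complex.I_sq

/-- The real-linear form with given holomorphic and antiholomorphic parts. -/
def wirtForm (A B : Matrix (Fin n) (Fin n) ℂ) : (Sym2 (Fin n) → ℂ) →L[ℝ] ℂ :=
  LinearMap.toContinuousLinearMap
    { toFun := fun v => (A * symMatrix v).trace + (B * (symMatrix v).map conj).trace
      map_add' := fun v w => by
        simp only [Matrix.trace, Matrix.diag, Matrix.mul_apply, symMatrix, Matrix.of_apply,
          Matrix.map_apply, Pi.add_apply, map_add, mul_add, Finset.sum_add_distrib]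
        ring
      map_smul' := fun c v => by
        simp only [Matrix.trace, Matrix.diag, Matrix.mul_apply, symMatrix, Matrix.of_apply,
          Matrix.map_apply, Pi.smul_apply, Complex.real_smul, map_mul, Complex.conj_ofReal,
          RingHom.id_apply, mul_add, Finset.mul_sum]
        congr 1 <;> refine Finset.sum_congr rfl fun i _ => Finset.sum_congr rfl fun j _ => by ring }

theorem wirtForm_apply (A B : Matrix (Fin n) (Fin n) ℂ) (v : Sym2 (Fin n) → ℂ) :
    wirtForm A B v = (A * symMatrix v).trace + (B * (symMatrix v).map conj).trace := rfl

theorem eq_wirtForm (L : (Sym2 (Fin n) → ℂ) →L[ℝ] ℂ) : L = wirtForm (wirt L) (wirtBar L) := by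
  apply ContinuousLinearMap.coe_injective
  refine LinearMap.pi_ext fun p c => ?_
  induction p using Sym2.ind with
  | _ j k =>
    have hc : Pi.single s(j, k) c = c.re • Pi.single (M := fun _ => ℂ) s(j, k) (1 : ℂ) +
        c.im • Pi.single (M := fun _ => ℂ) s(j, k) Complex.I := by
      funext q
      by_cases h : q = s(j, k)
      · subst h
        simp [Complex.re_add_im]
      · simp [h]
    have h2 : (1 + if j = k then 1 else 0 : ℂ) ≠ 0 := by
      split_ifs <;> norm_num
    apply mul_left_cancel₀ h2
    change _ * L _ = _ * wirtForm _ _ _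
    rw [wirtForm_apply, symMatrix_conj_single, mul_add,
      trace_mul_symMatrix_single (wirt_transpose L),
      trace_mul_symMatrix_single (wirtBar_transpose L), hc]
    simp only [map_add, map_smul, wirt, wirtBar, Matrix.of_apply, Complex.real_smul]
    nth_rewrite 3 [← Complex.re_add_im c]
    nth_rewrite 5 [← Complex.re_add_im c]
    simp only [map_add, map_mul, Complex.conj_ofReal, Complex.conj_I]
    ring_nf
    simp only [Complex.I_sq]
    ring

theorem apply_eq_wirt (L : (Sym2 (Fin n) → ℂ) →L[ℝ] ℂ) (v : Sym2 (Fin n) → ℂ) :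
    L v = (wirt L * symMatrix v).trace + (wirtBar L * (symMatrix v).map conj).trace := by
  rw [← wirtForm_apply, ← eq_wirtForm]

theorem wirt_add (L M : (Sym2 (Fin n) → ℂ) →L[ℝ] ℂ) : wirt (L + M) = wirt L + wirt M := by
  ext j k
  simp only [wirt, Matrix.of_apply, Matrix.add_apply, _root_.add_apply]
  ring

theorem wirtBar_add (L M : (Sym2 (Fin n) → ℂ) →L[ℝ] ℂ) :
    wirtBar (L + M) = wirtBar L + wirtBar M := by
  ext j k
  simp only [wirtBar, Matrix.of_apply, Matrix.add_apply, _root_.add_apply]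
  ring

theorem wirt_smul (c : ℂ) (L : (Sym2 (Fin n) → ℂ) →L[ℝ] ℂ) : wirt (c • L) = c • wirt L := by
  ext j k
  simp only [wirt, Matrix.of_apply, Matrix.smul_apply, _root_.smul_apply, smul_eq_mul]
  ring

theorem wirtBar_smul (c : ℂ) (L : (Sym2 (Fin n) → ℂ) →L[ℝ] ℂ) :
    wirtBar (c • L) = c • wirtBar L := by
  ext j k
  simp only [wirtBar, Matrix.of_apply, Matrix.smul_apply, _root_.smul_apply,
    smul_eq_mul]
  ring

theorem wirt_zero : wirt (0 : (Sym2 (Fin n) → ℂ) →L[ℝ] ℂ) = 0 := by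
  ext j k
  simp [wirt]

theorem wirtBar_zero : wirtBar (0 : (Sym2 (Fin n) → ℂ) →L[ℝ] ℂ) = 0 := by
  ext j k
  simp [wirtBar]

/-! ### The congruence `H ↦ A H Aᵗ` on symmetric matrices -/

/-- The map `H ↦ A H Aᵗ` on symmetric matrices, in coordinates. -/
def congrMap (A : Matrix (Fin n) (Fin n) ℂ) : (Sym2 (Fin n) → ℂ) →ₗ[ℂ] (Sym2 (Fin n) → ℂ) where
  toFun v p := (A * symMatrix v * Aᵀ) (Quot.out p).1 (Quot.out p).2
  map_add' v w := by
    funext p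
    rw [show symMatrix (v + w) = symMatrix v + symMatrix w from rfl, Matrix.mul_add, Matrix.add_mul]
    rfl
  map_smul' c v := by
    funext p
    rw [show symMatrix (c • v) = c • symMatrix v from rfl, Matrix.mul_smul, Matrix.smul_mul]
    rfl

/-- A symmetric matrix does not depend on how the unordered pairs of indices are ordered. -/
theorem symMatrix_out {M : Matrix (Fin n) (Fin n) ℂ} (hM : Mᵀ = M) :
    symMatrix (fun p => M (Quot.out p).1 (Quot.out p).2) = M := by
  ext j k
  simp only [symMatrix, Matrix.of_apply]
  have h : s((Quot.out s(j, k)).1, (Quot.out s(j, k)).2) = s(j, k) := Quot.out_eq s(j, k)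
  rcases Sym2.eq_iff.1 h with ⟨h1, h2⟩ | ⟨h1, h2⟩
  · rw [h1, h2]
  · rw [h1, h2]
    exact congrFun (congrFun hM j) k

theorem symMatrix_congrMap (A : Matrix (Fin n) (Fin n) ℂ) (v : Sym2 (Fin n) → ℂ) :
    symMatrix (congrMap A v) = A * symMatrix v * Aᵀ :=
  symMatrix_out (M := A * symMatrix v * Aᵀ) (by
    rw [Matrix.transpose_mul, Matrix.transpose_mul, Matrix.transpose_transpose,
      symMatrix_transpose, Matrix.mul_assoc])

theorem congrMap_mul (A B : Matrix (Fin n) (Fin n) ℂ) :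
    congrMap (A * B) = congrMap A ∘ₗ congrMap B := by
  refine LinearMap.ext fun v => ?_
  apply symMatrix_injective
  simp only [LinearMap.comp_apply, symMatrix_congrMap, Matrix.transpose_mul, Matrix.mul_assoc]

theorem congrMap_one : congrMap (1 : Matrix (Fin n) (Fin n) ℂ) = LinearMap.id := by
  refine LinearMap.ext fun v => ?_
  apply symMatrix_injective
  simp [symMatrix_congrMap]

/-- Among the pairs `j ≤ k`, indexed from `0`, a given index occurs `n - j` times in the first place
and `j + 1` times in the second, hence `n + 1` times in all. -/
theorem prod_sym2_mul (d : Fin n → ℂ) :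
    ∏ p : Sym2 (Fin n), d (Quot.out p).1 * d (Quot.out p).2 = (∏ j, d j) ^ (n + 1) := by
  have h1 : ∀ p : Sym2 (Fin n), d (Quot.out p).1 * d (Quot.out p).2 =
      d (Sym2.sortEquiv p).1.1 * d (Sym2.sortEquiv p).1.2 := by
    intro p
    have e1 : s((Quot.out p).1, (Quot.out p).2) = p := Quot.out_eq p
    have e2 : s((Sym2.sortEquiv p).1.1, (Sym2.sortEquiv p).1.2) = p :=
      Sym2.sortEquiv.symm_apply_apply p
    rcases Sym2.eq_iff.1 (e1.trans e2.symm) with ⟨h1, h2⟩ | ⟨h1, h2⟩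
    · rw [h1, h2]
    · rw [h1, h2, mul_comm]
  rw [Finset.prod_congr rfl fun p _ => h1 p,
    Sym2.sortEquiv.prod_comp fun q : {p : Fin n × Fin n // p.1 ≤ p.2} => d q.1.1 * d q.1.2,
    ← Finset.prod_subtype (Finset.univ.filter fun q : Fin n × Fin n => q.1 ≤ q.2) (by simp)
      (fun q : Fin n × Fin n => d q.1 * d q.2), Finset.prod_mul_distrib]
  have h2 : ∏ q ∈ Finset.univ.filter (fun q : Fin n × Fin n => q.1 ≤ q.2), d q.1 =
      ∏ j, d j ^ (n - j : ℕ) := by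
    rw [Finset.prod_filter, Fintype.prod_prod_type]
    refine Finset.prod_congr rfl fun j _ => ?_
    rw [← Finset.prod_filter]
    dsimp only
    rw [Finset.prod_const]
    congr 1
    rw [show (Finset.univ.filter fun k => j ≤ k) = Finset.Ici j by ext; simp, Fin.card_Ici]
  have h3 : ∏ q ∈ Finset.univ.filter (fun q : Fin n × Fin n => q.1 ≤ q.2), d q.2 =
      ∏ j, d j ^ (j + 1 : ℕ) := by
    rw [Finset.prod_filter, Fintype.prod_prod_type_right]
    refine Finset.prod_congr rfl fun j _ => ?_
    rw [← Finset.prod_filter]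
    dsimp only
    rw [Finset.prod_const]
    congr 1
    rw [show (Finset.univ.filter fun k => k ≤ j) = Finset.Iic j by ext; simp, Fin.card_Iic]
  rw [h2, h3, ← Finset.prod_mul_distrib, ← Finset.prod_pow]
  refine Finset.prod_congr rfl fun j _ => ?_
  rw [← pow_add]
  congr 1
  omega

theorem det_congrMap_diagonal (d : Fin n → ℂ) :
    LinearMap.det (congrMap (Matrix.diagonal d)) = (Matrix.diagonal d).det ^ (n + 1) := by
  have h : congrMap (Matrix.diagonal d) =
      Matrix.toLin' (Matrix.diagonal fun p : Sym2 (Fin n) =>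
        d (Quot.out p).1 * d (Quot.out p).2) := by
    refine LinearMap.ext fun v => funext fun p => ?_
    rw [Matrix.toLin'_apply, Matrix.mulVec_diagonal]
    have e1 : s((Quot.out p).1, (Quot.out p).2) = p := Quot.out_eq p
    simp only [congrMap, LinearMap.coe_mk, AddHom.coe_mk, Matrix.diagonal_transpose,
      Matrix.mul_diagonal, Matrix.diagonal_mul, symMatrix, Matrix.of_apply, e1]
    ring
  rw [h, LinearMap.det_toLin', Matrix.det_diagonal, Matrix.det_diagonal, prod_sym2_mul]

/-- The determinant is multiplicative in the parameter `c`, and conjugation by a diagonal matrix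
turns `c` into `2c`. Its value `x` therefore satisfies `x = x ^ 2` and is not zero. -/
theorem det_congrMap_transvection {i j : Fin n} (hij : i ≠ j) (c : ℂ) :
    LinearMap.det (congrMap (Matrix.transvection i j c)) = 1 := by
  have hadd : ∀ a b : ℂ, LinearMap.det (congrMap (Matrix.transvection i j (a + b))) =
      LinearMap.det (congrMap (Matrix.transvection i j a)) *
        LinearMap.det (congrMap (Matrix.transvection i j b)) := by
    intro a b
    rw [← Matrix.transvection_mul_transvection_same i j hij, congrMap_mul, LinearMap.det_comp]
  have hne : LinearMap.det (congrMap (Matrix.transvection i j c)) ≠ 0 := by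
    intro h0
    have := hadd c (-c)
    rw [h0, add_neg_cancel, Matrix.transvection_zero, congrMap_one, LinearMap.det_id, zero_mul]
      at this
    exact one_ne_zero this
  -- Doubling the `i`-th coordinate intertwines the transvections with parameters `c` and `2c`.
  set d : Fin n → ℂ := fun k => if k = i then 2 else 1 with hd
  have hdet : (Matrix.diagonal d).det ≠ 0 := by
    rw [Matrix.det_diagonal]
    refine Finset.prod_ne_zero_iff.2 fun k _ => ?_
    simp only [hd]
    split_ifs <;> norm_num
  have hconj : Matrix.diagonal d * Matrix.transvection i j c =
      Matrix.transvection i j (c + c) * Matrix.diagonal d := by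
    ext a b
    simp only [Matrix.diagonal_mul, Matrix.mul_diagonal, Matrix.transvection, Matrix.add_apply,
      Matrix.one_apply, Matrix.single_apply, hd]
    by_cases ha : a = i <;> by_cases hb : b = j <;> by_cases hab : a = b <;>
      simp_all [eq_comm]
    all_goals ring
  have h := congrArg (fun M => LinearMap.det (congrMap M)) hconj
  simp only [congrMap_mul, LinearMap.det_comp, det_congrMap_diagonal, hadd] at h
  rw [mul_comm] at h
  have h' := mul_right_cancel₀ (pow_ne_zero _ hdet) h
  exact (mul_left_cancel₀ hne (by rw [← h', mul_one])).symm

/-- Both sides are multiplicative in `A`, so diagonal matrices and transvections suffice. The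
exponent `n + 1` is the one that makes `det(Y)^{-(n+1)}` the invariant density. -/
theorem det_congrMap {A : Matrix (Fin n) (Fin n) ℂ} (hA : A.det ≠ 0) :
    LinearMap.det (congrMap A) = A.det ^ (n + 1) := by
  refine Matrix.diagonal_transvection_induction_of_det_ne_zero
    (fun A => LinearMap.det (congrMap A) = A.det ^ (n + 1)) A hA
    (fun d _ => det_congrMap_diagonal d) (fun t => ?_) (fun A B _ _ h1 h2 => ?_)
  · rw [Matrix.TransvectionStruct.toMatrix, det_congrMap_transvection t.hij,
      Matrix.det_transvection_of_ne _ _ t.hij, one_pow]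
  · rw [congrMap_mul, LinearMap.det_comp, h1, h2, Matrix.det_mul, mul_pow]

/-! ### Smoothness of determinants and inverses -/

theorem contDiffAt_det {V : Type*} [NormedAddCommGroup V] [NormedSpace ℝ V] {r : WithTop ℕ∞}
    {M : V → Matrix (Fin n) (Fin n) ℂ} {x : V}
    (hM : ∀ i j, ContDiffAt ℝ r (fun v => M v i j) x) :
    ContDiffAt ℝ r (fun v => (M v).det) x := by
  simp only [Matrix.det_apply']
  exact ContDiffAt.sum fun σ _ => contDiffAt_const.mul (contDiffAt_prod fun i _ => hM _ _)

theorem contDiffAt_inv_apply {V : Type*} [NormedAddCommGroup V] [NormedSpace ℝ V] {r : WithTop ℕ∞}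
    {M : V → Matrix (Fin n) (Fin n) ℂ} {x : V}
    (hM : ∀ i j, ContDiffAt ℝ r (fun v => M v i j) x) (hx : (M x).det ≠ 0) (i j : Fin n) :
    ContDiffAt ℝ r (fun v => (M v)⁻¹ i j) x := by
  simp only [Matrix.inv_def, Matrix.smul_apply, Ring.inverse_eq_inv', smul_eq_mul,
    Matrix.adjugate_apply]
  refine ((contDiffAt_det hM).inv hx).mul (contDiffAt_det fun a b => ?_)
  by_cases ha : a = j
  · subst ha
    simpa using contDiffAt_const
  · simpa [Matrix.updateRow_apply, ha] using hM a b

theorem contDiffAt_mul_apply {V : Type*} [NormedAddCommGroup V] [NormedSpace ℝ V] {r : WithTop ℕ∞}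
    {M N : V → Matrix (Fin n) (Fin n) ℂ} {x : V}
    (hM : ∀ i j, ContDiffAt ℝ r (fun v => M v i j) x)
    (hN : ∀ i j, ContDiffAt ℝ r (fun v => N v i j) x) (i j : Fin n) :
    ContDiffAt ℝ r (fun v => (M v * N v) i j) x := by
  simp only [Matrix.mul_apply]
  exact ContDiffAt.sum fun k _ => (hM i k).mul (hN k j)

theorem contDiff_symMatrix_apply {r : WithTop ℕ∞} (i j : Fin n) :
    ContDiff ℝ r fun z : Sym2 (Fin n) → ℂ => symMatrix z i j := by
  simp only [symMatrix, Matrix.of_apply]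
  exact contDiff_apply ℝ ℂ _

theorem contDiffAt_affine_apply {r : WithTop ℕ∞} (A B : Matrix (Fin n) (Fin n) ℂ)
    (z : Sym2 (Fin n) → ℂ) (i j : Fin n) :
    ContDiffAt ℝ r (fun z : Sym2 (Fin n) → ℂ => (A * symMatrix z + B) i j) z := by
  simp only [Matrix.add_apply]
  exact (contDiffAt_mul_apply (M := fun _ => A) (fun _ _ => contDiffAt_const)
    (fun a b => (contDiff_symMatrix_apply a b).contDiffAt) i j).add contDiffAt_const

/-- Jacobi's formula. -/
theorem hasDerivAt_det_add_smul {M : Matrix (Fin n) (Fin n) ℂ} (hM : M.det ≠ 0)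
    (N : Matrix (Fin n) (Fin n) ℂ) :
    HasDerivAt (fun t : ℝ => (M + (t : ℂ) • N).det) (M.det * (M⁻¹ * N).trace) 0 := by
  have hu : IsUnit M.det := isUnit_iff_ne_zero.2 hM
  have h1 : ∀ t : ℝ, (M + (t : ℂ) • N).det = M.det * (1 + (t : ℂ) • (M⁻¹ * N)).det := by
    intro t
    rw [← Matrix.det_mul, Matrix.mul_add, Matrix.mul_one, Matrix.mul_smul, ← Matrix.mul_assoc,
      Matrix.mul_nonsing_inv _ hu, Matrix.one_mul]
  rw [funext h1]
  refine HasDerivAt.const_mul _ ?_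
  -- The determinant is `1 + t tr(M⁻¹N) + t² p(t)` with a polynomial `p`, so only the trace survives
  -- in the derivative at `0`.
  rw [funext fun t : ℝ => Matrix.det_one_add_smul (t : ℂ) (M⁻¹ * N)]
  set p := (det (1 + (Polynomial.X : Polynomial ℂ) • (M⁻¹ * N).map Polynomial.C)).divX.divX
  have h2 : HasDerivAt (fun t : ℂ => 1 + (M⁻¹ * N).trace * t + p.eval t * t ^ 2)
      (M⁻¹ * N).trace ((0 : ℝ) : ℂ) := by
    have h3 := (((hasDerivAt_id ((0 : ℝ) : ℂ)).const_mul (M⁻¹ * N).trace).const_add 1).add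
      ((p.hasDerivAt ((0 : ℝ) : ℂ)).mul ((hasDerivAt_id ((0 : ℝ) : ℂ)).pow 2))
    convert! h3 using 1
    simp
  exact h2.comp_ofReal

/-- Once differentiability is known, a differential can be computed along lines, where the
determinant becomes a polynomial in one variable. -/
theorem fderiv_apply_of_line {f : (Sym2 (Fin n) → ℂ) → ℂ} {z v : Sym2 (Fin n) → ℂ} {c : ℂ}
    (hf : DifferentiableAt ℝ f z) (hc : HasDerivAt (fun t : ℝ => f (z + t • v)) c 0) :
    fderiv ℝ f z v = c := by
  have h1 := (hf.hasFDerivAt.hasLineDerivAt v).lineDeriv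
  have h2 : HasLineDerivAt ℝ f c z v := hc
  rw [← h1, h2.lineDeriv]

theorem symMatrix_add_smul (z v : Sym2 (Fin n) → ℂ) (t : ℝ) :
    symMatrix (z + t • v) = symMatrix z + (t : ℂ) • symMatrix v := by
  ext i j
  simp [symMatrix]

theorem fderiv_det_affine (A B : Matrix (Fin n) (Fin n) ℂ) {z : Sym2 (Fin n) → ℂ}
    (hz : (A * symMatrix z + B).det ≠ 0) (v : Sym2 (Fin n) → ℂ) :
    fderiv ℝ (fun z => (A * symMatrix z + B).det) z v =
      (A * symMatrix z + B).det * ((A * symMatrix z + B)⁻¹ * (A * symMatrix v)).trace := by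
  refine fderiv_apply_of_line
    ((contDiffAt_det (contDiffAt_affine_apply (r := 1) A B z)).differentiableAt one_ne_zero) ?_
  have h : ∀ t : ℝ, A * symMatrix (z + t • v) + B =
      (A * symMatrix z + B) + (t : ℂ) • (A * symMatrix v) := by
    intro t
    rw [symMatrix_add_smul, Matrix.mul_add, Matrix.mul_smul]
    abel
  simp only [h]
  exact hasDerivAt_det_add_smul hz _

/-! ### The action in coordinates -/

theorem det_denom_ne_zero (γ : Sp n) (Z : HalfSpace n) : (denom γ Z.mat).det ≠ 0 :=
  (isUnit_det_denom γ Z).ne_zero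

theorem mat_transpose (Z : HalfSpace n) : Z.matᵀ = Z.mat := symMatrix_transpose _

/-- The action of `γ` in coordinates. -/
def actCoord (γ : Sp n) (z : Sym2 (Fin n) → ℂ) : Sym2 (Fin n) → ℂ := fun p =>
  (numer γ (symMatrix z) * (denom γ (symMatrix z))⁻¹) (Quot.out p).1 (Quot.out p).2

theorem actCoord_val (γ : Sp n) (Z : HalfSpace n) : actCoord γ Z.1 = (γ • Z).1 := by
  apply symMatrix_injective
  have h : (numer γ Z.mat * (denom γ Z.mat)⁻¹)ᵀ = numer γ Z.mat * (denom γ Z.mat)⁻¹ := by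
    rw [← smul_mat, mat_transpose]
  exact (symMatrix_out h).trans (smul_mat γ Z).symm

theorem contDiffAt_denom_apply {r : WithTop ℕ∞} (γ : Sp n) (z : Sym2 (Fin n) → ℂ) (i j : Fin n) :
    ContDiffAt ℝ r (fun z => denom γ (symMatrix z) i j) z :=
  contDiffAt_affine_apply _ _ z i j

theorem contDiffAt_actCoord {r : WithTop ℕ∞} (γ : Sp n) (Z : HalfSpace n) :
    ContDiffAt ℝ r (actCoord γ) Z.1 :=
  contDiffAt_pi.2 fun _ => contDiffAt_mul_apply (fun i j => contDiffAt_affine_apply _ _ _ i j)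
    (fun i j => contDiffAt_inv_apply (contDiffAt_denom_apply γ _) (det_denom_ne_zero γ Z) i j) _ _

theorem continuous_smul_halfSpace (γ : Sp n) : Continuous fun Z : HalfSpace n => γ • Z := by
  rw [continuous_induced_rng, continuous_iff_continuousAt]
  intro Z
  have h : (Subtype.val ∘ fun Z : HalfSpace n => γ • Z) = actCoord γ ∘ Subtype.val := by
    funext W
    exact (actCoord_val γ W).symm
  rw [h]
  exact ((contDiffAt_actCoord (r := 1) γ Z).continuousAt).comp continuous_subtype_val.continuousAt

instance : ContinuousConstSMul (Sp n) (HalfSpace n) := ⟨continuous_smul_halfSpace⟩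

/-- `(C W + D)ᵗ (γZ - γW) (C Z + D) = Z - W`. -/
theorem denom_smul_sub (γ : Sp n) (W Z : HalfSpace n) :
    (denom γ W.mat)ᵀ * ((γ • Z).mat - (γ • W).mat) * denom γ Z.mat = Z.mat - W.mat := by
  have hZ : (γ • Z).mat * denom γ Z.mat = numer γ Z.mat := by
    rw [smul_mat, Matrix.mul_assoc, Matrix.nonsing_inv_mul _ (isUnit_det_denom γ Z),
      Matrix.mul_one]
  have hW : (denom γ W.mat)ᵀ * (γ • W).mat = (numer γ W.mat)ᵀ := by
    rw [← mat_transpose (γ • W), ← Matrix.transpose_mul, smul_mat, Matrix.mul_assoc,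
      Matrix.nonsing_inv_mul _ (isUnit_det_denom γ W), Matrix.mul_one]
  rw [Matrix.mul_sub, Matrix.sub_mul, Matrix.mul_assoc, hZ, hW]
  exact denom_numer γ _ _ (mat_transpose W)

/-- An exact formula for increments of the action. It replaces the quotient rule in
`hasFDerivAt_actCoord`. -/
theorem smul_sub_eq (γ : Sp n) (W Z : HalfSpace n) :
    (γ • Z).mat - (γ • W).mat =
      ((denom γ W.mat)⁻¹)ᵀ * (Z.mat - W.mat) * (denom γ Z.mat)⁻¹ := by
  have hu : IsUnit (denom γ W.mat)ᵀ.det := by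
    rw [Matrix.det_transpose]
    exact isUnit_det_denom γ W
  rw [← denom_smul_sub γ W Z, Matrix.transpose_nonsing_inv, Matrix.mul_assoc, Matrix.mul_assoc,
    Matrix.mul_nonsing_inv _ (isUnit_det_denom γ Z), Matrix.mul_one, ← Matrix.mul_assoc,
    Matrix.nonsing_inv_mul _ hu, Matrix.one_mul]

/-- `(C (conj Z) + D)ᵗ (γZ - conj γZ) (C Z + D) = Z - conj Z`. -/
theorem denom_subConj (γ : Sp n) (Z : HalfSpace n) :
    ((denom γ Z.mat).map conj)ᵀ * (γ • Z).subConj * denom γ Z.mat = Z.subConj := by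
  have hZ : (γ • Z).mat * denom γ Z.mat = numer γ Z.mat := by
    rw [smul_mat, Matrix.mul_assoc, Matrix.nonsing_inv_mul _ (isUnit_det_denom γ Z),
      Matrix.mul_one]
  have hW : ((denom γ Z.mat).map conj)ᵀ * (γ • Z).mat.map conj = ((numer γ Z.mat).map conj)ᵀ := by
    rw [← hZ, Matrix.map_mul, Matrix.transpose_mul, ← Matrix.transpose_map (M := (γ • Z).mat),
      mat_transpose]
  rw [HalfSpace.subConj, Matrix.mul_sub, Matrix.sub_mul, Matrix.mul_assoc, hZ, hW, ← denom_conj,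
    ← numer_conj]
  exact denom_numer γ _ _ (map_conj_symm Z)

theorem subConj_transpose (Z : HalfSpace n) : Z.subConjᵀ = Z.subConj := by
  rw [HalfSpace.subConj, Matrix.transpose_sub, mat_transpose, map_conj_symm]

theorem denom_subConj' (γ : Sp n) (Z : HalfSpace n) :
    (denom γ Z.mat)ᵀ * (γ • Z).subConj * (denom γ Z.mat).map conj = Z.subConj := by
  have h := congrArg Matrix.transpose (denom_subConj γ Z)
  rwa [Matrix.transpose_mul, Matrix.transpose_mul, Matrix.transpose_transpose, subConj_transpose,
    subConj_transpose, ← Matrix.mul_assoc] at h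

theorem det_map_conj (M : Matrix (Fin n) (Fin n) ℂ) : (M.map conj).det = conj M.det :=
  ((starRingEnd ℂ).map_det M).symm

theorem det_Y_pos (Z : HalfSpace n) : 0 < Z.Y.det := Matrix.PosDef.det_pos Z.2

theorem det_subConj (Z : HalfSpace n) : Z.subConj.det = (2 * Complex.I) ^ n * (Z.Y.det : ℂ) := by
  rw [subConj_eq, Matrix.det_smul, Fintype.card_fin]
  congr 1
  exact (Complex.ofRealHom.map_det Z.Y).symm

/-- Take determinants in `denom_subConj`. The factor `(2i)^n`, which comes from `Z - conj Z = 2iY`,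
cancels. -/
theorem det_Y_smul (γ : Sp n) (Z : HalfSpace n) :
    ‖(denom γ Z.mat).det‖ ^ 2 * (γ • Z).Y.det = Z.Y.det := by
  have h := congrArg Matrix.det (denom_subConj γ Z)
  rw [Matrix.det_mul, Matrix.det_mul, Matrix.det_transpose, det_map_conj, det_subConj,
    det_subConj] at h
  have h2 : ((2 * Complex.I) ^ n) ≠ 0 := by simp
  apply Complex.ofReal_injective
  apply mul_left_cancel₀ h2
  rw [← h]
  push_cast
  rw [← Complex.conj_mul']
  ring

/-- The congruence map as a continuous real-linear map. -/
def congrCLM (A : Matrix (Fin n) (Fin n) ℂ) : (Sym2 (Fin n) → ℂ) →L[ℝ] (Sym2 (Fin n) → ℂ) :=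
  LinearMap.toContinuousLinearMap ((congrMap A).restrictScalars ℝ)

theorem congrCLM_apply (A : Matrix (Fin n) (Fin n) ℂ) (v : Sym2 (Fin n) → ℂ) :
    congrCLM A v = congrMap A v := rfl

theorem continuousAt_mul_inv_denom (A : Matrix (Fin n) (Fin n) ℂ) (γ : Sp n) (Z : HalfSpace n)
    (i j : Fin n) : ContinuousAt (fun z => (A * (denom γ (symMatrix z))⁻¹) i j) Z.1 :=
  (contDiffAt_mul_apply (r := 1) (M := fun _ => A) (fun _ _ => contDiffAt_const)
    (fun a b => contDiffAt_inv_apply (contDiffAt_denom_apply γ _) (det_denom_ne_zero γ Z) a b)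
    i j).continuousAt

/-- In the increment formula with `W = Z + tv`, division by `t` leaves `(CZ+D)^{-t} v (CW+D)^{-1}`,
which converges by continuity of the inverse. Smoothness of the action is already known, so
directional limits determine the differential. -/
theorem hasFDerivAt_actCoord (γ : Sp n) (Z : HalfSpace n) :
    HasFDerivAt (actCoord γ) (congrCLM ((denom γ Z.mat)⁻¹)ᵀ) Z.1 := by
  have hd := (contDiffAt_actCoord (r := 1) γ Z).differentiableAt one_ne_zero
  convert! hd.hasFDerivAt using 1
  refine ContinuousLinearMap.ext fun v => ?_
  have h1 := hasDerivAt_iff_tendsto_slope_zero.1 (hd.hasFDerivAt.hasLineDerivAt v)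
  have hline : Continuous fun t : ℝ => Z.1 + t • v := by fun_prop
  have hU : ∀ᶠ t : ℝ in nhds 0, Z.1 + t • v ∈ upper n := by
    refine hline.continuousAt.eventually_mem ?_
    simpa using upper_mem_nhds Z
  have h2 : Filter.Tendsto (fun t : ℝ => (fun p => ((denom γ Z.mat)⁻¹ᵀ * symMatrix v *
      (denom γ (symMatrix (Z.1 + t • v)))⁻¹) (Quot.out p).1 (Quot.out p).2 : Sym2 (Fin n) → ℂ))
      (nhds 0) (nhds (congrCLM ((denom γ Z.mat)⁻¹)ᵀ v)) := by
    rw [tendsto_pi_nhds]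
    intro p
    have hlim : Filter.Tendsto (fun t : ℝ => Z.1 + t • v) (nhds 0) (nhds Z.1) := by
      simpa using hline.tendsto 0
    have h3 := (continuousAt_mul_inv_denom ((denom γ Z.mat)⁻¹ᵀ * symMatrix v) γ Z
      (Quot.out p).1 (Quot.out p).2).tendsto.comp hlim
    have h4 : congrCLM ((denom γ Z.mat)⁻¹)ᵀ v p = ((denom γ Z.mat)⁻¹ᵀ * symMatrix v *
        (denom γ (symMatrix Z.1))⁻¹) (Quot.out p).1 (Quot.out p).2 := rfl
    rw [h4]
    exact h3
  -- Near `t = 0` the perturbed point stays in the half-space, so the slope equals the explicit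
  -- expression for `t ≠ 0`.
  refine (tendsto_nhds_unique (h1.congr' ?_) (h2.mono_left nhdsWithin_le_nhds)).symm
  filter_upwards [nhdsWithin_le_nhds hU, self_mem_nhdsWithin] with t ht ht0
  obtain ⟨(W : HalfSpace n), hW⟩ := ht
  have ht0' : (t : ℂ) ≠ 0 := by simpa using ht0
  have h4 := smul_sub_eq γ Z W
  have h5 : W.mat - Z.mat = (t : ℂ) • symMatrix v := by
    rw [HalfSpace.mat, hW, symMatrix_add_smul, HalfSpace.mat]
    abel
  have h6 : W.mat = symMatrix (Z.1 + t • v) := by rw [← hW]; rfl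
  rw [h5] at h4
  funext p
  have h7 := congrFun (congrFun h4 (Quot.out p).1) (Quot.out p).2
  have h8 : ∀ V : HalfSpace n, V.mat (Quot.out p).1 (Quot.out p).2 = V.1 p := by
    intro V
    change V.1 s((Quot.out p).1, (Quot.out p).2) = V.1 p
    rw [show s((Quot.out p).1, (Quot.out p).2) = p from Quot.out_eq p]
  rw [Matrix.sub_apply, h8, h8, Matrix.mul_smul, Matrix.smul_mul, Matrix.smul_apply, h6] at h7
  simp only [zero_add, zero_smul, add_zero, ← hW, actCoord_val, Pi.smul_apply, Pi.sub_apply]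
  rw [h7, Complex.real_smul, smul_eq_mul, ← mul_assoc, Complex.ofReal_inv, inv_mul_cancel₀ ht0',
    one_mul, hW]

/-- The real determinant of a complex-linear map is the squared modulus of its complex determinant.
-/
theorem det_congrCLM {A : Matrix (Fin n) (Fin n) ℂ} (hA : A.det ≠ 0) :
    (congrCLM A).det = (‖A.det‖ ^ 2) ^ (n + 1) := by
  have h : (congrCLM A).det = LinearMap.det ((congrMap A).restrictScalars ℝ) := rfl
  rw [h, LinearMap.det_restrictScalars, det_congrMap hA, Algebra.norm_complex_apply,
    Complex.normSq_eq_norm_sq, norm_pow, ← pow_mul, ← pow_mul, mul_comm]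

/-! ### The invariant measure -/

theorem measurableSet_upper : MeasurableSet (upper n) := isOpen_upper.measurableSet

theorem measurableSet_posDef :
    MeasurableSet {z : Sym2 (Fin n) → ℂ | ((symMatrix z).map Complex.im).PosDef} := by
  convert! measurableSet_upper (n := n) using 1
  ext z
  exact mem_upper.symm

instance : BorelSpace (HalfSpace n) := inferInstance

/-- The density of the invariant measure in coordinates. -/
def density (z : Sym2 (Fin n) → ℂ) : ℝ := (((symMatrix z).map Complex.im).det ^ (n + 1))⁻¹

theorem siegelMeasure_apply {s : Set (HalfSpace n)} (hs : MeasurableSet s) :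
    siegelMeasure n s = ∫⁻ z in Subtype.val '' s, ENNReal.ofReal (density z) := by
  rw [siegelMeasure, withDensity_apply _ hs]
  exact setLIntegral_subtype measurableSet_posDef s (fun z => ENNReal.ofReal (density z))

/-- The Jacobian `|det(CZ+D)|^{-2(n+1)}` of the action cancels the change of `det(Y)^{-(n+1)}` under
`Y(γZ) = Im(γZ)`, whose determinant is `|det(CZ+D)|^{-2} det(Y)`. -/
theorem siegelMeasure_preimage_smul (γ : Sp n) {s : Set (HalfSpace n)} (hs : MeasurableSet s) :
    siegelMeasure n ((fun Z => γ • Z) ⁻¹' s) = siegelMeasure n s := by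
  have hm : MeasurableSet ((fun Z : HalfSpace n => γ • Z) ⁻¹' s) :=
    (continuous_smul_halfSpace γ).measurable hs
  set t := (fun Z : HalfSpace n => γ • Z) ⁻¹' s with ht
  have himg : Subtype.val '' s = actCoord γ '' (Subtype.val '' t) := by
    ext z
    constructor
    · rintro ⟨W, hW, rfl⟩
      refine ⟨(γ⁻¹ • W).1, ⟨γ⁻¹ • W, ?_, rfl⟩, ?_⟩
      · simpa [ht] using hW
      · rw [actCoord_val, smul_inv_smul]
    · rintro ⟨_, ⟨W, hW, rfl⟩, rfl⟩
      exact ⟨γ • W, hW, (actCoord_val γ W).symm⟩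
  have hval : MeasurableSet (Subtype.val '' t : Set (Sym2 (Fin n) → ℂ)) :=
    (MeasurableEmbedding.subtype_coe measurableSet_posDef).measurableSet_image.2 hm
  have hinj : Set.InjOn (actCoord γ) (Subtype.val '' t) := by
    rintro _ ⟨W, -, rfl⟩ _ ⟨V, -, rfl⟩ h
    rw [actCoord_val, actCoord_val] at h
    rw [MulAction.injective γ (Subtype.ext h)]
  rw [siegelMeasure_apply hs, siegelMeasure_apply hm, himg]
  have hch := lintegral_image_eq_lintegral_abs_det_fderiv_mul
    (volume : Measure (Sym2 (Fin n) → ℂ)) hval (f := actCoord γ)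
    (f' := fun z => congrCLM ((denom γ (symMatrix z))⁻¹)ᵀ)
    (by
      rintro _ ⟨W, -, rfl⟩
      exact (hasFDerivAt_actCoord γ W).hasFDerivWithinAt) hinj
    (fun z => ENNReal.ofReal (density z))
  rw [hch]
  refine setLIntegral_congr_fun hval ?_
  rintro _ ⟨(W : HalfSpace n), -, rfl⟩
  have hQ := det_denom_ne_zero γ W
  have hQ' : (((denom γ W.mat)⁻¹)ᵀ).det ≠ 0 := by
    rw [Matrix.det_transpose, Matrix.det_nonsing_inv, Ring.inverse_eq_inv']
    exact inv_ne_zero hQ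
  have hY := det_Y_smul γ W
  change ENNReal.ofReal ((W.Y.det ^ (n + 1))⁻¹) =
    ENNReal.ofReal |(congrCLM ((denom γ W.mat)⁻¹)ᵀ).det| * ENNReal.ofReal (density (actCoord γ W.1))
  rw [actCoord_val]
  change _ = _ * ENNReal.ofReal (((γ • W).Y.det ^ (n + 1))⁻¹)
  rw [det_congrCLM hQ', ← ENNReal.ofReal_mul (abs_nonneg _), abs_of_nonneg (by positivity)]
  congr 1
  rw [Matrix.det_transpose, Matrix.det_nonsing_inv, Ring.inverse_eq_inv', ← hY, norm_inv, mul_pow,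
    mul_inv, inv_pow, inv_pow]

instance : SMulInvariantMeasure (Sp n) (HalfSpace n) (siegelMeasure n) :=
  ⟨fun γ _ hs => siegelMeasure_preimage_smul γ hs⟩

/-! ### Functions on the half-space -/

theorem isOpenEmbedding_val : Topology.IsOpenEmbedding (Subtype.val : HalfSpace n → _) := by
  refine Topology.IsOpenEmbedding.mk Topology.IsEmbedding.subtypeVal ?_
  exact isOpen_upper

theorem eventually_upper {Z : HalfSpace n} {p : (Sym2 (Fin n) → ℂ) → Prop}
    (h : ∀ᶠ W : HalfSpace n in nhds Z, p W.1) : ∀ᶠ z in nhds Z.1, p z := by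
  rw [← isOpenEmbedding_val.map_nhds_eq]
  exact h

theorem contDiffOn_ext_iff {r : WithTop ℕ∞} {f : HalfSpace n → ℂ} :
    ContDiffOn ℝ r (ext f) (Set.range (Subtype.val : HalfSpace n → Sym2 (Fin n) → ℂ)) ↔
      ∀ Z : HalfSpace n, ContDiffAt ℝ r (ext f) Z.1 := by
  constructor
  · exact fun h Z => h.contDiffAt (upper_mem_nhds Z)
  · rintro h _ ⟨Z, rfl⟩
    exact (h Z).contDiffWithinAt

theorem continuous_of_contDiffAt {r : WithTop ℕ∞} {f : HalfSpace n → ℂ}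
    (h : ∀ Z : HalfSpace n, ContDiffAt ℝ r (ext f) Z.1) : Continuous f := by
  rw [continuous_iff_continuousAt]
  intro Z
  have h1 : f = ext f ∘ Subtype.val := by
    funext W
    exact (ext_val f W).symm
  rw [h1]
  exact (h Z).continuousAt.comp continuous_subtype_val.continuousAt

theorem contDiffAt_ext_congr {r : WithTop ℕ∞} {f : HalfSpace n → ℂ} {Z : HalfSpace n}
    {g : (Sym2 (Fin n) → ℂ) → ℂ} (hg : ContDiffAt ℝ r g Z.1)
    (h : ∀ W : HalfSpace n, f W = g W.1) : ContDiffAt ℝ r (ext f) Z.1 :=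
  hg.congr_of_eventuallyEq (eventuallyEq_of_upper fun W => by rw [ext_val, h])

theorem contDiffAt_ext_mul {r : WithTop ℕ∞} {f g : HalfSpace n → ℂ} {Z : HalfSpace n}
    (hf : ContDiffAt ℝ r (ext f) Z.1) (hg : ContDiffAt ℝ r (ext g) Z.1) :
    ContDiffAt ℝ r (ext fun W => f W * g W) Z.1 :=
  contDiffAt_ext_congr (hf.mul hg) fun W => by simp only [ext_val]

theorem contDiffAt_ext_conj {r : WithTop ℕ∞} {f : HalfSpace n → ℂ} {Z : HalfSpace n}
    (hf : ContDiffAt ℝ r (ext f) Z.1) : ContDiffAt ℝ r (ext fun W => conj (f W)) Z.1 :=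
  contDiffAt_ext_congr (g := fun z => Complex.conjCLE (ext f z))
    (Complex.conjCLE.contDiff.contDiffAt.comp Z.1 hf)
    fun W => by simp only [ext_val, Complex.conjCLE_apply]

theorem contDiffAt_ext_smul {r : WithTop ℕ∞} {f : HalfSpace n → ℂ} (γ : Sp n) {Z : HalfSpace n}
    (hf : ContDiffAt ℝ r (ext f) (γ • Z).1) : ContDiffAt ℝ r (ext fun W => f (γ • W)) Z.1 := by
  rw [← actCoord_val] at hf
  exact contDiffAt_ext_congr (hf.comp Z.1 (contDiffAt_actCoord γ Z))
    fun W => by simp only [Function.comp_apply, actCoord_val, ext_val]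

/-! ### The automorphy factor -/

/-- `det (C Z + D)` in coordinates. -/
def detDenom (γ : Sp n) (z : Sym2 (Fin n) → ℂ) : ℂ := (denom γ (symMatrix z)).det

theorem contDiffAt_detDenom {r : WithTop ℕ∞} (γ : Sp n) (z : Sym2 (Fin n) → ℂ) :
    ContDiffAt ℝ r (detDenom γ) z :=
  contDiffAt_det (contDiffAt_denom_apply γ z)

/-- Near `Z` the imaginary part of `ℓ γ W - ℓ γ Z` lies in `(-π, π)`, so this difference is the
principal logarithm of a quotient close to `1`. A branch that is only assumed continuous is
therefore analytic. -/
theorem ext_logBranch {ℓ : Sp n → HalfSpace n → ℂ} (hℓ : IsLogBranch ℓ) (γ : Sp n)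
    (Z : HalfSpace n) :
    ext (ℓ γ) =ᶠ[nhds Z.1] fun z => ℓ γ Z + Complex.log (detDenom γ z / detDenom γ Z.1) := by
  refine eventually_upper ?_
  have hc : Filter.Tendsto (fun W => (ℓ γ W - ℓ γ Z).im) (nhds Z) (nhds 0) := by
    have h : Continuous fun W => (ℓ γ W - ℓ γ Z).im :=
      Complex.continuous_im.comp ((hℓ γ).1.sub continuous_const)
    simpa using h.tendsto Z
  filter_upwards [hc.eventually (lt_mem_nhds (neg_lt_zero.2 Real.pi_pos)),
    hc.eventually (gt_mem_nhds Real.pi_pos)] with W h1 h2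
  have h3 : detDenom γ W.1 / detDenom γ Z.1 = Complex.exp (ℓ γ W - ℓ γ Z) := by
    rw [Complex.exp_sub, (hℓ γ).2, (hℓ γ).2]
    rfl
  rw [ext_val, h3, Complex.log_exp h1 h2.le]
  ring

theorem contDiffAt_ext_logBranch {r : WithTop ℕ∞} {ℓ : Sp n → HalfSpace n → ℂ}
    (hℓ : IsLogBranch ℓ) (γ : Sp n) (Z : HalfSpace n) : ContDiffAt ℝ r (ext (ℓ γ)) Z.1 := by
  refine ContDiffAt.congr_of_eventuallyEq ?_ (ext_logBranch hℓ γ Z)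
  have hq : detDenom γ Z.1 ≠ 0 := det_denom_ne_zero γ Z
  have hlog : ContDiffAt ℝ r Complex.log (detDenom γ Z.1 / detDenom γ Z.1) := by
    rw [div_self hq]
    exact (Complex.contDiffAt_log Complex.one_mem_slitPlane).restrict_scalars ℝ
  have h : ContDiffAt ℝ r (fun z => detDenom γ z / detDenom γ Z.1) Z.1 := by
    simp only [div_eq_mul_inv]
    exact (contDiffAt_detDenom γ _).mul contDiffAt_const
  exact contDiffAt_const.add (ContDiffAt.comp (g := Complex.log) Z.1 hlog h)

/-- The lower left block as a complex matrix. -/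
def lowerLeft (γ : Sp n) : Matrix (Fin n) (Fin n) ℂ := γ.1.toBlocks₂₁.map Complex.ofReal

theorem lowerLeft_conj (γ : Sp n) : (lowerLeft γ).map conj = lowerLeft γ := by
  ext i j
  simp [lowerLeft]

theorem lowerLeft_denom (γ : Sp n) (Z : HalfSpace n) :
    lowerLeft γ * (denom γ Z.mat)ᵀ = denom γ Z.mat * (lowerLeft γ)ᵀ := by
  -- The transposed matrix is symplectic too. Its block relation reads `C Dᵗ = D Cᵗ`.
  have h : (γ.1.toBlocks₂₁ᵀ.map Complex.ofReal)ᵀ * γ.1.toBlocks₂₂ᵀ.map Complex.ofReal =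
      (γ.1.toBlocks₂₂ᵀ.map Complex.ofReal)ᵀ * γ.1.toBlocks₂₁ᵀ.map Complex.ofReal :=
    (block_rels_complex ⟨γ.1ᵀ, SymplecticGroup.transpose_mem γ.2⟩).2.1
  simp only [Matrix.transpose_map, Matrix.transpose_transpose] at h
  simp only [denom, lowerLeft, Matrix.transpose_add, Matrix.transpose_mul, mat_transpose,
    Matrix.mul_add, Matrix.add_mul, Matrix.mul_assoc]
  rw [h]

/-- That is, `(CZ+D)⁻¹C` is symmetric. This is needed to recognise it as the Wirtinger matrix of
`log det(CZ+D)`. -/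
theorem inv_denom_mul_lowerLeft (γ : Sp n) (Z : HalfSpace n) :
    (denom γ Z.mat)⁻¹ * lowerLeft γ = (lowerLeft γ)ᵀ * ((denom γ Z.mat)⁻¹)ᵀ := by
  have hu := isUnit_det_denom γ Z
  have h := congrArg (fun M => (denom γ Z.mat)⁻¹ * M * ((denom γ Z.mat)⁻¹)ᵀ) (lowerLeft_denom γ Z)
  rw [← Matrix.mul_assoc, ← Matrix.mul_assoc, Matrix.nonsing_inv_mul _ hu, Matrix.one_mul,
    Matrix.mul_assoc, Matrix.mul_assoc, ← Matrix.transpose_mul, Matrix.nonsing_inv_mul _ hu,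
    Matrix.transpose_one, Matrix.mul_one] at h
  exact h

/-- Differentiate `exp ℓ = det(CZ+D)` by Jacobi's formula and cancel the determinant. The result
does not depend on the branch. -/
theorem fderiv_logBranch {ℓ : Sp n → HalfSpace n → ℂ} (hℓ : IsLogBranch ℓ) (γ : Sp n)
    (Z : HalfSpace n) (v : Sym2 (Fin n) → ℂ) :
    fderiv ℝ (ext (ℓ γ)) Z.1 v = ((denom γ Z.mat)⁻¹ * lowerLeft γ * symMatrix v).trace := by
  have hd := ((contDiffAt_ext_logBranch (r := 1) hℓ γ Z).differentiableAt one_ne_zero).hasFDerivAt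
  have h1 : (fun z => Complex.exp (ext (ℓ γ) z)) =ᶠ[nhds Z.1] detDenom γ :=
    eventuallyEq_of_upper fun W => by
      rw [ext_val, (hℓ γ).2]
      rfl
  have h2 := (hd.cexp.congr_of_eventuallyEq h1.symm).fderiv
  have h3 : fderiv ℝ (detDenom γ) Z.1 v = _ :=
    fderiv_det_affine _ _ (det_denom_ne_zero γ Z) v
  rw [h2, ext_val, (hℓ γ).2, _root_.smul_apply, smul_eq_mul] at h3
  have h4 := mul_left_cancel₀ (det_denom_ne_zero γ Z) h3
  rw [h4, Matrix.mul_assoc]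
  rfl

theorem contDiffAt_ext_autFactor {r : WithTop ℕ∞} {ℓ : Sp n → HalfSpace n → ℂ}
    (hℓ : IsLogBranch ℓ) (α β : ℝ) (γ : Sp n) (Z : HalfSpace n) :
    ContDiffAt ℝ r (ext (autFactor ℓ α β γ)) Z.1 := by
  have h := contDiffAt_ext_logBranch (r := r) hℓ γ Z
  have hc : ContDiffAt ℝ r (fun z => Complex.conjCLE (ext (ℓ γ) z)) Z.1 :=
    Complex.conjCLE.contDiff.contDiffAt.comp Z.1 h
  refine contDiffAt_ext_congr ((contDiffAt_const (c := (α : ℂ)).mul h).cexp.mul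
    (contDiffAt_const (c := (β : ℂ)).mul hc).cexp) fun W => ?_
  simp only [ext_val, autFactor, Complex.conjCLE_apply]

theorem fderiv_autFactor {ℓ : Sp n → HalfSpace n → ℂ} (hℓ : IsLogBranch ℓ) (α β : ℝ) (γ : Sp n)
    (Z : HalfSpace n) (v : Sym2 (Fin n) → ℂ) :
    fderiv ℝ (ext (autFactor ℓ α β γ)) Z.1 v = autFactor ℓ α β γ Z *
      (α * fderiv ℝ (ext (ℓ γ)) Z.1 v + β * conj (fderiv ℝ (ext (ℓ γ)) Z.1 v)) := by
  have hd := ((contDiffAt_ext_logBranch (r := 1) hℓ γ Z).differentiableAt one_ne_zero).hasFDerivAt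
  have hc : HasFDerivAt (fun z => Complex.conjCLE (ext (ℓ γ) z))
      ((Complex.conjCLE : ℂ →L[ℝ] ℂ).comp (fderiv ℝ (ext (ℓ γ)) Z.1)) Z.1 :=
    (Complex.conjCLE : ℂ →L[ℝ] ℂ).hasFDerivAt.comp Z.1 hd
  have h := (hd.const_mul (α : ℂ)).cexp.mul (hc.const_mul (β : ℂ)).cexp
  have h1 : ext (autFactor ℓ α β γ) =ᶠ[nhds Z.1] fun z => Complex.exp (α * ext (ℓ γ) z) *
      Complex.exp (β * Complex.conjCLE (ext (ℓ γ) z)) :=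
    eventuallyEq_of_upper fun W => by simp only [ext_val, autFactor, Complex.conjCLE_apply]
  rw [(h.congr_of_eventuallyEq h1).fderiv]
  simp only [ext_val, autFactor, Complex.conjCLE_apply, _root_.add_apply, _root_.smul_apply,
    smul_eq_mul, ContinuousLinearMap.comp_apply, ContinuousLinearEquiv.coe_coe]
  ring

theorem autFactor_ne_zero (ℓ : Sp n → HalfSpace n → ℂ) (α β : ℝ) (γ : Sp n) (Z : HalfSpace n) :
    autFactor ℓ α β γ Z ≠ 0 :=
  mul_ne_zero (Complex.exp_ne_zero _) (Complex.exp_ne_zero _)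

theorem norm_autFactor (ℓ : Sp n → HalfSpace n → ℂ) (α β : ℝ) (γ : Sp n) (Z : HalfSpace n) :
    ‖autFactor ℓ α β γ Z‖ = Real.exp ((α + β) * (ℓ γ Z).re) := by
  rw [autFactor, norm_mul, Complex.norm_exp, Complex.norm_exp, ← Real.exp_add]
  simp
  ring

/-- The modulus of the automorphy factor is `|det(CZ+D)|^{α+β}`, whatever the branch. -/
theorem det_Y_smul_rpow {ℓ : Sp n → HalfSpace n → ℂ} (hℓ : IsLogBranch ℓ) (α β : ℝ) (γ : Sp n)
    (Z : HalfSpace n) :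
    (γ • Z).Y.det ^ (α + β) * ‖autFactor ℓ α β γ Z‖ ^ 2 = Z.Y.det ^ (α + β) := by
  rw [← det_Y_smul γ Z, ← (hℓ γ).2, Complex.norm_exp, Real.mul_rpow (by positivity)
    (det_Y_pos _).le, norm_autFactor, ← Real.exp_nat_mul, ← Real.exp_nat_mul, ← Real.exp_mul,
    mul_comm]
  congr 2
  push_cast
  ring

/-- Allowing `g` to differ from `f` covers test functions and translated cut-offs, which are not
automorphic themselves. -/
theorem pairingIntegrand_smul {ℓ : Sp n → HalfSpace n → ℂ} (hℓ : IsLogBranch ℓ) {α β : ℝ}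
    {γ : Sp n} {Z : HalfSpace n} {f₁ f₂ g₁ g₂ : HalfSpace n → ℂ}
    (h₁ : f₁ (γ • Z) = autFactor ℓ α β γ Z * g₁ Z)
    (h₂ : f₂ (γ • Z) = autFactor ℓ α β γ Z * g₂ Z) :
    pairingIntegrand α β f₁ f₂ (γ • Z) = pairingIntegrand α β g₁ g₂ Z := by
  rw [pairingIntegrand, pairingIntegrand, h₁, h₂, ← det_Y_smul_rpow hℓ α β γ Z, map_mul]
  push_cast
  rw [← Complex.mul_conj']
  ring

/-! ### Equivariance of `Λ` -/

theorem trace_map_conj (M : Matrix (Fin n) (Fin n) ℂ) : (M.map conj).trace = conj M.trace := by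
  simp [Matrix.trace]

theorem wirtBar_comp_congr (L : (Sym2 (Fin n) → ℂ) →L[ℝ] ℂ) (A : Matrix (Fin n) (Fin n) ℂ) :
    wirtBar (L.comp (congrCLM A)) = (A.map conj)ᵀ * wirtBar L * A.map conj := by
  refine (wirt_eq_wirtBar_eq (A := Aᵀ * wirt L * A) ?_ ?_ fun v => ?_).2
  · simp only [Matrix.transpose_mul, Matrix.transpose_transpose, wirt_transpose, Matrix.mul_assoc]
  · simp only [Matrix.transpose_mul, Matrix.transpose_transpose, wirtBar_transpose,
      Matrix.mul_assoc]
  · rw [ContinuousLinearMap.comp_apply, apply_eq_wirt L, congrCLM_apply, symMatrix_congrMap,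
      Matrix.map_mul, Matrix.map_mul, ← Matrix.mul_assoc, Matrix.trace_mul_comm,
      ← Matrix.mul_assoc, ← Matrix.mul_assoc, ← Matrix.mul_assoc,
      ← Matrix.mul_assoc, Matrix.trace_mul_comm (wirtBar L * _ * _), ← Matrix.mul_assoc,
      ← Matrix.mul_assoc, ← Matrix.transpose_map]

/-- Chain rule and product rule. The power with exponent `α` is holomorphic, so only the one with
exponent `β` contributes to the antiholomorphic derivative of the automorphy factor. -/
theorem dZbar_smul {ℓ : Sp n → HalfSpace n → ℂ} (hℓ : IsLogBranch ℓ) {α β : ℝ} {γ : Sp n}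
    {f g : HalfSpace n → ℂ} (hfg : ∀ Z, f (γ • Z) = autFactor ℓ α β γ Z * g Z) {Z : HalfSpace n}
    (hf : DifferentiableAt ℝ (ext f) (γ • Z).1) (hg : DifferentiableAt ℝ (ext g) Z.1) :
    (denom γ Z.mat)⁻¹.map conj * dZbar f (γ • Z) * ((denom γ Z.mat)⁻¹.map conj)ᵀ =
      autFactor ℓ α β γ Z • (dZbar g Z + (β * g Z) • ((denom γ Z.mat)⁻¹ * lowerLeft γ).map conj) := by
  rw [← actCoord_val] at hf
  have h1 := hf.hasFDerivAt.comp Z.1 (hasFDerivAt_actCoord γ Z)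
  have h2 := ((contDiffAt_ext_autFactor (r := 1) hℓ α β γ Z).differentiableAt
    one_ne_zero).hasFDerivAt.mul hg.hasFDerivAt
  have h3 : ext f ∘ actCoord γ =ᶠ[nhds Z.1] fun z => ext (autFactor ℓ α β γ) z * ext g z :=
    eventuallyEq_of_upper fun W => by
      rw [Function.comp_apply, actCoord_val, ext_val, ext_val, ext_val, hfg]
  have h4 := h1.unique (h2.congr_of_eventuallyEq h3)
  rw [actCoord_val] at h4
  have h5 := congrArg wirtBar h4
  rw [wirtBar_comp_congr, wirtBar_add, wirtBar_smul, wirtBar_smul, ← dZbar_eq, ← dZbar_eq, ext_val,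
    ext_val] at h5
  have h6 : wirtBar (fderiv ℝ (ext (autFactor ℓ α β γ)) Z.1) =
      (autFactor ℓ α β γ Z * β) • ((denom γ Z.mat)⁻¹ * lowerLeft γ).map conj := by
    have hs : ((denom γ Z.mat)⁻¹ * lowerLeft γ)ᵀ = (denom γ Z.mat)⁻¹ * lowerLeft γ := by
      rw [Matrix.transpose_mul, inv_denom_mul_lowerLeft]
    refine (wirt_eq_wirtBar_eq (A := (autFactor ℓ α β γ Z * α) •
      ((denom γ Z.mat)⁻¹ * lowerLeft γ)) ?_ ?_ fun v => ?_).2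
    · rw [Matrix.transpose_smul, hs]
    · rw [Matrix.transpose_smul, ← Matrix.transpose_map, hs]
    · rw [fderiv_autFactor hℓ, fderiv_logBranch hℓ, Matrix.smul_mul, Matrix.smul_mul,
        Matrix.trace_smul, Matrix.trace_smul, ← Matrix.map_mul, trace_map_conj, smul_eq_mul,
        smul_eq_mul]
      ring
  rw [h6] at h5
  have h7 : (((denom γ Z.mat)⁻¹)ᵀ.map conj)ᵀ = (denom γ Z.mat)⁻¹.map conj := by
    rw [← Matrix.transpose_map, Matrix.transpose_transpose]
  rw [h7] at h5
  rw [Matrix.transpose_map] at h5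
  rw [h5, smul_add, smul_smul, smul_smul]
  congr 2
  ring

theorem subConj_mul_lowerLeft (γ : Sp n) (Z : HalfSpace n) :
    Z.subConj * (lowerLeft γ)ᵀ = (denom γ Z.mat)ᵀ - ((denom γ Z.mat).map conj)ᵀ := by
  rw [← denom_conj, ← Matrix.transpose_sub, ← subConj_transpose, ← Matrix.transpose_mul]
  congr 1
  rw [HalfSpace.subConj, Matrix.mul_sub, denom, denom]
  exact (add_sub_add_right_eq_sub _ _ _).symm

/-- The derivative of the automorphy factor contributes `β g (Qᵗ - conj(Q)ᵗ)`, where `Q = CZ + D`.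
The summand `-β 1_n` of `Λ_β` carries `Qᵗ` on the left and `conj(Q)ᵗ` on the right, and it absorbs
exactly this term. -/
theorem opLambda_smul {ℓ : Sp n → HalfSpace n → ℂ} (hℓ : IsLogBranch ℓ) {α β : ℝ} {γ : Sp n}
    {f g : HalfSpace n → ℂ} (hfg : ∀ Z, f (γ • Z) = autFactor ℓ α β γ Z * g Z) {Z : HalfSpace n}
    (hf : DifferentiableAt ℝ (ext f) (γ • Z).1) (hg : DifferentiableAt ℝ (ext g) Z.1) :
    (denom γ Z.mat)ᵀ * opLambda β f (γ • Z) =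
      autFactor ℓ α β γ Z • (opLambda β g Z * ((denom γ Z.mat).map conj)ᵀ) := by
  have hu := isUnit_det_denom γ Z
  have h1 := dZbar_smul hℓ hfg hf hg
  set Q := denom γ Z.mat with hQ
  set J := autFactor ℓ α β γ Z with hJ
  have hQ1 : Q.map conj * Q⁻¹.map conj = 1 := by
    rw [← Matrix.map_mul, Matrix.mul_nonsing_inv _ hu]
    exact Matrix.map_one _ (map_zero _) (map_one _)
  have hQ2 : (Q⁻¹.map conj)ᵀ * (Q.map conj)ᵀ = 1 := by
    rw [← Matrix.transpose_mul, hQ1, Matrix.transpose_one]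
  have h2 : (Q⁻¹ * lowerLeft γ).map conj * (Q.map conj)ᵀ = (lowerLeft γ)ᵀ := by
    rw [inv_denom_mul_lowerLeft, ← hQ, Matrix.map_mul, Matrix.mul_assoc, Matrix.transpose_map,
      Matrix.transpose_map, hQ2, Matrix.mul_one, lowerLeft_conj]
  have h3 : Qᵀ * (γ • Z).subConj * dZbar f (γ • Z) = Z.subConj *
      (Q⁻¹.map conj * dZbar f (γ • Z) * (Q⁻¹.map conj)ᵀ) * (Q.map conj)ᵀ := by
    rw [← denom_subConj' γ Z, ← hQ]
    calc Qᵀ * (γ • Z).subConj * dZbar f (γ • Z) = Qᵀ * (γ • Z).subConj *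
          (Q.map conj * Q⁻¹.map conj) * dZbar f (γ • Z) * ((Q⁻¹.map conj)ᵀ * (Q.map conj)ᵀ) := by
          rw [hQ1, hQ2, Matrix.mul_one, Matrix.mul_one]
      _ = _ := by simp only [Matrix.mul_assoc]
  have h4 : Z.subConj * ((Q⁻¹ * lowerLeft γ).map conj * (Q.map conj)ᵀ) = Qᵀ - (Q.map conj)ᵀ := by
    rw [h2, subConj_mul_lowerLeft]
  rw [opLambda, opLambda, Matrix.mul_sub, ← Matrix.mul_assoc, h3, h1, hfg, ← hJ]
  simp only [Matrix.mul_smul, Matrix.smul_mul, Matrix.mul_add, Matrix.add_mul, Matrix.sub_mul,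
    Matrix.mul_one, Matrix.one_mul, smul_add, smul_sub, Matrix.mul_assoc] at h4 ⊢
  rw [h4]
  simp only [smul_sub, smul_smul]
  rw [show (β : ℂ) * (J * g Z) = J * (β * g Z) by ring]
  abel

/-- The product `Λ_β f₁ conj(Λ_β f₂)` changes by conjugation with `Qᵗ`, which the trace does not
see, and by the factor `|J|²`, which the power of `det Y` compensates. -/
theorem lambdaIntegrand_smul {ℓ : Sp n → HalfSpace n → ℂ} (hℓ : IsLogBranch ℓ) {α β : ℝ}
    {γ : Sp n} {Z : HalfSpace n} {f₁ f₂ g₁ g₂ : HalfSpace n → ℂ}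
    (h₁ : ∀ Z, f₁ (γ • Z) = autFactor ℓ α β γ Z * g₁ Z)
    (h₂ : ∀ Z, f₂ (γ • Z) = autFactor ℓ α β γ Z * g₂ Z)
    (hf₁ : DifferentiableAt ℝ (ext f₁) (γ • Z).1) (hg₁ : DifferentiableAt ℝ (ext g₁) Z.1)
    (hf₂ : DifferentiableAt ℝ (ext f₂) (γ • Z).1) (hg₂ : DifferentiableAt ℝ (ext g₂) Z.1) :
    lambdaIntegrand α β f₁ f₂ (γ • Z) = lambdaIntegrand α β g₁ g₂ Z := by
  have e₁ := opLambda_smul hℓ h₁ hf₁ hg₁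
  have e₂ := congrArg (fun M => M.map conj) (opLambda_smul hℓ h₂ hf₂ hg₂)
  have hu := isUnit_det_denom γ Z
  rw [lambdaIntegrand, lambdaIntegrand, ← det_Y_smul_rpow hℓ α β γ Z]
  set Q := denom γ Z.mat with hQ
  set J := autFactor ℓ α β γ Z with hJ
  have hu1 : (Q⁻¹)ᵀ * Qᵀ = 1 := by
    rw [← Matrix.transpose_mul, Matrix.mul_nonsing_inv _ hu, Matrix.transpose_one]
  have hu2 : ((Q⁻¹).map conj)ᵀ * (Q.map conj)ᵀ = 1 := by
    rw [← Matrix.transpose_mul, ← Matrix.map_mul, Matrix.mul_nonsing_inv _ hu,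
      Matrix.map_one _ (map_zero _) (map_one _), Matrix.transpose_one]
  have hcc : ∀ M : Matrix (Fin n) (Fin n) ℂ, (M.map conj).map conj = M := by
    intro M
    ext i j
    simp
  have e₂' : (Q.map conj)ᵀ * (opLambda β f₂ (γ • Z)).map conj =
      conj J • ((opLambda β g₂ Z).map conj * Qᵀ) := by
    have hs : ∀ M : Matrix (Fin n) (Fin n) ℂ, (J • M).map conj = conj J • M.map conj := by
      intro M
      ext i j
      simp
    simp only [Matrix.map_mul, hs, ← Matrix.transpose_map, hcc] at e₂
    simpa only [Matrix.transpose_map] using e₂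
  have e₁' : opLambda β f₁ (γ • Z) = (Q⁻¹)ᵀ * (J • (opLambda β g₁ Z * (Q.map conj)ᵀ)) := by
    rw [← e₁, ← Matrix.mul_assoc, hu1, Matrix.one_mul]
  rw [e₁']
  simp only [Matrix.mul_smul, Matrix.smul_mul, Matrix.mul_assoc, Matrix.trace_smul, smul_eq_mul]
  rw [e₂']
  simp only [Matrix.mul_smul, Matrix.trace_smul, smul_eq_mul]
  rw [Matrix.trace_mul_comm, Matrix.mul_assoc, Matrix.mul_assoc, ← Matrix.transpose_mul,
    Matrix.nonsing_inv_mul _ hu, Matrix.transpose_one, Matrix.mul_one]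
  push_cast
  rw [← Complex.mul_conj']
  ring

/-! ### Calculus of the Wirtinger operators -/

theorem dZ_congr {f : HalfSpace n → ℂ} {Z : HalfSpace n} {L : (Sym2 (Fin n) → ℂ) →L[ℝ] ℂ}
    {h : (Sym2 (Fin n) → ℂ) → ℂ} (hh : HasFDerivAt h L Z.1) (hf : ∀ W : HalfSpace n, f W = h W.1) :
    dZ f Z = wirt L ∧ dZbar f Z = wirtBar L := by
  have h1 : ext f =ᶠ[nhds Z.1] h := eventuallyEq_of_upper fun W => by rw [ext_val, hf]
  rw [dZ_eq, dZbar_eq, (hh.congr_of_eventuallyEq h1).fderiv]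
  exact ⟨rfl, rfl⟩

theorem dZ_mul {f g : HalfSpace n → ℂ} {Z : HalfSpace n} (hf : DifferentiableAt ℝ (ext f) Z.1)
    (hg : DifferentiableAt ℝ (ext g) Z.1) :
    dZ (fun W => f W * g W) Z = f Z • dZ g Z + g Z • dZ f Z ∧
      dZbar (fun W => f W * g W) Z = f Z • dZbar g Z + g Z • dZbar f Z := by
  have h := dZ_congr (f := fun W => f W * g W) (hf.hasFDerivAt.mul hg.hasFDerivAt)
    fun W => by simp only [Pi.mul_apply, ext_val]
  rw [wirt_add, wirt_smul, wirt_smul, wirtBar_add, wirtBar_smul, wirtBar_smul, ext_val, ext_val,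
    ← dZ_eq, ← dZ_eq, ← dZbar_eq, ← dZbar_eq] at h
  exact h

theorem dZ_add {f g : HalfSpace n → ℂ} {Z : HalfSpace n} (hf : DifferentiableAt ℝ (ext f) Z.1)
    (hg : DifferentiableAt ℝ (ext g) Z.1) :
    dZ (fun W => f W + g W) Z = dZ f Z + dZ g Z ∧
      dZbar (fun W => f W + g W) Z = dZbar f Z + dZbar g Z := by
  have h := dZ_congr (f := fun W => f W + g W) (hf.hasFDerivAt.add hg.hasFDerivAt)
    fun W => by simp only [Pi.add_apply, ext_val]
  rw [wirt_add, wirtBar_add, ← dZ_eq, ← dZ_eq, ← dZbar_eq, ← dZbar_eq] at h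
  exact h

theorem dZ_const_mul {f : HalfSpace n → ℂ} {Z : HalfSpace n} (c : ℂ)
    (hf : DifferentiableAt ℝ (ext f) Z.1) :
    dZ (fun W => c * f W) Z = c • dZ f Z ∧ dZbar (fun W => c * f W) Z = c • dZbar f Z := by
  have h := dZ_congr (f := fun W => c * f W) (hf.hasFDerivAt.const_mul c)
    fun W => by simp only [ext_val]
  rw [wirt_smul, wirtBar_smul, ← dZ_eq, ← dZbar_eq] at h
  exact h

theorem differentiableAt_ext_mul {f g : HalfSpace n → ℂ} {Z : HalfSpace n}
    (hf : DifferentiableAt ℝ (ext f) Z.1) (hg : DifferentiableAt ℝ (ext g) Z.1) :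
    DifferentiableAt ℝ (ext fun W => f W * g W) Z.1 :=
  (hf.mul hg).congr_of_eventuallyEq
    (eventuallyEq_of_upper fun W => by simp only [Pi.mul_apply, ext_val])

theorem differentiableAt_ext_const_mul {f : HalfSpace n → ℂ} {Z : HalfSpace n} (c : ℂ)
    (hf : DifferentiableAt ℝ (ext f) Z.1) : DifferentiableAt ℝ (ext fun W => c * f W) Z.1 :=
  (hf.const_mul c).congr_of_eventuallyEq (eventuallyEq_of_upper fun W => by simp only [ext_val])

theorem differentiableAt_ext_sum {ι : Type*} (s : Finset ι) {f : ι → HalfSpace n → ℂ}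
    {Z : HalfSpace n} (hf : ∀ i ∈ s, DifferentiableAt ℝ (ext (f i)) Z.1) :
    DifferentiableAt ℝ (ext fun W => ∑ i ∈ s, f i W) Z.1 :=
  (DifferentiableAt.fun_sum hf).congr_of_eventuallyEq
    (eventuallyEq_of_upper fun W => by simp only [ext_val])

theorem dZ_sum {ι : Type*} (s : Finset ι) {f : ι → HalfSpace n → ℂ} {Z : HalfSpace n}
    (hf : ∀ i ∈ s, DifferentiableAt ℝ (ext (f i)) Z.1) :
    dZ (fun W => ∑ i ∈ s, f i W) Z = ∑ i ∈ s, dZ (f i) Z ∧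
      dZbar (fun W => ∑ i ∈ s, f i W) Z = ∑ i ∈ s, dZbar (f i) Z := by
  classical
  induction s using Finset.induction_on with
  | empty =>
    have h := dZ_congr (f := fun _ : HalfSpace n => (0 : ℂ)) (hasFDerivAt_const (0 : ℂ) Z.1)
      fun W => rfl
    rw [wirt_zero, wirtBar_zero] at h
    simpa using h
  | insert i s hi ih =>
    have ih' := ih fun j hj => hf j (Finset.mem_insert_of_mem hj)
    have h := dZ_add (hf i (Finset.mem_insert_self i s))
      (differentiableAt_ext_sum s fun j hj => hf j (Finset.mem_insert_of_mem hj))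
    simp only [Finset.sum_insert hi]
    rw [ih'.1, ih'.2] at h
    exact h

theorem conj_wirt_comp (L : (Sym2 (Fin n) → ℂ) →L[ℝ] ℂ) :
    wirt ((Complex.conjCLE : ℂ →L[ℝ] ℂ).comp L) = (wirtBar L).map conj := by
  refine (wirt_eq_wirtBar_eq (B := (wirt L).map conj) ?_ ?_ fun v => ?_).1
  · rw [← Matrix.transpose_map, wirtBar_transpose]
  · rw [← Matrix.transpose_map, wirt_transpose]
  · have hcc : (symMatrix v) = ((symMatrix v).map conj).map conj := by
      ext i j
      simp
    rw [ContinuousLinearMap.comp_apply, apply_eq_wirt L]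
    simp only [ContinuousLinearEquiv.coe_coe, Complex.conjCLE_apply, map_add]
    rw [← trace_map_conj, ← trace_map_conj, Matrix.map_mul, Matrix.map_mul, ← hcc, add_comm]

theorem dZ_conj {f : HalfSpace n → ℂ} {Z : HalfSpace n} (hf : DifferentiableAt ℝ (ext f) Z.1) :
    dZ (fun W => conj (f W)) Z = (dZbar f Z).map conj := by
  have h := dZ_congr (f := fun W => conj (f W))
    ((Complex.conjCLE : ℂ →L[ℝ] ℂ).hasFDerivAt.comp Z.1 hf.hasFDerivAt)
    fun W => by simp [ext_val]
  rw [h.1, conj_wirt_comp, dZbar_eq]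

/-! ### Derivatives of `Z - conj Z` -/

theorem contDiffAt_ext_subConj {r : WithTop ℕ∞} (Z : HalfSpace n) (l p : Fin n) :
    ContDiffAt ℝ r (ext fun W => W.subConj l p) Z.1 := by
  have h : ContDiffAt ℝ r (fun z : Sym2 (Fin n) → ℂ => z s(l, p)) Z.1 :=
    (contDiff_apply ℝ ℂ _).contDiffAt
  have hc : ContDiffAt ℝ r (fun z : Sym2 (Fin n) → ℂ => Complex.conjCLE (z s(l, p))) Z.1 :=
    Complex.conjCLE.contDiff.contDiffAt.comp Z.1 h
  exact contDiffAt_ext_congr (h.sub hc) fun W => rfl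

theorem differentiableAt_ext_subConj (Z : HalfSpace n) (l p : Fin n) :
    DifferentiableAt ℝ (ext fun W => W.subConj l p) Z.1 :=
  (contDiffAt_ext_subConj (r := 1) Z l p).differentiableAt one_ne_zero

/-- On symmetric matrices the entry `(l, p)` is the trace pairing with the symmetrised elementary
matrix `(E_{lp} + E_{pl})/2`. The conjugate coordinate enters with the opposite sign. -/
theorem dZ_subConj (Z : HalfSpace n) (l p m k : Fin n) :
    dZ (fun W => W.subConj l p) Z m k =
      1 / 2 * ((if m = l then 1 else 0) * (if k = p then 1 else 0) +
        (if m = p then 1 else 0) * (if k = l then 1 else 0)) ∧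
    dZbar (fun W => W.subConj l p) Z m k =
      -1 / 2 * ((if m = l then 1 else 0) * (if k = p then 1 else 0) +
        (if m = p then 1 else 0) * (if k = l then 1 else 0)) := by
  set A : Matrix (Fin n) (Fin n) ℂ :=
    (1 / 2 : ℂ) • (Matrix.single l p 1 + Matrix.single p l 1) with hA
  have hAt : Aᵀ = A := by
    rw [hA, Matrix.transpose_smul, Matrix.transpose_add, Matrix.transpose_single,
      Matrix.transpose_single, add_comm]
  have hAe : ∀ m k, A m k = 1 / 2 * ((if m = l then 1 else 0) * (if k = p then 1 else 0) +
        (if m = p then 1 else 0) * (if k = l then 1 else 0)) := by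
    intro m k
    simp only [hA, Matrix.smul_apply, Matrix.add_apply, Matrix.single_apply, smul_eq_mul,
      ite_and, mul_ite, mul_one, mul_zero, eq_comm (a := l), eq_comm (a := p)]
    grind
  have hS : ∀ S : Matrix (Fin n) (Fin n) ℂ, Sᵀ = S → (A * S).trace = S l p := by
    intro S hS
    have h1 : S p l = S l p := congrFun (congrFun hS l) p
    rw [hA, Matrix.smul_mul, Matrix.add_mul, Matrix.trace_smul, Matrix.trace_add,
      Matrix.trace_single_mul, Matrix.trace_single_mul, h1, one_smul, smul_eq_mul]
    ring
  set P : (Sym2 (Fin n) → ℂ) →L[ℝ] ℂ := ContinuousLinearMap.proj s(l, p) with hP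
  have hPd : HasFDerivAt (fun z : Sym2 (Fin n) → ℂ => z s(l, p)) P Z.1 := hasFDerivAt_apply _ _
  have hL : HasFDerivAt (fun z : Sym2 (Fin n) → ℂ => z s(l, p) - Complex.conjCLE (z s(l, p)))
      (P - (Complex.conjCLE : ℂ →L[ℝ] ℂ).comp P) Z.1 :=
    hPd.sub ((Complex.conjCLE : ℂ →L[ℝ] ℂ).hasFDerivAt.comp Z.1 hPd)
  have h := dZ_congr (f := fun W => W.subConj l p) hL fun W => rfl
  have hw := wirt_eq_wirtBar_eq (A := A) (B := -A) hAt (by rw [Matrix.transpose_neg, hAt])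
    (L := P - (Complex.conjCLE : ℂ →L[ℝ] ℂ).comp P) (fun v => by
      rw [Matrix.neg_mul, Matrix.trace_neg, hS _ (symMatrix_transpose v),
        hS _ (by rw [← Matrix.transpose_map, symMatrix_transpose]), ← sub_eq_add_neg]
      rfl)
  rw [h.1, h.2, hw.1, hw.2, Matrix.neg_apply, hAe]
  refine ⟨rfl, by ring⟩

/-! ### Regularity of the operators -/

theorem contDiffAt_ext_dZ {r m : WithTop ℕ∞} (hrm : m + 1 ≤ r) {f : HalfSpace n → ℂ}
    {Z : HalfSpace n} (hf : ContDiffAt ℝ r (ext f) Z.1) (j k : Fin n) :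
    ContDiffAt ℝ m (ext fun W => dZ f W j k) Z.1 ∧
      ContDiffAt ℝ m (ext fun W => dZbar f W j k) Z.1 := by
  have h := hf.fderiv_right hrm
  have h1 : ∀ v, ContDiffAt ℝ m (fun z => fderiv ℝ (ext f) z v) Z.1 := fun v =>
    h.clm_apply contDiffAt_const
  refine ⟨contDiffAt_ext_congr (g := fun z => wirt (fderiv ℝ (ext f) z) j k) ?_
    fun W => by rw [dZ_eq], contDiffAt_ext_congr
    (g := fun z => wirtBar (fderiv ℝ (ext f) z) j k) ?_ fun W => by rw [dZbar_eq]⟩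
  · simp only [wirt, Matrix.of_apply]
    exact contDiffAt_const.mul ((h1 _).sub (contDiffAt_const.mul (h1 _)))
  · simp only [wirtBar, Matrix.of_apply]
    exact contDiffAt_const.mul ((h1 _).add (contDiffAt_const.mul (h1 _)))

theorem contDiffAt_ext_sum {r : WithTop ℕ∞} {ι : Type*} (s : Finset ι) {f : ι → HalfSpace n → ℂ}
    {Z : HalfSpace n} (hf : ∀ i ∈ s, ContDiffAt ℝ r (ext (f i)) Z.1) :
    ContDiffAt ℝ r (ext fun W => ∑ i ∈ s, f i W) Z.1 :=
  contDiffAt_ext_congr (ContDiffAt.sum hf) fun W => by simp only [ext_val]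

theorem contDiffAt_ext_add {r : WithTop ℕ∞} {f g : HalfSpace n → ℂ} {Z : HalfSpace n}
    (hf : ContDiffAt ℝ r (ext f) Z.1) (hg : ContDiffAt ℝ r (ext g) Z.1) :
    ContDiffAt ℝ r (ext fun W => f W + g W) Z.1 :=
  contDiffAt_ext_congr (hf.add hg) fun W => by simp only [ext_val]

theorem contDiffAt_ext_const_mul {r : WithTop ℕ∞} {f : HalfSpace n → ℂ} {Z : HalfSpace n} (c : ℂ)
    (hf : ContDiffAt ℝ r (ext f) Z.1) : ContDiffAt ℝ r (ext fun W => c * f W) Z.1 :=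
  contDiffAt_ext_congr ((contDiffAt_const (c := c)).mul hf) fun W => by simp only [ext_val]

theorem opK_apply (α : ℝ) (f : HalfSpace n → ℂ) (Z : HalfSpace n) (j k : Fin n) :
    opK α f Z j k = ∑ p, Z.subConj j p * dZ f Z p k + (if j = k then α else 0 : ℂ) * f Z := by
  simp only [opK, Matrix.add_apply, Matrix.mul_apply, Matrix.smul_apply, Matrix.one_apply,
    smul_eq_mul]
  split_ifs <;> simp

theorem opLambda_apply (β : ℝ) (f : HalfSpace n → ℂ) (Z : HalfSpace n) (j k : Fin n) :
    opLambda β f Z j k =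
      ∑ p, Z.subConj j p * dZbar f Z p k + (if j = k then -β else 0 : ℂ) * f Z := by
  simp only [opLambda, Matrix.sub_apply, Matrix.mul_apply, Matrix.smul_apply, Matrix.one_apply,
    smul_eq_mul]
  split_ifs <;> simp [sub_eq_add_neg]

theorem contDiffAt_ext_op {r m : WithTop ℕ∞} (hrm : m + 1 ≤ r) {f : HalfSpace n → ℂ}
    {Z : HalfSpace n} (hf : ContDiffAt ℝ r (ext f) Z.1) (c : ℝ) (j k : Fin n) :
    ContDiffAt ℝ m (ext fun W => opK c f W j k) Z.1 ∧
      ContDiffAt ℝ m (ext fun W => opLambda c f W j k) Z.1 := by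
  simp only [opK_apply, opLambda_apply]
  have hf' : ContDiffAt ℝ m (ext f) Z.1 := hf.of_le (le_self_add.trans hrm)
  exact ⟨contDiffAt_ext_add (contDiffAt_ext_sum _ fun p _ => contDiffAt_ext_mul
      (contDiffAt_ext_subConj Z j p) (contDiffAt_ext_dZ hrm hf p k).1)
      (contDiffAt_ext_const_mul _ hf'),
    contDiffAt_ext_add (contDiffAt_ext_sum _ fun p _ => contDiffAt_ext_mul
      (contDiffAt_ext_subConj Z j p) (contDiffAt_ext_dZ hrm hf p k).2)
      (contDiffAt_ext_const_mul _ hf')⟩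

theorem trace_opOmega_apply (α β : ℝ) (f : HalfSpace n → ℂ) (Z : HalfSpace n) :
    (opOmega α β f Z).trace =
      ∑ j, ∑ l, opLambda (β - (n + 1) / 2) (fun W => opK α f W l j) Z j l +
        n * (α * (β - (n + 1) / 2)) * f Z := by
  simp only [opOmega, Matrix.trace_add, Matrix.trace_smul, Matrix.trace_one, Fintype.card_fin,
    smul_eq_mul]
  congr 1
  push_cast
  ring

theorem contDiffAt_ext_laplacian {r m : WithTop ℕ∞} (hrm : m + 1 + 1 ≤ r) {f : HalfSpace n → ℂ}
    {Z : HalfSpace n} (hf : ContDiffAt ℝ r (ext f) Z.1) (α β : ℝ) :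
    ContDiffAt ℝ m (ext (laplacian α β f)) Z.1 := by
  have h : laplacian α β f = fun W => (-1 : ℂ) *
      (∑ j, ∑ l, opLambda (β - (n + 1) / 2) (fun W => opK α f W l j) W j l +
        n * (α * (β - (n + 1) / 2)) * f W) := by
    funext W
    rw [laplacian, trace_opOmega_apply]
    ring
  rw [h]
  have hf' : ContDiffAt ℝ m (ext f) Z.1 :=
    hf.of_le ((le_self_add.trans le_self_add).trans hrm)
  exact contDiffAt_ext_const_mul _ (contDiffAt_ext_add (contDiffAt_ext_sum _ fun j _ =>
    contDiffAt_ext_sum _ fun l _ => (contDiffAt_ext_op le_rfl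
      (contDiffAt_ext_op hrm hf α l j).1 _ j l).2) (contDiffAt_ext_const_mul _ hf'))

/-! ### The two factorizations of `tr Ω` -/

/-- Both sides are the same combination of second real derivatives, by symmetry of the second
differential. -/
theorem dZ_dZbar_comm {f : HalfSpace n → ℂ} {Z : HalfSpace n} (hf : ContDiffAt ℝ 2 (ext f) Z.1)
    (a b c d : Fin n) :
    dZ (fun W => dZbar f W a b) Z c d = dZbar (fun W => dZ f W c d) Z a b := by
  have h := ((hf.fderiv_right (m := 1) (by norm_num)).differentiableAt one_ne_zero).hasFDerivAt
  have h1 : ∀ v, HasFDerivAt (fun z => fderiv ℝ (ext f) z v)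
      ((ContinuousLinearMap.apply ℝ ℂ v).comp (fderiv ℝ (fderiv ℝ (ext f)) Z.1)) Z.1 := fun v =>
    (ContinuousLinearMap.apply ℝ ℂ v).hasFDerivAt.comp Z.1 h
  have hsymm := hf.isSymmSndFDerivAt (by simp)
  have e1 := dZ_congr (f := fun W => dZbar f W a b)
    (((h1 (Pi.single s(a, b) 1)).add ((h1 (Pi.single s(a, b) Complex.I)).const_mul
      Complex.I)).const_mul ((1 + if a = b then 1 else 0) / 4 : ℂ))
    (fun W => by
      rw [dZbar_eq]
      rfl)
  have e2 := dZ_congr (f := fun W => dZ f W c d)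
    (((h1 (Pi.single s(c, d) 1)).sub ((h1 (Pi.single s(c, d) Complex.I)).const_mul
      Complex.I)).const_mul ((1 + if c = d then 1 else 0) / 4 : ℂ))
    (fun W => by
      rw [dZ_eq]
      rfl)
  rw [e1.1, e2.2]
  simp only [wirt, wirtBar, Matrix.of_apply, _root_.smul_apply, _root_.add_apply,
    _root_.sub_apply, ContinuousLinearMap.comp_apply, ContinuousLinearMap.apply_apply,
    smul_eq_mul]
  rw [hsymm (Pi.single s(a, b) 1), hsymm (Pi.single s(a, b) 1), hsymm (Pi.single s(a, b) Complex.I),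
    hsymm (Pi.single s(a, b) Complex.I)]
  ring

/-- The contraction of the derivatives of `Z - conj Z`. -/
theorem sum_contract (S G : Matrix (Fin n) (Fin n) ℂ) (ε : ℂ) :
    ∑ j, ∑ l, ∑ m, S j m * ∑ p, ((if m = l then 1 else 0) * (if l = p then 1 else 0) +
        (if m = p then 1 else 0)) * (ε / 2 * G p j) =
      ε * (n + 1) / 2 * (S * G).trace := by
  have h1 : ∀ j l m, ∑ p, ((if m = l then 1 else 0) * (if l = p then 1 else 0) +
        (if m = p then 1 else 0)) * (ε / 2 * G p j) =
      ε / 2 * ((if m = l then 1 else 0) + 1) * G m j := by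
    intro j l m
    simp only [add_mul, Finset.sum_add_distrib]
    by_cases h : m = l
    · subst h
      simp
      ring
    · simp [h]
  simp only [h1]
  simp only [Matrix.trace, Matrix.diag, Matrix.mul_apply, Finset.mul_sum]
  refine Finset.sum_congr rfl fun j _ => ?_
  rw [Finset.sum_comm]
  refine Finset.sum_congr rfl fun m _ => ?_
  have h2 : ∀ l, S j m * (ε / 2 * ((if m = l then 1 else 0) + 1) * G m j) =
      (S j m * (ε / 2) * G m j) * ((if m = l then 1 else 0) + 1) := fun l => by ring
  simp only [h2, ← Finset.mul_sum, Finset.sum_add_distrib, Finset.sum_ite_eq, Finset.mem_univ,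
    if_true, Finset.sum_const, Finset.card_univ, Fintype.card_fin, nsmul_eq_mul, mul_one]
  ring

theorem trace_eq_sum (A B : Matrix (Fin n) (Fin n) ℂ) :
    (A * B).trace = ∑ j, ∑ m, A j m * B m j := by
  simp [Matrix.trace, Matrix.mul_apply]

/-- Letting `Λ` differentiate the coefficient `Z - conj Z` of `K` produces the first-order term with
`(n+1)/2`. With `b = β - (n+1)/2` the coefficient of `tr((Z - conj Z) ∂/∂Z)` becomes `-β`. -/
theorem sum_opLambda_opK {f : HalfSpace n → ℂ} {Z : HalfSpace n}
    (hf : ContDiffAt ℝ 2 (ext f) Z.1) (α b : ℝ) :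
    ∑ j, ∑ l, opLambda b (fun W => opK α f W l j) Z j l =
      ∑ j, ∑ l, ∑ m, Z.subConj j m * ∑ p, Z.subConj l p * dZbar (fun W => dZ f W p j) Z m l -
        ((n + 1) / 2 + b) * (Z.subConj * dZ f Z).trace + α * (Z.subConj * dZbar f Z).trace -
        n * (α * b) * f Z := by
  have hfd : DifferentiableAt ℝ (ext f) Z.1 := hf.differentiableAt two_ne_zero
  have hdd : ∀ p j, DifferentiableAt ℝ (ext fun W => dZ f W p j) Z.1 := fun p j =>
    ((contDiffAt_ext_dZ (m := 1) (by norm_num) hf p j).1).differentiableAt one_ne_zero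
  have hK : ∀ l j m, dZbar (fun W => opK α f W l j) Z m l =
      ∑ p, ((if m = l then 1 else 0) * (if l = p then 1 else 0) +
        (if m = p then 1 else 0)) * (-1 / 2 * dZ f Z p j) +
      ∑ p, Z.subConj l p * dZbar (fun W => dZ f W p j) Z m l +
      (if l = j then α else 0 : ℂ) * dZbar f Z m l := by
    intro l j m
    simp only [opK_apply]
    rw [(dZ_add (differentiableAt_ext_sum _ fun p _ => differentiableAt_ext_mul
      (differentiableAt_ext_subConj Z l p) (hdd p j)) (differentiableAt_ext_const_mul _ hfd)).2,
      (dZ_const_mul _ hfd).2, (dZ_sum _ fun p _ => differentiableAt_ext_mul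
      (differentiableAt_ext_subConj Z l p) (hdd p j)).2, Matrix.add_apply, Matrix.smul_apply,
      Matrix.sum_apply, smul_eq_mul, ← Finset.sum_add_distrib]
    congr 1
    refine Finset.sum_congr rfl fun p _ => ?_
    rw [(dZ_mul (differentiableAt_ext_subConj Z l p) (hdd p j)).2, Matrix.add_apply,
      Matrix.smul_apply, Matrix.smul_apply, (dZ_subConj Z l p m l).2, smul_eq_mul, smul_eq_mul, if_pos (Eq.refl l)]
    ring
  have hL : ∀ j l, opLambda b (fun W => opK α f W l j) Z j l =
      ∑ m, Z.subConj j m * dZbar (fun W => opK α f W l j) Z m l +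
        (if j = l then -b else 0 : ℂ) * opK α f Z l j := fun j l => opLambda_apply _ _ _ _ _
  simp only [hL, hK, mul_add, Finset.sum_add_distrib]
  rw [sum_contract Z.subConj (dZ f Z) (-1)]
  have h1 : ∑ j, ∑ l, ∑ m, Z.subConj j m * ((if l = j then α else 0 : ℂ) * dZbar f Z m l) =
      α * (Z.subConj * dZbar f Z).trace := by
    rw [trace_eq_sum, Finset.mul_sum]
    refine Finset.sum_congr rfl fun j _ => ?_
    rw [Finset.sum_eq_single j (fun l _ h => by simp [h]) (by simp), Finset.mul_sum]
    refine Finset.sum_congr rfl fun m _ => ?_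
    simp only [if_true]
    ring
  have h2 : ∑ j, ∑ l, (if j = l then -b else 0 : ℂ) * opK α f Z l j =
      -b * (Z.subConj * dZ f Z).trace - n * (α * b) * f Z := by
    have : ∀ j, ∑ l, (if j = l then -b else 0 : ℂ) * opK α f Z l j =
        -b * ∑ m, Z.subConj j m * dZ f Z m j - α * b * f Z := by
      intro j
      rw [Finset.sum_eq_single j (fun l _ h => by simp [h.symm]) (by simp), opK_apply]
      simp only [if_true]
      ring
    simp only [this, Finset.sum_sub_distrib, ← Finset.mul_sum, ← trace_eq_sum, Finset.sum_const,
      Finset.card_univ, Fintype.card_fin, nsmul_eq_mul]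
    ring
  rw [h1, h2]
  ring

/-- The mirror image of `sum_opLambda_opK`. For `a = α - (n+1)/2` its first-order terms coincide
with those of the other order. -/
theorem sum_opK_opLambda {f : HalfSpace n → ℂ} {Z : HalfSpace n}
    (hf : ContDiffAt ℝ 2 (ext f) Z.1) (a β : ℝ) :
    ∑ j, ∑ l, opK a (fun W => opLambda β f W l j) Z j l =
      ∑ j, ∑ l, ∑ m, Z.subConj j m * ∑ p, Z.subConj l p * dZ (fun W => dZbar f W p j) Z m l +
        ((n + 1) / 2 + a) * (Z.subConj * dZbar f Z).trace - β * (Z.subConj * dZ f Z).trace -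
        n * (a * β) * f Z := by
  have hfd : DifferentiableAt ℝ (ext f) Z.1 := hf.differentiableAt two_ne_zero
  have hdd : ∀ p j, DifferentiableAt ℝ (ext fun W => dZbar f W p j) Z.1 := fun p j =>
    ((contDiffAt_ext_dZ (m := 1) (by norm_num) hf p j).2).differentiableAt one_ne_zero
  have hK : ∀ l j m, dZ (fun W => opLambda β f W l j) Z m l =
      ∑ p, ((if m = l then 1 else 0) * (if l = p then 1 else 0) +
        (if m = p then 1 else 0)) * (1 / 2 * dZbar f Z p j) +
      ∑ p, Z.subConj l p * dZ (fun W => dZbar f W p j) Z m l +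
      (if l = j then -β else 0 : ℂ) * dZ f Z m l := by
    intro l j m
    simp only [opLambda_apply]
    rw [(dZ_add (differentiableAt_ext_sum _ fun p _ => differentiableAt_ext_mul
      (differentiableAt_ext_subConj Z l p) (hdd p j)) (differentiableAt_ext_const_mul _ hfd)).1,
      (dZ_const_mul _ hfd).1, (dZ_sum _ fun p _ => differentiableAt_ext_mul
      (differentiableAt_ext_subConj Z l p) (hdd p j)).1, Matrix.add_apply, Matrix.smul_apply,
      Matrix.sum_apply, smul_eq_mul, ← Finset.sum_add_distrib]
    congr 1
    refine Finset.sum_congr rfl fun p _ => ?_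
    rw [(dZ_mul (differentiableAt_ext_subConj Z l p) (hdd p j)).1, Matrix.add_apply,
      Matrix.smul_apply, Matrix.smul_apply, (dZ_subConj Z l p m l).1, smul_eq_mul, smul_eq_mul, if_pos (Eq.refl l)]
    ring
  have hL : ∀ j l, opK a (fun W => opLambda β f W l j) Z j l =
      ∑ m, Z.subConj j m * dZ (fun W => opLambda β f W l j) Z m l +
        (if j = l then a else 0 : ℂ) * opLambda β f Z l j := fun j l => opK_apply _ _ _ _ _
  simp only [hL, hK, mul_add, Finset.sum_add_distrib]
  rw [sum_contract Z.subConj (dZbar f Z) 1]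
  have h1 : ∑ j, ∑ l, ∑ m, Z.subConj j m * ((if l = j then -β else 0 : ℂ) * dZ f Z m l) =
      -β * (Z.subConj * dZ f Z).trace := by
    rw [trace_eq_sum, Finset.mul_sum]
    refine Finset.sum_congr rfl fun j _ => ?_
    rw [Finset.sum_eq_single j (fun l _ h => by simp [h]) (by simp), Finset.mul_sum]
    refine Finset.sum_congr rfl fun m _ => ?_
    simp only [if_true]
    ring
  have h2 : ∑ j, ∑ l, (if j = l then a else 0 : ℂ) * opLambda β f Z l j =
      a * (Z.subConj * dZbar f Z).trace - n * (a * β) * f Z := by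
    have : ∀ j, ∑ l, (if j = l then a else 0 : ℂ) * opLambda β f Z l j =
        a * ∑ m, Z.subConj j m * dZbar f Z m j - a * β * f Z := by
      intro j
      rw [Finset.sum_eq_single j (fun l _ h => by simp [h.symm]) (by simp), opLambda_apply]
      simp only [if_true]
      ring
    simp only [this, Finset.sum_sub_distrib, ← Finset.mul_sum, ← trace_eq_sum, Finset.sum_const,
      Finset.card_univ, Fintype.card_fin, nsmul_eq_mul]
    ring
  rw [h1, h2]
  ring

/-- `tr Ω_{α,β} = tr (K_{α-(n+1)/2} Λ_β) + n β (α - (n+1)/2)`. -/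
theorem trace_opOmega {f : HalfSpace n → ℂ} {Z : HalfSpace n} (hf : ContDiffAt ℝ 2 (ext f) Z.1)
    (α β : ℝ) : (opOmega α β f Z).trace =
      ∑ j, ∑ l, opK (α - (n + 1) / 2) (fun W => opLambda β f W l j) Z j l +
        ((n * β * (α - (n + 1) / 2) : ℝ) : ℂ) * f Z := by
  rw [trace_opOmega_apply, sum_opLambda_opK hf, sum_opK_opLambda hf]
  -- After commuting the derivatives the two sums differ by the exchange of `(j, m)` with `(l, p)`.
  have hS : ∑ j, ∑ l, ∑ m, Z.subConj j m * ∑ p, Z.subConj l p * dZ (fun W => dZbar f W p j) Z m l =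
      ∑ j, ∑ l, ∑ m, Z.subConj j m * ∑ p, Z.subConj l p * dZbar (fun W => dZ f W p j) Z m l := by
    simp only [dZ_dZbar_comm hf, Finset.mul_sum]
    rw [Finset.sum_comm]
    refine Finset.sum_congr rfl fun l _ => Finset.sum_congr rfl fun j _ => ?_
    rw [Finset.sum_comm]
    exact Finset.sum_congr rfl fun p _ => Finset.sum_congr rfl fun m _ => by ring
  rw [hS]
  push_cast
  ring

/-! ### Powers of `det Y` -/

/-- The imaginary part of a symmetric matrix, as a complex matrix. -/
def imMatrix (z : Sym2 (Fin n) → ℂ) : Matrix (Fin n) (Fin n) ℂ :=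
  ((symMatrix z).map Complex.im).map Complex.ofReal

/-- `det Y` in coordinates. -/
def detIm (z : Sym2 (Fin n) → ℂ) : ℝ := ((symMatrix z).map Complex.im).det

theorem ofReal_detIm (z : Sym2 (Fin n) → ℂ) : (detIm z : ℂ) = (imMatrix z).det :=
  Complex.ofRealHom.map_det _

theorem detIm_val (Z : HalfSpace n) : detIm Z.1 = Z.Y.det := rfl

theorem imMatrix_val (Z : HalfSpace n) : imMatrix Z.1 = Z.Y.map Complex.ofReal := rfl

theorem imMatrix_transpose (z : Sym2 (Fin n) → ℂ) : (imMatrix z)ᵀ = imMatrix z := by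
  rw [imMatrix, ← Matrix.transpose_map, im_symm]

theorem imMatrix_add_smul (z v : Sym2 (Fin n) → ℂ) (t : ℝ) :
    imMatrix (z + t • v) = imMatrix z + (t : ℂ) • imMatrix v := by
  ext i j
  simp [imMatrix, symMatrix]

theorem imMatrix_eq (v : Sym2 (Fin n) → ℂ) :
    imMatrix v = (-(Complex.I / 2)) • (symMatrix v - (symMatrix v).map conj) := by
  ext i j
  have h := Complex.sub_conj (symMatrix v i j)
  simp only [imMatrix, Matrix.map_apply, Matrix.smul_apply, Matrix.sub_apply, smul_eq_mul]
  rw [h]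
  push_cast
  linear_combination ((symMatrix v i j).im : ℂ) * Complex.I_sq

theorem contDiffAt_detIm {r : WithTop ℕ∞} (z : Sym2 (Fin n) → ℂ) :
    ContDiffAt ℝ r (detIm (n := n)) z := by
  have h : (detIm (n := n)) = fun z => Complex.reCLM ((imMatrix z).det) := by
    funext z
    rw [← ofReal_detIm, Complex.reCLM_apply, Complex.ofReal_re]
  rw [h]
  refine Complex.reCLM.contDiff.contDiffAt.comp z (contDiffAt_det fun i j => ?_)
  have h1 : ContDiff ℝ r fun z : Sym2 (Fin n) → ℂ =>
      Complex.ofRealCLM (Complex.imCLM (z s(i, j))) :=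
    Complex.ofRealCLM.contDiff.comp (Complex.imCLM.contDiff.comp (contDiff_apply ℝ ℂ _))
  exact h1.contDiffAt

theorem det_imMatrix_ne_zero (Z : HalfSpace n) : (imMatrix Z.1).det ≠ 0 := by
  rw [← ofReal_detIm, detIm_val, Complex.ofReal_ne_zero]
  exact (det_Y_pos Z).ne'

theorem fderiv_detIm (Z : HalfSpace n) (v : Sym2 (Fin n) → ℂ) :
    (fderiv ℝ detIm Z.1 v : ℂ) = Z.Y.det * ((imMatrix Z.1)⁻¹ * imMatrix v).trace := by
  have hd := ((contDiffAt_detIm (r := 1) Z.1).differentiableAt one_ne_zero).hasFDerivAt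
  have h1 : HasFDerivAt (fun z => (detIm z : ℂ)) (Complex.ofRealCLM.comp (fderiv ℝ detIm Z.1))
      Z.1 := Complex.ofRealCLM.hasFDerivAt.comp Z.1 hd
  have h2 : fderiv ℝ (fun z => (detIm z : ℂ)) Z.1 v =
      (imMatrix Z.1).det * ((imMatrix Z.1)⁻¹ * imMatrix v).trace := by
    refine fderiv_apply_of_line h1.differentiableAt ?_
    simp only [ofReal_detIm, imMatrix_add_smul]
    exact hasDerivAt_det_add_smul (det_imMatrix_ne_zero Z) _
  rw [h1.fderiv, ← ofReal_detIm, detIm_val] at h2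
  exact h2

theorem contDiffAt_ext_det_rpow {r : WithTop ℕ∞} (s : ℝ) (Z : HalfSpace n) :
    ContDiffAt ℝ r (ext fun W => ((W.Y.det ^ s : ℝ) : ℂ)) Z.1 := by
  have h : ContDiffAt ℝ r (fun z => Complex.ofRealCLM (detIm z ^ s)) Z.1 :=
    Complex.ofRealCLM.contDiff.contDiffAt.comp Z.1
      ((contDiffAt_detIm Z.1).rpow_const_of_ne (det_Y_pos Z).ne')
  exact contDiffAt_ext_congr h fun W => rfl

/-- By Jacobi's formula `∂/∂Z` of `det(Y)^s` is `-(i/2) s det(Y)^s Y⁻¹`, and `Z - conj Z = 2iY`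
cancels the inverse. -/
theorem subConj_mul_dZ_det_rpow (s : ℝ) (Z : HalfSpace n) :
    Z.subConj * dZ (fun W => ((W.Y.det ^ s : ℝ) : ℂ)) Z =
      ((s * Z.Y.det ^ s : ℝ) : ℂ) • (1 : Matrix (Fin n) (Fin n) ℂ) := by
  have hd := ((contDiffAt_detIm (r := 1) Z.1).differentiableAt one_ne_zero).hasFDerivAt
  have h1 : HasFDerivAt (fun z => ((detIm z ^ s : ℝ) : ℂ)) (Complex.ofRealCLM.comp
      ((s * detIm Z.1 ^ (s - 1)) • fderiv ℝ detIm Z.1)) Z.1 :=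
    Complex.ofRealCLM.hasFDerivAt.comp Z.1 (hd.rpow_const (Or.inl (det_Y_pos Z).ne'))
  have h2 := dZ_congr (f := fun W => ((W.Y.det ^ s : ℝ) : ℂ)) h1 fun W => rfl
  have hu : IsUnit (imMatrix Z.1).det := isUnit_iff_ne_zero.2 (det_imMatrix_ne_zero Z)
  have hsym : ((imMatrix Z.1)⁻¹)ᵀ = (imMatrix Z.1)⁻¹ := by
    rw [Matrix.transpose_nonsing_inv, imMatrix_transpose]
  set c : ℂ := ((s * Z.Y.det ^ s : ℝ) : ℂ) with hc
  have h3 := wirt_eq_wirtBar_eq (A := (-(Complex.I / 2) * c) • (imMatrix Z.1)⁻¹)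
    (B := (Complex.I / 2 * c) • (imMatrix Z.1)⁻¹) (by rw [Matrix.transpose_smul, hsym])
    (by rw [Matrix.transpose_smul, hsym])
    (L := Complex.ofRealCLM.comp ((s * detIm Z.1 ^ (s - 1)) • fderiv ℝ detIm Z.1)) (fun v => by
      rw [ContinuousLinearMap.comp_apply, _root_.smul_apply, Complex.ofRealCLM_apply, smul_eq_mul,
        Complex.ofReal_mul, fderiv_detIm, imMatrix_eq v, Matrix.mul_smul, Matrix.mul_sub,
        Matrix.trace_smul, Matrix.trace_sub, Matrix.smul_mul, Matrix.smul_mul, Matrix.trace_smul,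
        Matrix.trace_smul, detIm_val]
      have h4 : c = ((s * Z.Y.det ^ (s - 1) : ℝ) : ℂ) * (Z.Y.det : ℂ) := by
        rw [hc, ← Complex.ofReal_mul, mul_assoc, ← Real.rpow_add_one (det_Y_pos Z).ne',
          sub_add_cancel]
      rw [h4]
      simp only [smul_eq_mul]
      ring)
  rw [h2.1, h3.1, subConj_eq, ← imMatrix_val, Matrix.smul_mul, Matrix.mul_smul,
    Matrix.mul_nonsing_inv _ hu, smul_smul]
  congr 1
  linear_combination -c * Complex.I_sq

/-! ### The divergence identity -/

/-- For `j = l` the symmetrised derivative gives `1/2` for each of the `n` values of `m`, and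
another `1/2` at `m = j`. -/
theorem sum_dZ_subConj (Z : HalfSpace n) (j l : Fin n) :
    ∑ m, dZ (fun W => W.subConj j m) Z m l = (n + 1) / 2 * (if j = l then 1 else 0) := by
  have h : ∀ m, dZ (fun W => W.subConj j m) Z m l =
      1 / 2 * ((if m = j then (if l = j then 1 else 0) else 0) + (if j = l then 1 else 0)) := by
    intro m
    rw [(dZ_subConj Z j m m l).1]
    by_cases h1 : m = j
    · subst h1
      by_cases h2 : l = m
      · subst h2
        simp
      · simp [h2, Ne.symm h2]
    · by_cases h2 : l = j
      · subst h2
        simp [h1]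
      · simp [h1, h2, Ne.symm h2]
  simp only [h, ← Finset.mul_sum, Finset.sum_add_distrib, Finset.sum_ite_eq', Finset.mem_univ,
    if_true, Finset.sum_const, Finset.card_univ, Fintype.card_fin, nsmul_eq_mul, eq_comm (a := l)]
  ring

/-- The vector field whose divergence compares `K` and the adjoint of `Λ`. -/
def field (s : ℝ) (F : HalfSpace n → Matrix (Fin n) (Fin n) ℂ) (ψ : HalfSpace n → ℂ)
    (j l m : Fin n) (Z : HalfSpace n) : ℂ :=
  ((Z.Y.det ^ s : ℝ) : ℂ) * (Z.subConj j m * (F Z l j * conj (ψ Z)))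

theorem contDiffAt_ext_field {r : WithTop ℕ∞} (s : ℝ) {F : HalfSpace n → Matrix (Fin n) (Fin n) ℂ}
    {ψ : HalfSpace n → ℂ} {Z : HalfSpace n}
    (hF : ∀ l j, ContDiffAt ℝ r (ext fun W => F W l j) Z.1)
    (hψ : ContDiffAt ℝ r (ext ψ) Z.1) (j l m : Fin n) :
    ContDiffAt ℝ r (ext (field s F ψ j l m)) Z.1 :=
  contDiffAt_ext_mul (contDiffAt_ext_det_rpow s Z) (contDiffAt_ext_mul
    (contDiffAt_ext_subConj Z j m) (contDiffAt_ext_mul (hF l j) (contDiffAt_ext_conj hψ)))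

theorem map_conj_subConj (Z : HalfSpace n) : Z.subConj.map conj = -Z.subConj := by
  ext i j
  simp [HalfSpace.subConj]

/-- The product rule has four terms. The derivatives of `F` and of `conj ψ` give the first-order
parts of `K` and of `conj Λ`, the latter with a sign because `Z - conj Z` is purely imaginary. The
derivatives of `det(Y)^s` and of `Z - conj Z` give the zero-order parts. -/
theorem sum_dZ_field (α β : ℝ) {F : HalfSpace n → Matrix (Fin n) (Fin n) ℂ}
    {ψ : HalfSpace n → ℂ} {Z : HalfSpace n}
    (hF : ∀ l j, ContDiffAt ℝ 1 (ext fun W => F W l j) Z.1)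
    (hψ : ContDiffAt ℝ 1 (ext ψ) Z.1) :
    ∑ j, ∑ l, ∑ m, dZ (field (α + β - (n + 1)) F ψ j l m) Z m l =
      ((Z.Y.det ^ (α + β - (n + 1)) : ℝ) : ℂ) *
        ((∑ j, ∑ l, opK (α - (n + 1) / 2) (fun W => F W l j) Z j l) * conj (ψ Z) -
          (F Z * (opLambda β ψ Z).map conj).trace) := by
  set s : ℝ := α + β - (n + 1) with hs
  set ρ : ℂ := ((Z.Y.det ^ s : ℝ) : ℂ) with hρ
  have dρ : DifferentiableAt ℝ (ext fun W : HalfSpace n => ((W.Y.det ^ s : ℝ) : ℂ)) Z.1 :=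
    (contDiffAt_ext_det_rpow (r := 1) s Z).differentiableAt one_ne_zero
  have dF : ∀ l j, DifferentiableAt ℝ (ext fun W => F W l j) Z.1 := fun l j =>
    (hF l j).differentiableAt one_ne_zero
  have dψ : DifferentiableAt ℝ (ext ψ) Z.1 := hψ.differentiableAt one_ne_zero
  have dψ' : DifferentiableAt ℝ (ext fun W => conj (ψ W)) Z.1 :=
    (contDiffAt_ext_conj hψ).differentiableAt one_ne_zero
  have dS := differentiableAt_ext_subConj Z
  have h1 : ∀ j l m, dZ (field s F ψ j l m) Z m l =
      (Z.subConj j m * dZ (fun W : HalfSpace n => ((W.Y.det ^ s : ℝ) : ℂ)) Z m l) *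
        (F Z l j * conj (ψ Z)) +
      dZ (fun W => W.subConj j m) Z m l * (ρ * (F Z l j * conj (ψ Z))) +
      (Z.subConj j m * dZ (fun W => F W l j) Z m l) * (ρ * conj (ψ Z)) +
      (Z.subConj j m * conj (dZbar ψ Z m l)) * (ρ * F Z l j) := by
    intro j l m
    have e1 := (dZ_mul dρ (differentiableAt_ext_mul (dS j m) (differentiableAt_ext_mul (dF l j)
      dψ'))).1
    rw [(dZ_mul (dS j m) (differentiableAt_ext_mul (dF l j) dψ')).1, (dZ_mul (dF l j) dψ').1,
      dZ_conj dψ] at e1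
    have e2 := congrFun (congrFun e1 m) l
    simp only [Matrix.add_apply, Matrix.smul_apply, Matrix.map_apply, smul_eq_mul] at e2
    unfold field
    rw [e2]
    ring
  have h2 : ∀ j l, ∑ m, dZ (field s F ψ j l m) Z m l =
      (if j = l then ((s + (n + 1) / 2 : ℝ) : ℂ) else 0) * (ρ * (F Z l j * conj (ψ Z))) +
      (∑ m, Z.subConj j m * dZ (fun W => F W l j) Z m l) * (ρ * conj (ψ Z)) +
      (∑ m, Z.subConj j m * conj (dZbar ψ Z m l)) * (ρ * F Z l j) := by
    intro j l
    have e := congrFun (congrFun (subConj_mul_dZ_det_rpow s Z) j) l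
    rw [Matrix.mul_apply, Matrix.smul_apply, Matrix.one_apply, Complex.ofReal_mul, ← hρ,
      smul_eq_mul] at e
    simp only [h1, Finset.sum_add_distrib, ← Finset.sum_mul]
    rw [e, sum_dZ_subConj]
    split_ifs <;> push_cast <;> ring
  have h3 : ∀ j l, opK (α - (n + 1) / 2) (fun W => F W l j) Z j l =
      ∑ m, Z.subConj j m * dZ (fun W => F W l j) Z m l +
        (if j = l then ((α - (n + 1) / 2 : ℝ) : ℂ) else 0) * F Z l j := fun j l => by
    rw [opK_apply]
  have h4 : ∀ j l, (opLambda β ψ Z).map conj j l =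
      -∑ m, Z.subConj j m * conj (dZbar ψ Z m l) + (if j = l then -β else 0 : ℂ) * conj (ψ Z) := by
    intro j l
    have hW : ∀ m, conj (Z.subConj j m) = -Z.subConj j m := fun m =>
      congrFun (congrFun (map_conj_subConj Z) j) m
    rw [Matrix.map_apply, opLambda_apply]
    simp only [map_add, map_sum, map_mul, hW, neg_mul, Finset.sum_neg_distrib]
    congr 2
    split_ifs <;> simp
  rw [trace_eq_sum, Finset.sum_comm (f := fun j m => F Z j m * _), mul_sub, Finset.sum_mul,
    Finset.mul_sum, Finset.mul_sum, ← Finset.sum_sub_distrib]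
  refine Finset.sum_congr rfl fun j _ => ?_
  rw [Finset.sum_mul, Finset.mul_sum, Finset.mul_sum, ← Finset.sum_sub_distrib]
  refine Finset.sum_congr rfl fun l _ => ?_
  rw [h2, h3, h4]
  -- On the diagonal, `s + (n+1)/2 = (α - (n+1)/2) + β` splits into the constants of `K` and `Λ`.
  split_ifs
  · rw [hs]
    push_cast
    ring
  · ring

/-! ### Integration by parts on the half-space -/

/-- A function on the half-space that vanishes outside a compact set. -/
def IsTest (f : HalfSpace n → ℂ) : Prop :=
  (∀ Z : HalfSpace n, ContDiffAt ℝ 1 (ext f) Z.1) ∧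
    ∃ K : Set (HalfSpace n), IsCompact K ∧ ∀ Z, Z ∉ K → f Z = 0

theorem support_ext_subset {f : HalfSpace n → ℂ} {K : Set (HalfSpace n)}
    (hf : ∀ Z, Z ∉ K → f Z = 0) : ∀ z, z ∉ (Subtype.val '' K : Set (Sym2 (Fin n) → ℂ)) →
      ext f z = 0 := by
  intro z hz
  by_cases hzU : z ∈ upper n
  · obtain ⟨(W : HalfSpace n), rfl⟩ := hzU
    rw [ext_val]
    exact hf W fun hW => hz ⟨W, hW, rfl⟩
  · exact ext_of_notMem f hzU

theorem hasCompactSupport_ext {f : HalfSpace n → ℂ} {K : Set (HalfSpace n)} (hK : IsCompact K)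
    (hf : ∀ Z, Z ∉ K → f Z = 0) : HasCompactSupport (ext f) :=
  HasCompactSupport.intro (hK.image continuous_subtype_val) (support_ext_subset hf)

theorem contDiff_ext {r : WithTop ℕ∞} {f : HalfSpace n → ℂ} {K : Set (HalfSpace n)}
    (hK : IsCompact K) (hf : ∀ Z, Z ∉ K → f Z = 0)
    (hd : ∀ Z : HalfSpace n, ContDiffAt ℝ r (ext f) Z.1) : ContDiff ℝ r (ext f) := by
  rw [contDiff_iff_contDiffAt]
  intro z
  by_cases hz : z ∈ upper n
  · obtain ⟨(W : HalfSpace n), rfl⟩ := hz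
    exact hd W
  · have hKc : IsClosed (Subtype.val '' K : Set (Sym2 (Fin n) → ℂ)) :=
      (hK.image continuous_subtype_val).isClosed
    have hz' : z ∈ (Subtype.val '' K : Set (Sym2 (Fin n) → ℂ))ᶜ := by
      rintro ⟨W, -, rfl⟩
      exact hz (val_mem_upper W)
    refine (contDiffAt_const (c := (0 : ℂ))).congr_of_eventuallyEq ?_
    filter_upwards [hKc.isOpen_compl.mem_nhds hz'] with w hw
    exact support_ext_subset hf w hw

/-- Integration by parts against the constant function `1`. -/
theorem integral_fderiv_eq_zero {g : (Sym2 (Fin n) → ℂ) → ℂ} (hg : ContDiff ℝ 1 g)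
    (hc : HasCompactSupport g) (v : Sym2 (Fin n) → ℂ) : ∫ z, fderiv ℝ g z v = 0 := by
  have hi : Integrable (fun z => fderiv ℝ g z v) := by
    refine Continuous.integrable_of_hasCompactSupport
      ((hg.continuous_fderiv one_ne_zero).clm_apply continuous_const) ?_
    exact (hc.fderiv (𝕜 := ℝ)).comp_left (g := fun L : (Sym2 (Fin n) → ℂ) →L[ℝ] ℂ => L v) rfl
  have h := integral_mul_fderiv_eq_neg_fderiv_mul_of_integrable (𝕜 := ℂ)
    (μ := (volume : Measure (Sym2 (Fin n) → ℂ))) (f := fun _ => (1 : ℂ)) (g := g) (v := v)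
    (by simp) (by simpa using hi)
    (by simpa using hg.continuous.integrable_of_hasCompactSupport hc)
    (fun _ _ => differentiableAt_const _) (fun x _ => hg.differentiable one_ne_zero x)
  simpa using h

theorem integral_dZ_eq_zero {f : HalfSpace n → ℂ} (hf : IsTest f) (m l : Fin n) :
    IntegrableOn (ext fun Z => dZ f Z m l) (upper n) ∧
      ∫ z in upper n, ext (fun Z => dZ f Z m l) z = 0 := by
  obtain ⟨hd, K, hK, hfK⟩ := hf
  have hg := contDiff_ext hK hfK hd
  have hc := hasCompactSupport_ext hK hfK
  have hi : ∀ v, Integrable (fun z => fderiv ℝ (ext f) z v) := fun v => by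
    refine Continuous.integrable_of_hasCompactSupport
      ((hg.continuous_fderiv one_ne_zero).clm_apply continuous_const) ?_
    exact (hc.fderiv (𝕜 := ℝ)).comp_left (g := fun L : (Sym2 (Fin n) → ℂ) →L[ℝ] ℂ => L v) rfl
  have h0 : Set.EqOn (ext fun Z => dZ f Z m l) (fun z => wirt (fderiv ℝ (ext f) z) m l)
      (upper n) := by
    rintro _ ⟨(W : HalfSpace n), rfl⟩
    simp only [ext_val, dZ_eq]
  have h1 := setIntegral_congr_fun (μ := (volume : Measure (Sym2 (Fin n) → ℂ)))
    measurableSet_upper h0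
  have h2 : ∫ z in upper n, wirt (fderiv ℝ (ext f) z) m l =
      ∫ z, wirt (fderiv ℝ (ext f) z) m l := by
    refine setIntegral_eq_integral_of_forall_compl_eq_zero fun z hz => ?_
    have hz' : z ∉ tsupport (ext f) := by
      have hKc : IsClosed (Subtype.val '' K : Set (Sym2 (Fin n) → ℂ)) :=
        (hK.image continuous_subtype_val).isClosed
      have hsub : tsupport (ext f) ⊆ Subtype.val '' K :=
        closure_minimal (fun w hw => by
          by_contra hw'
          exact hw (support_ext_subset hfK w hw')) hKc
      intro h
      obtain ⟨W, -, rfl⟩ := hsub h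
      exact hz (val_mem_upper W)
    have h0 : fderiv ℝ (ext f) z = 0 := by
      by_contra h
      exact hz' (support_fderiv_subset ℝ h)
    rw [h0, wirt_zero]
    rfl
  have h3 : Integrable fun z => wirt (fderiv ℝ (ext f) z) m l := by
    simp only [wirt, Matrix.of_apply]
    exact ((hi _).sub ((hi _).const_mul _)).const_mul _
  refine ⟨h3.integrableOn.congr_fun h0.symm measurableSet_upper, ?_⟩
  rw [h1, h2]
  simp only [wirt, Matrix.of_apply]
  rw [integral_const_mul, integral_sub (hi _) ((hi _).const_mul _), integral_const_mul,
    integral_fderiv_eq_zero hg hc, integral_fderiv_eq_zero hg hc]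
  simp

theorem integral_siegelMeasure (h : HalfSpace n → ℂ) :
    ∫ Z, h Z ∂(siegelMeasure n) = ∫ z in upper n, (density z : ℂ) * ext h z := by
  have hmeas : Measurable fun Z : HalfSpace n => ENNReal.ofReal ((HalfSpace.Y Z).det ^ (n + 1))⁻¹ := by
    have hc : Continuous fun Z : HalfSpace n => Z.Y.det :=
      continuous_iff_continuousAt.2 fun Z =>
        (contDiffAt_detIm (r := 1) Z.1).continuousAt.comp continuous_subtype_val.continuousAt
    exact ((hc.measurable.pow_const _).inv).ennreal_ofReal
  rw [siegelMeasure, integral_withDensity_eq_integral_toReal_smul hmeas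
    (Filter.Eventually.of_forall fun _ => ENNReal.ofReal_lt_top)]
  have h1 : ∀ Z : HalfSpace n, (ENNReal.ofReal ((HalfSpace.Y Z).det ^ (n + 1))⁻¹).toReal • h Z =
      (density Z.1 : ℂ) * ext h Z.1 := by
    intro Z
    rw [ENNReal.toReal_ofReal (by have := det_Y_pos Z; positivity), ext_val, Complex.real_smul]
    rfl
  simp only [h1]
  have h2 := integral_subtype_comap (μ := (volume : Measure (Sym2 (Fin n) → ℂ)))
    measurableSet_posDef (fun z => (density z : ℂ) * ext h z)
  have h3 : {z : Sym2 (Fin n) → ℂ | ((symMatrix z).map Complex.im).PosDef} = upper n := by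
    ext z
    exact mem_upper.symm
  refine h2.trans ?_
  rw [h3]

theorem continuous_det_Y : Continuous fun Z : HalfSpace n => Z.Y.det :=
  continuous_iff_continuousAt.2 fun Z =>
    (contDiffAt_detIm (r := 1) Z.1).continuousAt.comp continuous_subtype_val.continuousAt

instance : LocallyCompactSpace (HalfSpace n) := isOpenEmbedding_val.locallyCompactSpace

instance : IsFiniteMeasureOnCompacts (siegelMeasure n) := by
  have h1 : IsFiniteMeasureOnCompacts (Measure.comap
      (Subtype.val : HalfSpace n → Sym2 (Fin n) → ℂ) volume) :=
    IsFiniteMeasureOnCompacts.comap' _ continuous_subtype_val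
      (MeasurableEmbedding.subtype_coe measurableSet_posDef)
  have h2 : IsLocallyFiniteMeasure (Measure.comap
      (Subtype.val : HalfSpace n → Sym2 (Fin n) → ℂ) volume) :=
    isLocallyFiniteMeasure_of_isFiniteMeasureOnCompacts
  have h3 : IsLocallyFiniteMeasure (siegelMeasure n) :=
    IsLocallyFiniteMeasure.withDensity_ofReal
      ((continuous_det_Y.pow _).inv₀ fun Z => pow_ne_zero _ (det_Y_pos Z).ne')
  infer_instance

theorem integrable_siegelMeasure {f : HalfSpace n → ℂ} (hf : Continuous f)
    {K : Set (HalfSpace n)} (hK : IsCompact K) (hfK : ∀ Z, Z ∉ K → f Z = 0) :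
    Integrable f (siegelMeasure n) :=
  hf.integrable_of_hasCompactSupport (HasCompactSupport.intro hK hfK)

/-! ### Locality -/

theorem ext_eventuallyEq {f g : HalfSpace n → ℂ} {Z : HalfSpace n} (h : f =ᶠ[nhds Z] g) :
    ext f =ᶠ[nhds Z.1] ext g := by
  refine eventually_upper ?_
  filter_upwards [h] with W hW
  rw [ext_val, ext_val, hW]

theorem dZ_eventuallyEq {f g : HalfSpace n → ℂ} {Z : HalfSpace n} (h : f =ᶠ[nhds Z] g) :
    dZ f Z = dZ g Z ∧ dZbar f Z = dZbar g Z := by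
  rw [dZ_eq, dZ_eq, dZbar_eq, dZbar_eq, (ext_eventuallyEq h).fderiv_eq]
  exact ⟨rfl, rfl⟩

theorem opLambda_eventuallyEq (β : ℝ) {f g : HalfSpace n → ℂ} {Z : HalfSpace n}
    (h : f =ᶠ[nhds Z] g) : opLambda β f Z = opLambda β g Z := by
  rw [opLambda, opLambda, (dZ_eventuallyEq h).2, h.eq_of_nhds]

theorem opK_eventuallyEq (α : ℝ) {f g : HalfSpace n → ℂ} {Z : HalfSpace n}
    (h : f =ᶠ[nhds Z] g) : opK α f Z = opK α g Z := by
  rw [opK, opK, (dZ_eventuallyEq h).1, h.eq_of_nhds]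

theorem opLambda_zero (β : ℝ) (Z : HalfSpace n) : opLambda β (fun _ => 0) Z = 0 := by
  have h := dZ_congr (f := fun _ : HalfSpace n => (0 : ℂ)) (hasFDerivAt_const (0 : ℂ) Z.1)
    fun W => rfl
  rw [wirtBar_zero] at h
  rw [opLambda, h.2]
  simp

theorem opK_zero (α : ℝ) (Z : HalfSpace n) : opK α (fun _ => 0) Z = 0 := by
  have h := dZ_congr (f := fun _ : HalfSpace n => (0 : ℂ)) (hasFDerivAt_const (0 : ℂ) Z.1)
    fun W => rfl
  rw [wirt_zero] at h
  rw [opK, h.1]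
  simp

theorem laplacian_eq_zero (α β : ℝ) {f : HalfSpace n → ℂ} {Z : HalfSpace n}
    (h : f =ᶠ[nhds Z] fun _ => 0) : laplacian α β f Z = 0 := by
  have h1 : ∀ l j, (fun W => opK α f W l j) =ᶠ[nhds Z] fun _ => 0 := by
    intro l j
    filter_upwards [h.eventuallyEq_nhds] with W hW
    rw [opK_eventuallyEq α hW, opK_zero]
    rfl
  rw [laplacian, trace_opOmega_apply, h.eq_of_nhds]
  simp only [opLambda_eventuallyEq _ (h1 _ _), opLambda_zero]
  simp

theorem eventually_eq_zero_of_notMem {f : HalfSpace n → ℂ} {K : Set (HalfSpace n)}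
    (hK : IsClosed K) (hf : ∀ Z, Z ∉ K → f Z = 0) {Z : HalfSpace n} (hZ : Z ∉ K) :
    f =ᶠ[nhds Z] fun _ => 0 := by
  filter_upwards [hK.isOpen_compl.mem_nhds hZ] with W hW
  exact hf W hW

/-! ### Continuity of the integrands -/

theorem continuous_det_rpow (s : ℝ) : Continuous fun Z : HalfSpace n => ((Z.Y.det ^ s : ℝ) : ℂ) :=
  continuous_of_contDiffAt (r := 1) fun Z => contDiffAt_ext_det_rpow s Z

theorem continuous_pairingIntegrand (α β : ℝ) {f g : HalfSpace n → ℂ} (hf : Continuous f)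
    (hg : Continuous g) : Continuous (pairingIntegrand α β f g) :=
  (continuous_det_rpow _).mul (hf.mul (Complex.continuous_conj.comp hg))

theorem continuous_opLambda_apply (β : ℝ) {f : HalfSpace n → ℂ}
    (hf : ∀ Z : HalfSpace n, ContDiffAt ℝ 1 (ext f) Z.1) (j k : Fin n) :
    Continuous fun Z => opLambda β f Z j k :=
  continuous_of_contDiffAt (r := 0) fun Z => (contDiffAt_ext_op (by simp) (hf Z) β j k).2

theorem continuous_lambdaIntegrand (α β : ℝ) {f g : HalfSpace n → ℂ}
    (hf : ∀ Z : HalfSpace n, ContDiffAt ℝ 1 (ext f) Z.1)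
    (hg : ∀ Z : HalfSpace n, ContDiffAt ℝ 1 (ext g) Z.1) :
    Continuous (lambdaIntegrand α β f g) := by
  refine (continuous_det_rpow _).mul ?_
  simp only [trace_eq_sum, Matrix.map_apply]
  exact continuous_finsetSum _ fun j _ => continuous_finsetSum _ fun l _ =>
    (continuous_opLambda_apply β hf j l).mul
      (Complex.continuous_conj.comp (continuous_opLambda_apply β hg l j))

theorem lambdaIntegrand_eq_zero (α β : ℝ) {f g : HalfSpace n → ℂ} {Z : HalfSpace n}
    (hg : g =ᶠ[nhds Z] fun _ => 0) : lambdaIntegrand α β f g Z = 0 := by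
  rw [lambdaIntegrand, opLambda_eventuallyEq β hg, opLambda_zero, Matrix.map_zero _ (map_zero _)]
  simp

theorem pairingIntegrand_eq_zero (α β : ℝ) {f g : HalfSpace n → ℂ} {Z : HalfSpace n}
    (hg : g Z = 0) : pairingIntegrand α β f g Z = 0 := by
  rw [pairingIntegrand, hg]
  simp

/-! ### Integration by parts against test functions -/

theorem density_mul_det_rpow (α β : ℝ) (Z : HalfSpace n) :
    density Z.1 * Z.Y.det ^ (α + β) = Z.Y.det ^ (α + β - (n + 1)) := by
  have h : density Z.1 = (Z.Y.det ^ (n + 1))⁻¹ := rfl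
  rw [h, Real.rpow_sub (det_Y_pos Z), ← Nat.cast_succ, Real.rpow_natCast]
  field_simp

theorem isTest_field (s : ℝ) {F : HalfSpace n → Matrix (Fin n) (Fin n) ℂ} {ψ : HalfSpace n → ℂ}
    (hF : ∀ Z : HalfSpace n, ∀ l j, ContDiffAt ℝ 1 (ext fun W => F W l j) Z.1) (hψ : IsTest ψ)
    (j l m : Fin n) : IsTest (field s F ψ j l m) := by
  obtain ⟨hd, K, hK, hψK⟩ := hψ
  refine ⟨fun Z => contDiffAt_ext_field s (hF Z) (hd Z) j l m, K, hK, fun Z hZ => ?_⟩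
  rw [field, hψK Z hZ]
  simp

/-- Green's identity on the whole half-space: integrate `sum_dZ_field` with `F = Λ_β φ` and insert
`trace_opOmega`. The density lowers the exponent `α + β` to `α + β - (n+1)`, which is the one in the
divergence identity. -/
theorem integral_opOmega_test (α β : ℝ) {φ ψ : HalfSpace n → ℂ}
    (hφ : ∀ Z : HalfSpace n, ContDiffAt ℝ 2 (ext φ) Z.1) (hψ : IsTest ψ) :
    ∫ Z, pairingIntegrand α β (fun W => -laplacian α β φ W) ψ Z ∂(siegelMeasure n) =
      ∫ Z, lambdaIntegrand α β φ ψ Z ∂(siegelMeasure n) +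
        ((n * β * (α - (n + 1) / 2) : ℝ) : ℂ) *
          ∫ Z, pairingIntegrand α β φ ψ Z ∂(siegelMeasure n) := by
  set c : ℂ := ((n * β * (α - (n + 1) / 2) : ℝ) : ℂ) with hc
  have hφ1 : ∀ Z : HalfSpace n, ContDiffAt ℝ 1 (ext φ) Z.1 := fun Z => (hφ Z).of_le (by norm_num)
  have hF : ∀ Z : HalfSpace n, ∀ l j, ContDiffAt ℝ 1 (ext fun W => opLambda β φ W l j) Z.1 :=
    fun Z l j => (contDiffAt_ext_op (by norm_num) (hφ Z) β l j).2
  have hLap : Continuous (laplacian α β φ) :=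
    continuous_of_contDiffAt (r := 0) fun Z => contDiffAt_ext_laplacian (by norm_num) (hφ Z) α β
  obtain ⟨hd, K, hK, hψK⟩ := id hψ
  have i1 : Integrable (pairingIntegrand α β (fun W => -laplacian α β φ W) ψ) (siegelMeasure n) :=
    integrable_siegelMeasure (continuous_pairingIntegrand α β hLap.neg
      (continuous_of_contDiffAt hd)) hK fun Z hZ => pairingIntegrand_eq_zero α β (hψK Z hZ)
  have i2 : Integrable (lambdaIntegrand α β φ ψ) (siegelMeasure n) :=
    integrable_siegelMeasure (continuous_lambdaIntegrand α β hφ1 hd) hK fun Z hZ =>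
      lambdaIntegrand_eq_zero α β (eventually_eq_zero_of_notMem hK.isClosed hψK hZ)
  have i3 : Integrable (pairingIntegrand α β φ ψ) (siegelMeasure n) :=
    integrable_siegelMeasure (continuous_pairingIntegrand α β (continuous_of_contDiffAt hφ)
      (continuous_of_contDiffAt hd)) hK fun Z hZ => pairingIntegrand_eq_zero α β (hψK Z hZ)
  have key : ∫ Z, (pairingIntegrand α β (fun W => -laplacian α β φ W) ψ Z -
      lambdaIntegrand α β φ ψ Z - c * pairingIntegrand α β φ ψ Z) ∂(siegelMeasure n) = 0 := by
    rw [integral_siegelMeasure]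
    have hT := isTest_field (α + β - (n + 1)) hF hψ
    have h1 : ∫ z in upper n, (density z : ℂ) * ext (fun Z =>
        pairingIntegrand α β (fun W => -laplacian α β φ W) ψ Z -
          lambdaIntegrand α β φ ψ Z - c * pairingIntegrand α β φ ψ Z) z =
        ∫ z in upper n, ∑ j, ∑ l, ∑ m,
          ext (fun Z => dZ (field (α + β - (n + 1)) (opLambda β φ) ψ j l m) Z m l) z := by
      refine setIntegral_congr_fun measurableSet_upper ?_
      rintro _ ⟨(W : HalfSpace n), rfl⟩
      simp only [ext_val]
      rw [sum_dZ_field α β (hF W) (hd W), ← density_mul_det_rpow]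
      simp only [pairingIntegrand, lambdaIntegrand, laplacian, neg_neg, trace_opOmega (hφ W)]
      push_cast
      rw [hc]
      push_cast
      ring
    rw [h1, integral_finsetSum _ fun j _ => integrable_finsetSum _ fun l _ =>
      integrable_finsetSum _ fun m _ => (integral_dZ_eq_zero (hT j l m) m l).1]
    refine Finset.sum_eq_zero fun j _ => ?_
    rw [integral_finsetSum _ fun l _ =>
      integrable_finsetSum _ fun m _ => (integral_dZ_eq_zero (hT j l m) m l).1]
    refine Finset.sum_eq_zero fun l _ => ?_
    rw [integral_finsetSum _ fun m _ => (integral_dZ_eq_zero (hT j l m) m l).1]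
    exact Finset.sum_eq_zero fun m _ => (integral_dZ_eq_zero (hT j l m) m l).2
  have e := integral_sub (i1.sub i2) (i3.const_mul c)
  simp only [Pi.sub_apply] at e
  rw [e, integral_sub i1 i2, integral_const_mul] at key
  linear_combination key

/-! ### Equivariance of the Laplacian -/

theorem isTest_restrict {g : (Sym2 (Fin n) → ℂ) → ℝ} (hg : ContDiff ℝ ∞ g)
    (hc : HasCompactSupport g) (hU : tsupport g ⊆ upper n) :
    IsTest fun Z : HalfSpace n => (g Z.1 : ℂ) := by
  refine ⟨fun Z => ?_, Subtype.val ⁻¹' tsupport g, ?_, fun Z hZ => ?_⟩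
  · have h : ContDiffAt ℝ 1 (fun z => Complex.ofRealCLM (g z)) Z.1 :=
      Complex.ofRealCLM.contDiff.contDiffAt.comp Z.1 ((hg.of_le (by exact_mod_cast le_top)).contDiffAt)
    exact contDiffAt_ext_congr h fun W => rfl
  · exact isOpenEmbedding_val.isInducing.isCompact_preimage_iff hU |>.2 hc
  · have h : g Z.1 = 0 := image_eq_zero_of_notMem_tsupport hZ
    simp only [h, Complex.ofReal_zero]

/-- A continuous function on the half-space that is orthogonal to all test functions vanishes. -/
theorem eq_zero_of_forall_test {α β : ℝ} {h : HalfSpace n → ℂ} (hh : Continuous h)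
    (H : ∀ G : HalfSpace n → ℂ, IsTest G →
      ∫ Z, pairingIntegrand α β h G Z ∂(siegelMeasure n) = 0) : h = 0 := by
  -- The weight and the density are moved into the function, so that the hypothesis concerns
  -- Lebesgue measure on an open set. The fundamental lemma of the calculus of variations then
  -- applies, and continuity upgrades almost everywhere to everywhere.
  set f : HalfSpace n → ℂ := fun Z => ((Z.Y.det ^ (α + β - (n + 1)) : ℝ) : ℂ) * h Z with hf
  have hfc : ContinuousOn (ext f) (upper n) := by
    rintro _ ⟨(Z : HalfSpace n), rfl⟩
    refine ContinuousAt.continuousWithinAt ?_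
    rw [isOpenEmbedding_val.continuousAt_iff.symm]
    have h1 : ext f ∘ Subtype.val = f := funext fun W => ext_val f W
    rw [h1]
    exact ((continuous_det_rpow _).mul hh).continuousAt
  have h0 := isOpen_upper.ae_eq_zero_of_integral_contDiff_smul_eq_zero
    (μ := (volume : Measure (Sym2 (Fin n) → ℂ)))
    (hfc.locallyIntegrableOn measurableSet_upper) (fun g hg hgc hgU => by
      have h1 := H _ (isTest_restrict hg hgc hgU)
      rw [integral_siegelMeasure] at h1
      have h2 : ∫ z, g z • ext f z = ∫ z in upper n, g z • ext f z := by
        refine (setIntegral_eq_integral_of_forall_compl_eq_zero fun z hz => ?_).symm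
        rw [ext_of_notMem f hz, smul_zero]
      rw [h2, ← h1]
      refine setIntegral_congr_fun measurableSet_upper ?_
      rintro _ ⟨(W : HalfSpace n), rfl⟩
      simp only [ext_val, hf, pairingIntegrand, Complex.real_smul, Complex.conj_ofReal]
      rw [← density_mul_det_rpow]
      push_cast
      ring)
  have h1 := Measure.eqOn_open_of_ae_eq (μ := (volume : Measure (Sym2 (Fin n) → ℂ)))
    (f := ext f) (g := fun _ => 0) ((ae_restrict_iff' measurableSet_upper).2 h0) isOpen_upper hfc
    continuousOn_const
  funext Z
  have h2 := h1 (val_mem_upper Z)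
  rw [ext_val, hf] at h2
  refine (mul_eq_zero.1 h2).resolve_left ?_
  exact Complex.ofReal_ne_zero.2 (Real.rpow_pos_of_pos (det_Y_pos Z) _).ne'

/-- Test functions are permuted by the slash operators. -/
theorem isTest_unslash {ℓ : Sp n → HalfSpace n → ℂ} (hℓ : IsLogBranch ℓ) (α β : ℝ) (γ : Sp n)
    {G : HalfSpace n → ℂ} (hG : IsTest G) :
    IsTest fun W => autFactor ℓ α β γ (γ⁻¹ • W) * G (γ⁻¹ • W) := by
  obtain ⟨hd, K, hK, hGK⟩ := hG
  refine ⟨fun Z => contDiffAt_ext_smul (f := fun W => autFactor ℓ α β γ W * G W) γ⁻¹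
    (contDiffAt_ext_mul (contDiffAt_ext_autFactor hℓ α β γ _) (hd _)),
    (fun W => γ • W) '' K, hK.image (continuous_smul_halfSpace γ), fun Z hZ => ?_⟩
  have h : γ⁻¹ • Z ∉ K := fun h => hZ ⟨γ⁻¹ • Z, h, smul_inv_smul γ Z⟩
  simp only [hGK _ h, mul_zero]

theorem continuous_autFactor {ℓ : Sp n → HalfSpace n → ℂ} (hℓ : IsLogBranch ℓ) (α β : ℝ)
    (γ : Sp n) : Continuous (autFactor ℓ α β γ) :=
  continuous_of_contDiffAt (r := 1) (contDiffAt_ext_autFactor hℓ α β γ)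

theorem integral_smul_halfSpace (γ : Sp n) (f : HalfSpace n → ℂ) :
    ∫ Z, f (γ • Z) ∂(siegelMeasure n) = ∫ Z, f Z ∂(siegelMeasure n) := by
  have hm : MeasurePreserving (fun Z : HalfSpace n => γ • Z) (siegelMeasure n) (siegelMeasure n) :=
    measurePreserving_smul γ _
  exact hm.integral_comp (Homeomorph.smul γ).measurableEmbedding f

theorem continuous_laplacian (α β : ℝ) {f : HalfSpace n → ℂ}
    (hf : ∀ Z : HalfSpace n, ContDiffAt ℝ 2 (ext f) Z.1) : Continuous (laplacian α β f) :=
  continuous_of_contDiffAt (r := 0) fun Z => contDiffAt_ext_laplacian (by norm_num) (hf Z) α β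

/-- The Laplacian commutes with the action of `γ` on the functions which are invariant under it. -/
theorem laplacian_smul {ℓ : Sp n → HalfSpace n → ℂ} (hℓ : IsLogBranch ℓ) {α β : ℝ} {γ : Sp n}
    {φ : HalfSpace n → ℂ} (hφ : ∀ Z : HalfSpace n, ContDiffAt ℝ 2 (ext φ) Z.1)
    (hγ : ∀ Z, φ (γ • Z) = autFactor ℓ α β γ Z * φ Z) (Z : HalfSpace n) :
    laplacian α β φ (γ • Z) = autFactor ℓ α β γ Z * laplacian α β φ Z := by
  set Ω : HalfSpace n → ℂ := fun W => -laplacian α β φ W with hΩ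
  set h : HalfSpace n → ℂ := fun W => (autFactor ℓ α β γ W)⁻¹ * Ω (γ • W) with hh
  have hΩc : Continuous Ω := (continuous_laplacian α β hφ).neg
  have hhc : Continuous h := ((continuous_autFactor hℓ α β γ).inv₀
    fun W => autFactor_ne_zero ℓ α β γ W).mul (hΩc.comp (continuous_smul_halfSpace γ))
  -- Here `h` is `-Δφ` transformed by `γ`. Both `h` and `-Δφ` turn out to have the same pairing with
  -- every test function.
  have h1 : (fun W => h W - Ω W) = 0 := by
    refine eq_zero_of_forall_test (α := α) (β := β) (h := fun W => h W - Ω W) (hhc.sub hΩc) fun G hG => ?_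
    -- The test function whose transform by `γ` is `G`.
    set f : HalfSpace n → ℂ := fun W => autFactor ℓ α β γ (γ⁻¹ • W) * G (γ⁻¹ • W) with hf
    have hft : IsTest f := isTest_unslash hℓ α β γ hG
    have hfγ : ∀ W, f (γ • W) = autFactor ℓ α β γ W * G W := fun W => by
      simp only [hf, inv_smul_smul]
    have e1 := integral_opOmega_test α β hφ hft
    have e2 := integral_opOmega_test α β hφ hG
    have dφ : ∀ W : HalfSpace n, DifferentiableAt ℝ (ext φ) W.1 := fun W =>
      (hφ W).differentiableAt two_ne_zero
    -- Substituting `γZ` in the identity for `f` turns its right-hand side into that of the identity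
    -- for `G`, while its left-hand side becomes the pairing of `h` with `G`.
    rw [← integral_smul_halfSpace γ, ← integral_smul_halfSpace γ (lambdaIntegrand α β φ f),
      ← integral_smul_halfSpace γ (pairingIntegrand α β φ f)] at e1
    simp only [lambdaIntegrand_smul hℓ hγ hfγ (dφ _) (dφ _)
      ((hft.1 _).differentiableAt one_ne_zero) ((hG.1 _).differentiableAt one_ne_zero),
      pairingIntegrand_smul hℓ (hγ _) (hfγ _)] at e1
    have hhΩ : ∀ W, Ω (γ • W) = autFactor ℓ α β γ W * h W := fun W => by
      rw [hh, mul_inv_cancel_left₀ (autFactor_ne_zero ℓ α β γ W)]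
    have e3 : ∀ W, pairingIntegrand α β Ω f (γ • W) = pairingIntegrand α β h G W := fun W =>
      pairingIntegrand_smul hℓ (hhΩ W) (hfγ W)
    rw [integral_congr_ae (Filter.Eventually.of_forall e3)] at e1
    obtain ⟨hGd, K, hK, hGK⟩ := id hG
    have i1 : Integrable (pairingIntegrand α β h G) (siegelMeasure n) :=
      integrable_siegelMeasure (continuous_pairingIntegrand α β hhc
        (continuous_of_contDiffAt hGd)) hK fun Z hZ => pairingIntegrand_eq_zero α β (hGK Z hZ)
    have i2 : Integrable (pairingIntegrand α β Ω G) (siegelMeasure n) :=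
      integrable_siegelMeasure (continuous_pairingIntegrand α β hΩc
        (continuous_of_contDiffAt hGd)) hK fun Z hZ => pairingIntegrand_eq_zero α β (hGK Z hZ)
    have e4 : ∀ W, pairingIntegrand α β (fun W => h W - Ω W) G W =
        pairingIntegrand α β h G W - pairingIntegrand α β Ω G W := fun W => by
      simp only [pairingIntegrand]
      ring
    refine (integral_congr_ae (Filter.Eventually.of_forall e4)).trans ?_
    rw [integral_sub i1 i2, e1, ← e2, sub_self]
  have h2 := congrFun h1 Z
  simp only [hh, hΩ, Pi.zero_apply] at h2
  have h3 := autFactor_ne_zero ℓ α β γ Z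
  field_simp at h2
  linear_combination -h2

/-! ### Proper discontinuity -/

theorem continuous_mat : Continuous fun Z : HalfSpace n => Z.mat :=
  continuous_matrix fun i j => (continuous_apply s(i, j)).comp continuous_subtype_val

theorem continuous_Y : Continuous fun Z : HalfSpace n => Z.Y :=
  continuous_mat.matrix_map Complex.continuous_im

theorem continuous_inv_Y : Continuous fun Z : HalfSpace n => (Z.Y)⁻¹ := by
  have h : (fun Z : HalfSpace n => (Z.Y)⁻¹) = fun Z : HalfSpace n => (Z.Y.det)⁻¹ • Z.Y.adjugate := by
    funext Z
    rw [Matrix.inv_def, Ring.inverse_eq_inv']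
  rw [h]
  exact (continuous_det_Y.inv₀ fun Z => (det_Y_pos Z).ne').smul continuous_Y.matrix_adjugate

theorem denom_mul_Y (γ : Sp n) (Z : HalfSpace n) :
    (denom γ Z.mat)ᴴ * (γ • Z).Y.map Complex.ofReal * denom γ Z.mat = Z.Y.map Complex.ofReal := by
  have h := denom_subConj γ Z
  rw [subConj_eq, subConj_eq, Matrix.mul_smul, Matrix.smul_mul] at h
  exact smul_right_injective _ (by simp : (2 * Complex.I) ≠ 0) h

/-- Positive definite forms are uniformly positive on compact sets. -/
theorem exists_form_lower_bound {K : Set (HalfSpace n)} (hK : IsCompact K) :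
    ∃ ε : ℝ, 0 < ε ∧ ∀ Z ∈ K, ∀ v : Fin n → ℂ,
      ε * ‖v‖ ^ 2 ≤ (star v ⬝ᵥ (Z.Y.map Complex.ofReal) *ᵥ v).re := by
  have hc : Continuous fun p : HalfSpace n × (Fin n → ℂ) =>
      (star p.2 ⬝ᵥ (p.1.Y.map Complex.ofReal) *ᵥ p.2).re := by
    refine Complex.continuous_re.comp (Continuous.dotProduct continuous_snd.star
      (Continuous.matrix_mulVec ?_ continuous_snd))
    exact (continuous_Y.comp continuous_fst).matrix_map Complex.continuous_ofReal
  obtain ⟨ε, hε, h⟩ := (hK.prod (isCompact_sphere (0 : Fin n → ℂ) 1)).exists_forall_le'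
    hc.continuousOn (a := 0) fun p hp => posDef_complex p.1.2 p.2 fun h0 => by
      have := hp.2
      rw [mem_sphere_zero_iff_norm, h0, norm_zero] at this
      exact zero_ne_one this
  refine ⟨ε, hε, fun Z hZ v => ?_⟩
  by_cases hv : v = 0
  · simp [hv]
  have hv' : ‖v‖ ≠ 0 := norm_ne_zero_iff.2 hv
  set u : Fin n → ℂ := ((‖v‖⁻¹ : ℝ) : ℂ) • v with hu
  have h1 : ‖u‖ = 1 := by
    rw [hu, norm_smul, Complex.norm_real, norm_inv, norm_norm, inv_mul_cancel₀ hv']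
  have h2 : v = ((‖v‖ : ℝ) : ℂ) • u := by
    rw [hu, smul_smul, ← Complex.ofReal_mul, mul_inv_cancel₀ hv', Complex.ofReal_one, one_smul]
  have h3 := h (Z, u) ⟨hZ, by rw [mem_sphere_zero_iff_norm, h1]⟩
  have h4 : star v ⬝ᵥ (Z.Y.map Complex.ofReal) *ᵥ v =
      ((‖v‖ ^ 2 : ℝ) : ℂ) * (star u ⬝ᵥ (Z.Y.map Complex.ofReal) *ᵥ u) := by
    nth_rw 1 2 [h2]
    rw [star_smul, Matrix.mulVec_smul, smul_dotProduct, dotProduct_smul, Complex.star_def,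
      Complex.conj_ofReal]
    simp only [smul_eq_mul]
    push_cast
    ring
  rw [h4, Complex.re_ofReal_mul, mul_comm]
  exact mul_le_mul_of_nonneg_left h3 (by positivity)

/-- In `Q* Y(γZ) Q = Y(Z)`, with `Q = CZ + D`, the `j`-th diagonal entry is the form `Y(γZ)` at the
`j`-th column of `Q`. It is at least `ε` times the squared norm of that column, and it is bounded on
`K`. -/
theorem exists_denom_bound {K : Set (HalfSpace n)} (hK : IsCompact K) :
    ∃ R : ℝ, ∀ γ : Sp n, ∀ Z ∈ K, γ • Z ∈ K → ∀ i j, ‖denom γ Z.mat i j‖ ≤ R := by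
  obtain ⟨ε, hε, h⟩ := exists_form_lower_bound hK
  have hb : ∀ j, ∃ T : ℝ, ∀ Z ∈ K, ‖Z.Y j j‖ ≤ T := fun j =>
    hK.exists_bound_of_continuousOn (f := fun Z : HalfSpace n => Z.Y j j)
      (continuous_Y.matrix_elem j j).continuousOn
  choose T hT using hb
  refine ⟨∑ j, (1 + |T j| / ε), fun γ Z hZ hγ i j => ?_⟩
  have h1 := h _ hγ fun i => denom γ Z.mat i j
  have h2 := congrFun (congrFun (denom_mul_Y γ Z) j) j
  rw [Matrix.mul_assoc, Matrix.mul_apply'] at h2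
  have h3 : (star fun i => denom γ Z.mat i j) ⬝ᵥ
      ((γ • Z).Y.map Complex.ofReal *ᵥ fun i => denom γ Z.mat i j) = (Z.Y j j : ℂ) := h2
  rw [h3, Complex.ofReal_re] at h1
  have h4 : ‖denom γ Z.mat i j‖ ≤ ‖fun i => denom γ Z.mat i j‖ :=
    norm_le_pi_norm (fun i => denom γ Z.mat i j) i
  set v := ‖fun i => denom γ Z.mat i j‖
  have h5 : v ^ 2 ≤ |T j| / ε := by
    rw [le_div_iff₀ hε, mul_comm]
    exact h1.trans ((le_abs_self _).trans ((hT j Z hZ).trans (le_abs_self _)))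
  -- Because `v ≤ 1 + v²`. This avoids a square root.
  have h6 : v ≤ 1 + |T j| / ε := by nlinarith [sq_nonneg (v - 1)]
  refine (h4.trans h6).trans ?_
  exact Finset.single_le_sum (f := fun j => 1 + |T j| / ε) (fun _ _ => by positivity)
    (Finset.mem_univ j)

/-- The blocks are real, so taking real and imaginary parts recovers them from `Z`, `AZ + B` and `CZ
+ D`. -/
theorem toBlocks_eq (γ : Sp n) (Z : HalfSpace n) :
    γ.1.toBlocks₂₁ = (denom γ Z.mat).map Complex.im * (Z.Y)⁻¹ ∧
    γ.1.toBlocks₁₁ = (numer γ Z.mat).map Complex.im * (Z.Y)⁻¹ ∧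
    γ.1.toBlocks₂₂ = (denom γ Z.mat).map Complex.re -
      γ.1.toBlocks₂₁ * Z.mat.map Complex.re ∧
    γ.1.toBlocks₁₂ = (numer γ Z.mat).map Complex.re -
      γ.1.toBlocks₁₁ * Z.mat.map Complex.re := by
  have hu : IsUnit Z.Y.det := (det_Y_pos Z).ne'.isUnit
  have him : ∀ A B : Matrix (Fin n) (Fin n) ℝ,
      (A.map Complex.ofReal * Z.mat + B.map Complex.ofReal).map Complex.im = A * Z.Y := by
    intro A B
    ext i j
    simp [Matrix.mul_apply, HalfSpace.Y]
  have hre : ∀ A B : Matrix (Fin n) (Fin n) ℝ,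
      (A.map Complex.ofReal * Z.mat + B.map Complex.ofReal).map Complex.re =
        A * Z.mat.map Complex.re + B := by
    intro A B
    ext i j
    simp [Matrix.mul_apply]
  refine ⟨?_, ?_, ?_, ?_⟩
  · rw [denom, him, Matrix.mul_nonsing_inv_cancel_right _ _ hu]
  · rw [numer, him, Matrix.mul_nonsing_inv_cancel_right _ _ hu]
  · rw [denom, hre, add_sub_cancel_left]
  · rw [numer, hre, add_sub_cancel_left]

/-- The symplectic matrices that do not move a compact set off itself have bounded entries. -/
theorem exists_entry_bound {K : Set (HalfSpace n)} (hK : IsCompact K) :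
    ∃ R : ℝ, ∀ γ : Sp n, ∀ Z ∈ K, γ • Z ∈ K → ∀ i j, |γ.1 i j| ≤ R := by
  obtain ⟨R, hR⟩ := exists_denom_bound hK
  let Q₀ : Set (Matrix (Fin n) (Fin n) ℂ) :=
    Set.pi Set.univ fun _ => Set.pi Set.univ fun _ => Metric.closedBall 0 R
  have hQ₀ : IsCompact Q₀ := isCompact_univ_pi fun _ => isCompact_univ_pi fun _ =>
    isCompact_closedBall _ _
  let lower : HalfSpace n × Matrix (Fin n) (Fin n) ℂ → Matrix (Fin n) (Fin n) ℝ := fun p =>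
    p.2.map Complex.im * (p.1.Y)⁻¹
  let rest : HalfSpace n × Matrix (Fin n) (Fin n) ℂ → Matrix (Fin n) (Fin n) ℝ := fun p =>
    p.2.map Complex.re - lower p * p.1.mat.map Complex.re
  have hl : Continuous lower := (continuous_snd.matrix_map Complex.continuous_im).matrix_mul
    (continuous_inv_Y.comp continuous_fst)
  have hr : Continuous rest := (continuous_snd.matrix_map Complex.continuous_re).sub
    (hl.matrix_mul ((continuous_mat.comp continuous_fst).matrix_map Complex.continuous_re))
  -- By `AZ + B = (γZ)(CZ + D)`, the map `Φ` rebuilds `γ` continuously from `Z`, `γZ` and `CZ + D`,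
  -- all of which range over compact sets.
  let Φ : (HalfSpace n × HalfSpace n) × Matrix (Fin n) (Fin n) ℂ →
      Matrix (Fin n ⊕ Fin n) (Fin n ⊕ Fin n) ℝ := fun p =>
    Matrix.fromBlocks (lower (p.1.1, p.1.2.mat * p.2)) (rest (p.1.1, p.1.2.mat * p.2))
      (lower (p.1.1, p.2)) (rest (p.1.1, p.2))
  have hN : Continuous fun p : (HalfSpace n × HalfSpace n) × Matrix (Fin n) (Fin n) ℂ =>
      (p.1.1, p.1.2.mat * p.2) := (continuous_fst.comp continuous_fst).prodMk
    ((continuous_mat.comp (continuous_snd.comp continuous_fst)).matrix_mul continuous_snd)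
  have hD : Continuous fun p : (HalfSpace n × HalfSpace n) × Matrix (Fin n) (Fin n) ℂ =>
      (p.1.1, p.2) := (continuous_fst.comp continuous_fst).prodMk continuous_snd
  have hΦ : Continuous Φ := Continuous.matrix_fromBlocks (hl.comp hN) (hr.comp hN) (hl.comp hD)
    (hr.comp hD)
  have hb : ∀ i j, ∃ T : ℝ, ∀ p ∈ (K ×ˢ K) ×ˢ Q₀, ‖Φ p i j‖ ≤ T := fun i j =>
    ((hK.prod hK).prod hQ₀).exists_bound_of_continuousOn
      (f := fun p => Φ p i j) (hΦ.matrix_elem i j).continuousOn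
  choose T hT using hb
  refine ⟨∑ i, ∑ j, |T i j|, fun γ Z hZ hγ i j => ?_⟩
  have hq : denom γ Z.mat ∈ Q₀ := by
    exact fun i _ j _ => mem_closedBall_zero_iff.2 (hR γ Z hZ hγ i j)
  have hnum : (γ • Z).mat * denom γ Z.mat = numer γ Z.mat := by
    rw [smul_mat]
    exact actMatrix_mul γ Z
  have h1 : Φ ((Z, γ • Z), denom γ Z.mat) = γ.1 := by
    obtain ⟨hc, ha, hd, hb⟩ := toBlocks_eq γ Z
    simp only [Φ, lower, rest, hnum]
    rw [← hc, ← ha, ← hd, ← hb, Matrix.fromBlocks_toBlocks]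
  have h2 := hT i j ((Z, γ • Z), denom γ Z.mat) ⟨⟨hZ, hγ⟩, hq⟩
  rw [h1, Real.norm_eq_abs] at h2
  refine (h2.trans (le_abs_self _)).trans ?_
  refine (Finset.single_le_sum (f := fun j => |T i j|) (fun _ _ => abs_nonneg _)
    (Finset.mem_univ j)).trans ?_
  exact Finset.single_le_sum (f := fun i => ∑ j, |T i j|)
    (fun _ _ => Finset.sum_nonneg fun _ _ => abs_nonneg _) (Finset.mem_univ i)

theorem finite_SpZ {K : Set (HalfSpace n)} (hK : IsCompact K) :
    {γ : Sp n | γ ∈ SpZ n ∧ ∃ Z ∈ K, γ • Z ∈ K}.Finite := by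
  obtain ⟨R, hR⟩ := exists_entry_bound hK
  have h1 : (Set.Icc (fun _ _ => -⌈R⌉ : Fin n ⊕ Fin n → Fin n ⊕ Fin n → ℤ) fun _ _ => ⌈R⌉).Finite :=
    Set.finite_Icc _ _
  have h2 : {g : symplecticGroup (Fin n) ℤ | ∀ i j, |g.1 i j| ≤ ⌈R⌉}.Finite := by
    refine Set.Finite.subset (h1.preimage (f := fun g : symplecticGroup (Fin n) ℤ =>
      (g.1 : Fin n ⊕ Fin n → Fin n ⊕ Fin n → ℤ)) (Subtype.val_injective.injOn)) fun g hg => ?_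
    exact ⟨fun i j => (abs_le.1 (hg i j)).1, fun i j => (abs_le.1 (hg i j)).2⟩
  refine (h2.image (intSpHom n)).subset ?_
  rintro _ ⟨⟨g, rfl⟩, Z, hZ, hgZ⟩
  refine ⟨g, fun i j => ?_, rfl⟩
  have h3 := hR _ Z hZ hgZ i j
  have h4 : ((|g.1 i j| : ℤ) : ℝ) ≤ R := by
    rw [Int.cast_abs]
    exact h3
  exact Int.cast_le.1 (h4.trans (Int.le_ceil R))

/-- Representatives of `Γ` modulo `Γ ∩ Sp_n(ℤ)` suffice, since this subgroup has finite index in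
`Γ`. -/
theorem exists_finite_cosets {Γ : Subgroup (Sp n)} (hΓ : Γ.Commensurable (SpZ n)) :
    ∃ T : Set (Sp n), T.Finite ∧ ∀ γ ∈ Γ, ∃ t ∈ T, ∃ δ ∈ SpZ n, γ = t * δ := by
  have hfi : ((SpZ n).subgroupOf Γ).FiniteIndex := ⟨hΓ.2⟩
  have : Finite (Γ ⧸ (SpZ n).subgroupOf Γ) := Subgroup.finite_quotient_of_finiteIndex
  refine ⟨Set.range fun q : Γ ⧸ (SpZ n).subgroupOf Γ => (q.out : Sp n), Set.finite_range _,
    fun γ hγ => ?_⟩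
  refine ⟨_, ⟨((⟨γ, hγ⟩ : Γ) : Γ ⧸ (SpZ n).subgroupOf Γ), rfl⟩, _, ?_, (mul_inv_cancel_left _ γ).symm⟩
  have h := QuotientGroup.leftRel_apply.1 (Quotient.exact
    (Quotient.out_eq ((⟨γ, hγ⟩ : Γ) : Γ ⧸ (SpZ n).subgroupOf Γ)))
  exact Subgroup.mem_subgroupOf.1 h

theorem finite_of_commensurable {Γ : Subgroup (Sp n)} (hΓ : Γ.Commensurable (SpZ n))
    {K : Set (HalfSpace n)} (hK : IsCompact K) :
    {γ : Sp n | γ ∈ Γ ∧ ∃ Z ∈ K, γ • Z ∈ K}.Finite := by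
  obtain ⟨T, hT, h⟩ := exists_finite_cosets hΓ
  -- If `tδ` maps a point of `K` into `K`, then `δ` maps it into `t⁻¹K`. Adding these finitely many
  -- translates reduces the claim to `Sp_n(ℤ)`.
  set K' : Set (HalfSpace n) := K ∪ ⋃ t ∈ T, (fun Z => t⁻¹ • Z) '' K with hK'
  have hc : IsCompact K' := hK.union (hT.isCompact_biUnion fun t _ =>
    hK.image (continuous_smul_halfSpace _))
  refine (Set.Finite.image2 (fun t δ => t * δ) hT (finite_SpZ hc)).subset ?_
  rintro γ ⟨hγ, Z, hZ, hγZ⟩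
  obtain ⟨t, ht, δ, hδ, rfl⟩ := h γ hγ
  refine ⟨t, ht, δ, ⟨hδ, Z, Or.inl hZ, Or.inr (Set.mem_biUnion ht ⟨_, hγZ, ?_⟩)⟩, rfl⟩
  simp only [mul_smul, inv_smul_smul]

theorem countable_of_commensurable {Γ : Subgroup (Sp n)} (hΓ : Γ.Commensurable (SpZ n)) :
    Countable Γ := by
  obtain ⟨T, hT, h⟩ := exists_finite_cosets hΓ
  have : Countable (Matrix (Fin n ⊕ Fin n) (Fin n ⊕ Fin n) ℤ) :=
    inferInstanceAs (Countable (Fin n ⊕ Fin n → Fin n ⊕ Fin n → ℤ))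
  have : Countable (symplecticGroup (Fin n) ℤ) := Subtype.countable
  have hS : ((SpZ n : Subgroup (Sp n)) : Set (Sp n)).Countable := by
    rw [SpZ, MonoidHom.coe_range]
    exact Set.countable_range _
  refine Set.Countable.to_subtype (s := (Γ : Set (Sp n)))
    ((Set.Countable.image2 hT.countable hS fun t δ => t * δ).mono ?_)
  intro γ hγ
  obtain ⟨t, ht, δ, hδ, rfl⟩ := h γ hγ
  exact ⟨t, ht, δ, hδ, rfl⟩

/-! ### The group of transformations -/

theorem exists_smul_eq {Γ : Subgroup (Sp n)} (g : transformationGroup Γ) :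
    ∃ γ ∈ Γ, ∀ Z : HalfSpace n, g • Z = γ • Z := by
  obtain ⟨_, ⟨γ, rfl⟩⟩ := g
  exact ⟨γ.1, γ.2, fun Z => rfl⟩

/-- The transformation of the half-space induced by an element of `Γ`. -/
def toTransformation {Γ : Subgroup (Sp n)} (γ : Γ) : transformationGroup Γ :=
  (MulAction.toPermHom Γ (HalfSpace n)).rangeRestrict γ

theorem toTransformation_surjective {Γ : Subgroup (Sp n)} :
    Function.Surjective (toTransformation (Γ := Γ)) :=
  (MulAction.toPermHom Γ (HalfSpace n)).rangeRestrict_surjective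

theorem countable_transformationGroup {Γ : Subgroup (Sp n)} (hΓ : Γ.Commensurable (SpZ n)) :
    Countable (transformationGroup Γ) :=
  have := countable_of_commensurable hΓ
  toTransformation_surjective.countable

theorem finite_transformations {Γ : Subgroup (Sp n)} (hΓ : Γ.Commensurable (SpZ n))
    {K : Set (HalfSpace n)} (hK : IsCompact K) :
    {g : transformationGroup Γ | ∃ Z ∈ K, g • Z ∈ K}.Finite := by
  have h : {γ : Γ | ∃ Z ∈ K, (γ : Sp n) • Z ∈ K}.Finite :=
    ((finite_of_commensurable hΓ hK).preimage (f := ((↑) : Γ → Sp n))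
      Subtype.val_injective.injOn).subset fun γ hγ => ⟨γ.2, hγ⟩
  refine (h.image toTransformation).subset fun g hg => ?_
  obtain ⟨γ, rfl⟩ := toTransformation_surjective g
  exact ⟨γ, hg, rfl⟩

instance (Γ : Subgroup (Sp n)) : ContinuousConstSMul (transformationGroup Γ) (HalfSpace n) where
  continuous_const_smul g := by
    obtain ⟨γ, -, h⟩ := exists_smul_eq g
    simp only [h]
    exact continuous_smul_halfSpace γ

instance (Γ : Subgroup (Sp n)) :
    SMulInvariantMeasure (transformationGroup Γ) (HalfSpace n) (siegelMeasure n) where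
  measure_preimage_smul g s hs := by
    obtain ⟨γ, -, h⟩ := exists_smul_eq g
    simp only [h]
    exact measure_preimage_smul_of_nullMeasurableSet hs.nullMeasurableSet γ

instance (Γ : Subgroup (Sp n)) : MeasurableConstSMul (transformationGroup Γ) (HalfSpace n) :=
  inferInstance

/-! ### Invariant functions with compact support modulo the group -/

/-- The union of the `Γ`-translates of `K`. -/
def saturation (Γ : Subgroup (Sp n)) (K : Set (HalfSpace n)) : Set (HalfSpace n) :=
  ⋃ g : transformationGroup Γ, (fun Z => g • Z) ⁻¹' K

theorem mem_saturation {Γ : Subgroup (Sp n)} {K : Set (HalfSpace n)} {Z : HalfSpace n} :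
    Z ∈ saturation Γ K ↔ ∃ γ ∈ Γ, γ • Z ∈ K := by
  rw [saturation, Set.mem_iUnion]
  constructor
  · rintro ⟨g, hg⟩
    obtain ⟨γ, hγ, h⟩ := exists_smul_eq g
    exact ⟨γ, hγ, h Z ▸ hg⟩
  · rintro ⟨γ, hγ, h⟩
    exact ⟨toTransformation ⟨γ, hγ⟩, h⟩

theorem locallyFinite_translates {Γ : Subgroup (Sp n)} (hΓ : Γ.Commensurable (SpZ n))
    {K : Set (HalfSpace n)} (hK : IsCompact K) :
    LocallyFinite fun g : transformationGroup Γ => (fun Z => g • Z) ⁻¹' K := by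
  intro Z
  obtain ⟨L, hL, hLZ⟩ := exists_compact_mem_nhds Z
  refine ⟨L, hLZ, (finite_transformations hΓ (hK.union hL)).subset ?_⟩
  rintro g ⟨W, hW, hWL⟩
  exact ⟨W, Or.inr hWL, Or.inl hW⟩

theorem isClosed_saturation {Γ : Subgroup (Sp n)} (hΓ : Γ.Commensurable (SpZ n))
    {K : Set (HalfSpace n)} (hK : IsCompact K) : IsClosed (saturation Γ K) :=
  (locallyFinite_translates hΓ hK).isClosed_iUnion fun g =>
    hK.isClosed.preimage (continuous_const_smul g)

/-- The measures of the pieces `g⁻¹K ∩ F` add up to the measure of `K`, because `F` is a fundamental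
domain. -/
theorem measure_saturation_inter_lt_top {Γ : Subgroup (Sp n)} (hΓ : Γ.Commensurable (SpZ n))
    {F : Set (HalfSpace n)} (hF : IsFundDomain Γ F) {K : Set (HalfSpace n)} (hK : IsCompact K) :
    siegelMeasure n (saturation Γ K ∩ F) < ⊤ := by
  have := countable_transformationGroup hΓ
  refine lt_of_le_of_lt ?_ (hK.measure_lt_top (μ := siegelMeasure n))
  rw [saturation, Set.iUnion_inter, IsFundamentalDomain.measure_eq_tsum hF K,
    ← (Equiv.inv (transformationGroup Γ)).tsum_eq]
  refine (measure_iUnion_le _).trans (le_of_eq (tsum_congr fun g => ?_))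
  rw [Equiv.inv_apply, Set.preimage_smul g K]

theorem exists_norm_bound_of_invariant {Γ : Subgroup (Sp n)} {f : HalfSpace n → ℂ}
    (hf : Continuous f) (hΓf : ∀ γ ∈ Γ, ∀ Z, f (γ • Z) = f Z) {K : Set (HalfSpace n)}
    (hK : IsCompact K) (hfK : ∀ Z, Z ∉ saturation Γ K → f Z = 0) : ∃ C : ℝ, ∀ Z, ‖f Z‖ ≤ C := by
  obtain ⟨C, hC⟩ := hK.exists_bound_of_continuousOn hf.continuousOn
  refine ⟨max C 0, fun Z => ?_⟩
  by_cases hZ : Z ∈ saturation Γ K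
  · obtain ⟨γ, hγ, h⟩ := mem_saturation.1 hZ
    rw [← hΓf γ hγ]
    exact (hC _ h).trans (le_max_left _ _)
  · rw [hfK Z hZ, norm_zero]
    exact le_max_right _ _

/-- Invariance carries the bound on the compact set `K` to all its translates, and these meet `F` in
a set of finite measure. -/
theorem integrableOn_of_invariant {Γ : Subgroup (Sp n)} (hΓ : Γ.Commensurable (SpZ n))
    {F : Set (HalfSpace n)} (hF : IsFundDomain Γ F) {f : HalfSpace n → ℂ}
    (hf : Continuous f) (hΓf : ∀ γ ∈ Γ, ∀ Z, f (γ • Z) = f Z) {K : Set (HalfSpace n)}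
    (hK : IsCompact K) (hfK : ∀ Z, Z ∉ saturation Γ K → f Z = 0) :
    IntegrableOn f F (siegelMeasure n) := by
  obtain ⟨C, hC⟩ := exists_norm_bound_of_invariant hf hΓf hK hfK
  have hS := (isClosed_saturation hΓ hK).measurableSet
  have h1 : (saturation Γ K).indicator f = f := Set.indicator_eq_self.2 fun Z hZ => by
    by_contra h
    exact hZ (hfK Z h)
  rw [IntegrableOn, ← h1, integrable_indicator_iff hS]
  refine Measure.integrableOn_of_bounded (M := C) ?_ hf.aestronglyMeasurable
    (Filter.Eventually.of_forall hC)
  rw [Measure.restrict_apply hS]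
  exact (measure_saturation_inter_lt_top hΓ hF hK).ne

/-! ### Integrability of the integrands -/

section

variable {Γ : Subgroup (Sp n)} {F : Set (HalfSpace n)} {ℓ : Sp n → HalfSpace n → ℂ} {α β : ℝ}
  {f g : HalfSpace n → ℂ} {K : Set (HalfSpace n)}

theorem integrableOn_pairing (hΓ : Γ.Commensurable (SpZ n)) (hF : IsFundDomain Γ F)
    (hℓ : IsLogBranch ℓ) (hf : Continuous f) (hg : Continuous g)
    (hΓf : ∀ γ ∈ Γ, ∀ Z, f (γ • Z) = autFactor ℓ α β γ Z * f Z)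
    (hΓg : ∀ γ ∈ Γ, ∀ Z, g (γ • Z) = autFactor ℓ α β γ Z * g Z)
    (hK : IsCompact K) (hgK : ∀ Z, Z ∉ saturation Γ K → g Z = 0) :
    IntegrableOn (pairingIntegrand α β f g) F (siegelMeasure n) :=
  integrableOn_of_invariant hΓ hF (continuous_pairingIntegrand α β hf hg)
    (fun γ hγ Z => pairingIntegrand_smul hℓ (hΓf γ hγ Z) (hΓg γ hγ Z)) hK
    fun Z hZ => pairingIntegrand_eq_zero α β (hgK Z hZ)

theorem integrableOn_lambda (hΓ : Γ.Commensurable (SpZ n)) (hF : IsFundDomain Γ F)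
    (hℓ : IsLogBranch ℓ) (hf : ∀ Z : HalfSpace n, ContDiffAt ℝ 1 (ext f) Z.1)
    (hg : ∀ Z : HalfSpace n, ContDiffAt ℝ 1 (ext g) Z.1)
    (hΓf : ∀ γ ∈ Γ, ∀ Z, f (γ • Z) = autFactor ℓ α β γ Z * f Z)
    (hΓg : ∀ γ ∈ Γ, ∀ Z, g (γ • Z) = autFactor ℓ α β γ Z * g Z)
    (hK : IsCompact K) (hgK : ∀ Z, Z ∉ saturation Γ K → g Z = 0) :
    IntegrableOn (lambdaIntegrand α β f g) F (siegelMeasure n) := by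
  have hf' := fun Z : HalfSpace n => (hf Z).differentiableAt one_ne_zero
  have hg' := fun Z : HalfSpace n => (hg Z).differentiableAt one_ne_zero
  exact integrableOn_of_invariant hΓ hF (continuous_lambdaIntegrand α β hf hg)
    (fun γ hγ Z => lambdaIntegrand_smul hℓ (hΓf γ hγ) (hΓg γ hγ) (hf' _) (hf' _) (hg' _) (hg' _)) hK
    fun Z hZ => lambdaIntegrand_eq_zero α β
      (eventually_eq_zero_of_notMem (isClosed_saturation hΓ hK) hgK hZ)

end

/-! ### Growth -/

/-- Take for `ε` a positive lower bound of the form `Y₀` on the Euclidean unit sphere. An eigenvalue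
of `Y` is the value of the form `Y ≥ Y₀` at a unit eigenvector. -/
theorem exists_eigenvalue_lower_bound {Y₀ : Matrix (Fin n) (Fin n) ℝ} (h₀ : Y₀.PosDef) :
    ∃ ε : ℝ, 0 < ε ∧ ∀ Y : Matrix (Fin n) (Fin n) ℝ, ∀ hY : Y.IsHermitian,
      (Y - Y₀).PosSemidef → ∀ i, ε ≤ hY.eigenvalues i := by
  have hc : Continuous fun v : EuclideanSpace ℝ (Fin n) => star v.ofLp ⬝ᵥ Y₀ *ᵥ v.ofLp := by
    refine Continuous.dotProduct (PiLp.continuous_ofLp 2 _).star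
      (Continuous.matrix_mulVec continuous_const (PiLp.continuous_ofLp 2 _))
  obtain ⟨ε, hε, h⟩ := (isCompact_sphere (0 : EuclideanSpace ℝ (Fin n)) 1).exists_forall_le'
    hc.continuousOn (a := 0) fun v hv => (Matrix.posDef_iff_dotProduct_mulVec.1 h₀).2 fun h0 => by
      rw [mem_sphere_zero_iff_norm, (WithLp.ofLp_eq_zero 2).1 h0, norm_zero] at hv
      exact zero_ne_one hv
  refine ⟨ε, hε, fun Y hY hp i => ?_⟩
  have h1 := h (hY.eigenvectorBasis i) (by
    rw [mem_sphere_zero_iff_norm]; exact hY.eigenvectorBasis.orthonormal.1 i)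
  have h2 := (Matrix.posSemidef_iff_dotProduct_mulVec.1 hp).2 (hY.eigenvectorBasis i).ofLp
  rw [Matrix.sub_mulVec, dotProduct_sub] at h2
  have h3 := hY.eigenvalues_eq i
  rw [h3, RCLike.re_to_real]
  linarith

/-- Every power of `det Y` has moderate growth on `{Y ≥ Y₀}`. -/
theorem exists_det_rpow_bound (hn : 0 < n) {Y₀ : Matrix (Fin n) (Fin n) ℝ} (h₀ : Y₀.PosDef)
    (s : ℝ) : ∃ M : ℝ, 0 < M ∧ ∃ N : ℕ, ∀ Z : HalfSpace n, (Z.Y - Y₀).PosSemidef →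
      Z.Y.det ^ s ≤ M * (Z.Y.trace ^ N) ^ 2 := by
  obtain ⟨ε, hε, h⟩ := exists_eigenvalue_lower_bound h₀
  have key : ∀ Z : HalfSpace n, (Z.Y - Y₀).PosSemidef →
      ε ^ n ≤ Z.Y.det ∧ Z.Y.det ≤ Z.Y.trace ^ n ∧ ε ≤ Z.Y.trace := by
    intro Z hZ
    have hY : Z.Y.IsHermitian := Matrix.PosDef.isHermitian Z.2
    have h1 := h Z.Y hY hZ
    have h0 : ∀ i, 0 ≤ hY.eigenvalues i := fun i => hε.le.trans (h1 i)
    have hd : Z.Y.det = ∏ i, hY.eigenvalues i := hY.det_eq_prod_eigenvalues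
    have ht : Z.Y.trace = ∑ i, hY.eigenvalues i := hY.trace_eq_sum_eigenvalues
    have hle : ∀ i, hY.eigenvalues i ≤ Z.Y.trace := fun i => by
      rw [ht]
      exact Finset.single_le_sum (fun j _ => h0 j) (Finset.mem_univ i)
    -- The bound on the trace requires at least one eigenvalue, hence `n > 0`.
    refine ⟨?_, ?_, (h1 ⟨0, hn⟩).trans (hle _)⟩
    · rw [hd]
      simpa using Finset.prod_le_prod (s := Finset.univ) (f := fun _ => ε)
        (fun _ _ => hε.le) fun i _ => h1 i
    · rw [hd]
      simpa using Finset.prod_le_prod (s := Finset.univ) (g := fun _ => Z.Y.trace)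
        (fun i _ => h0 i) fun i _ => hle i
  rcases le_total s 0 with hs | hs
  · refine ⟨(ε ^ n) ^ s, by positivity, 0, fun Z hZ => ?_⟩
    rw [pow_zero, one_pow, mul_one]
    exact Real.rpow_le_rpow_of_nonpos (by positivity) (key Z hZ).1 hs
  -- Since `tr(Y)/ε ≥ 1`, the real exponent `n s` may be raised to the even integer `2N`. The
  -- constant collects the resulting powers of `ε`.
  · obtain ⟨N, hN⟩ := exists_nat_ge (n * s)
    refine ⟨ε ^ (n * s) / ε ^ (N * 2), by positivity, N, fun Z hZ => ?_⟩
    obtain ⟨-, h2, h3⟩ := key Z hZ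
    have ht : 0 < Z.Y.trace := hε.trans_le h3
    have h4 : Z.Y.det ^ s ≤ Z.Y.trace ^ (n * s) := by
      rw [Real.rpow_mul ht.le, Real.rpow_natCast]
      exact Real.rpow_le_rpow (det_Y_pos Z).le h2 hs
    have h5 : (Z.Y.trace / ε) ^ (n * s) ≤ (Z.Y.trace / ε) ^ ((N * 2 : ℕ) : ℝ) := by
      refine Real.rpow_le_rpow_of_exponent_le ((one_le_div hε).2 h3) (hN.trans ?_)
      push_cast
      have : (0 : ℝ) ≤ N := Nat.cast_nonneg N
      linarith
    rw [Real.rpow_natCast, Real.div_rpow ht.le hε.le, div_pow, div_le_div_iff₀ (by positivity)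
      (by positivity)] at h5
    refine h4.trans ?_
    rw [← pow_mul, div_mul_eq_mul_div, le_div_iff₀ (by positivity), mul_comm (ε ^ _)]
    exact h5

/-- A global bound for `det(Y)^{α+β}|u|²` applies at `γZ`. In terms of `Z` it bounds the squared
modulus of the transformed function by a constant times `det(Y)^{-(α+β)}`, which has moderate
growth. -/
theorem growth_of_bound {ℓ : Sp n → HalfSpace n → ℂ} (hℓ : IsLogBranch ℓ) {α β : ℝ} (hn : 0 < n)
    {u : HalfSpace n → ℂ} {C : ℝ} (hC : ∀ Z, ‖pairingIntegrand α β u u Z‖ ≤ C) (γ : Sp n)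
    {Y₀ : Matrix (Fin n) (Fin n) ℝ} (h₀ : Y₀.PosDef) : ∃ M : ℝ, 0 < M ∧ ∃ N : ℕ,
      ∀ Z : HalfSpace n, (Z.Y - Y₀).PosSemidef →
        ‖(autFactor ℓ α β γ Z)⁻¹ * u (γ • Z)‖ ≤ M * Z.Y.trace ^ N := by
  obtain ⟨M, hM, N, h⟩ := exists_det_rpow_bound hn h₀ (-(α + β))
  -- The square root appears because squares are compared, and `|C| + 1` keeps the constant
  -- positive.
  refine ⟨√((|C| + 1) * M), by positivity, N, fun Z hZ => ?_⟩
  have ht : 0 ≤ Z.Y.trace := Matrix.PosSemidef.trace_nonneg (Matrix.PosDef.posSemidef Z.2)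
  refine abs_le_of_sq_le_sq' ?_ (by positivity) |>.2
  rw [mul_pow, Real.sq_sqrt (by positivity), norm_mul, norm_inv, mul_pow, inv_pow]
  have h1 := hC (γ • Z)
  have hD : 0 < (γ • Z).Y.det ^ (α + β) := Real.rpow_pos_of_pos (det_Y_pos _) _
  have hJ : 0 < ‖autFactor ℓ α β γ Z‖ := norm_pos_iff.2 (autFactor_ne_zero ℓ α β γ Z)
  rw [pairingIntegrand, norm_mul, norm_mul, RCLike.norm_conj, Complex.norm_real,
    Real.norm_of_nonneg hD.le, ← sq] at h1
  have h2 := h Z hZ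
  rw [Real.rpow_neg (det_Y_pos Z).le, ← det_Y_smul_rpow hℓ α β γ Z] at h2
  calc (‖autFactor ℓ α β γ Z‖ ^ 2)⁻¹ * ‖u (γ • Z)‖ ^ 2
      = ((γ • Z).Y.det ^ (α + β) * ‖u (γ • Z)‖ ^ 2) *
        ((γ • Z).Y.det ^ (α + β) * ‖autFactor ℓ α β γ Z‖ ^ 2)⁻¹ := by field_simp
    _ ≤ (|C| + 1) * (M * (Z.Y.trace ^ N) ^ 2) := by
        refine mul_le_mul (h1.trans ((le_abs_self C).trans (by linarith))) h2 (by positivity)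
          (by positivity)
    _ = _ := by ring

/-! ### The Laplacian of a form -/

theorem isAutomorphicForm_laplacian (hn : 0 < n) {α β : ℝ} {Γ : Subgroup (Sp n)}
    (hΓ : Γ.Commensurable (SpZ n)) {F : Set (HalfSpace n)} (hF : IsFundDomain Γ F)
    {ℓ : Sp n → HalfSpace n → ℂ} (hℓ : IsLogBranch ℓ) {r : WithTop ℕ∞} (hr : r = ∞ ∨ r = ω)
    {φ : HalfSpace n → ℂ} (hφ : IsAutomorphicForm r Γ F ℓ α β φ) {K : Set (HalfSpace n)}
    (hK : IsCompact K) (hφK : ∀ Z, Z ∉ saturation Γ K → φ Z = 0) :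
    IsAutomorphicForm r Γ F ℓ α β (laplacian α β φ) ∧
      ∀ Z, Z ∉ saturation Γ K → laplacian α β φ Z = 0 := by
  have hreg := contDiffOn_ext_iff.1 hφ.regular
  have h2r : (2 : WithTop ℕ∞) ≤ r := by
    rcases hr with rfl | rfl
    · exact WithTop.coe_le_coe.2 le_top
    · exact le_top
  -- For smooth and for analytic functions two derivatives cost no regularity.
  have hrr : r + 1 + 1 ≤ r := by
    rcases hr with rfl | rfl <;> rfl
  have hφ2 := fun Z : HalfSpace n => (hreg Z).of_le h2r
  have hΔ0 : ∀ Z, Z ∉ saturation Γ K → laplacian α β φ Z = 0 := fun Z hZ =>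
    laplacian_eq_zero α β (eventually_eq_zero_of_notMem (isClosed_saturation hΓ hK) hφK hZ)
  have haut : ∀ γ ∈ Γ, ∀ Z, laplacian α β φ (γ • Z) = autFactor ℓ α β γ Z * laplacian α β φ Z :=
    fun γ hγ Z => laplacian_smul hℓ hφ2 (hφ.automorphy γ hγ) Z
  have hc := continuous_laplacian α β hφ2
  refine ⟨⟨contDiffOn_ext_iff.2 fun Z => contDiffAt_ext_laplacian hrr (hreg Z) α β, haut,
    fun γ _ Y₀ h₀ => ?_, ?_⟩, hΔ0⟩
  · obtain ⟨C, hC⟩ := exists_norm_bound_of_invariant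
      (continuous_pairingIntegrand α β hc hc)
      (fun γ hγ Z => pairingIntegrand_smul hℓ (haut γ hγ Z) (haut γ hγ Z)) hK
      fun Z hZ => pairingIntegrand_eq_zero α β (hΔ0 Z hZ)
    exact growth_of_bound hℓ hn hC γ h₀
  · have h1 := (integrableOn_pairing hΓ hF hℓ hc hc haut haut hK hΔ0).norm
    refine h1.congr (Filter.Eventually.of_forall fun Z => ?_)
    have hD : 0 < Z.Y.det ^ (α + β) := Real.rpow_pos_of_pos (det_Y_pos _) _
    simp only [pairingIntegrand]
    rw [norm_mul, norm_mul, RCLike.norm_conj, Complex.norm_real, Real.norm_of_nonneg hD.le, ← sq]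

/-! ### Sums over the group -/

section

variable {Γ : Subgroup (Sp n)} {χ : HalfSpace n → ℂ} {L : Set (HalfSpace n)}

theorem contDiffAt_ext_transformation {r : WithTop ℕ∞} {f : HalfSpace n → ℂ}
    (hf : ∀ Z : HalfSpace n, ContDiffAt ℝ r (ext f) Z.1) (g : transformationGroup Γ)
    (Z : HalfSpace n) : ContDiffAt ℝ r (ext fun W => f (g • W)) Z.1 := by
  obtain ⟨γ, -, h⟩ := exists_smul_eq g
  simp only [h]
  exact contDiffAt_ext_smul γ (hf _)

theorem exists_finset_translates (hΓ : Γ.Commensurable (SpZ n)) (hL : IsCompact L)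
    (hχL : ∀ Z, Z ∉ L → χ Z = 0) (Z : HalfSpace n) :
    ∃ s : Finset (transformationGroup Γ), ∀ᶠ W in nhds Z, ∀ g ∉ s, χ (g • W) = 0 := by
  obtain ⟨t, ht, hfin⟩ := locallyFinite_translates hΓ hL Z
  refine ⟨hfin.toFinset, ?_⟩
  filter_upwards [ht] with W hW g hg
  refine hχL _ fun h => hg ?_
  rw [Set.Finite.mem_toFinset]
  exact ⟨W, h, hW⟩

/-- The sum of the translates of `χ`. -/
def orbitSum (Γ : Subgroup (Sp n)) (χ : HalfSpace n → ℂ) (Z : HalfSpace n) : ℂ :=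
  ∑ᶠ g : transformationGroup Γ, χ (g • Z)

theorem orbitSum_eq_sum {s : Finset (transformationGroup Γ)} {Z : HalfSpace n}
    (h : ∀ g ∉ s, χ (g • Z) = 0) : orbitSum Γ χ Z = ∑ g ∈ s, χ (g • Z) :=
  finsum_eq_sum_of_support_subset _ fun g hg => by
    by_contra hgs
    exact hg (h g hgs)

theorem orbitSum_smul (g : transformationGroup Γ) (Z : HalfSpace n) :
    orbitSum Γ χ (g • Z) = orbitSum Γ χ Z := by
  simp only [orbitSum, ← mul_smul]
  exact finsum_comp_equiv (Equiv.mulRight g) (f := fun g => χ (g • Z))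

theorem contDiffAt_ext_orbitSum {r : WithTop ℕ∞} (hΓ : Γ.Commensurable (SpZ n)) (hL : IsCompact L)
    (hχL : ∀ Z, Z ∉ L → χ Z = 0) (hχ : ∀ Z : HalfSpace n, ContDiffAt ℝ r (ext χ) Z.1)
    (Z : HalfSpace n) : ContDiffAt ℝ r (ext (orbitSum Γ χ)) Z.1 := by
  obtain ⟨s, hs⟩ := exists_finset_translates hΓ hL hχL Z
  refine (contDiffAt_ext_sum s fun g _ => contDiffAt_ext_transformation hχ g Z)
    |>.congr_of_eventuallyEq (ext_eventuallyEq ?_)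
  filter_upwards [hs] with W hW
  exact orbitSum_eq_sum hW

theorem contDiffAt_ext_inv {r : WithTop ℕ∞} {f : HalfSpace n → ℂ} {Z : HalfSpace n}
    (hf : ContDiffAt ℝ r (ext f) Z.1) (h0 : f Z ≠ 0) :
    ContDiffAt ℝ r (ext fun W => (f W)⁻¹) Z.1 :=
  contDiffAt_ext_congr (g := fun z => (ext f z)⁻¹) (hf.inv (by rwa [ext_val]))
    fun W => by simp only [ext_val]

end

/-- There are smooth functions whose translates form a partition of unity on the translates of a
compact set. -/
theorem exists_partition {Γ : Subgroup (Sp n)} (hΓ : Γ.Commensurable (SpZ n))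
    {K : Set (HalfSpace n)} (hK : IsCompact K) :
    ∃ (w : HalfSpace n → ℂ) (L : Set (HalfSpace n)), IsCompact L ∧ (∀ Z, Z ∉ L → w Z = 0) ∧
      (∀ Z ∈ saturation Γ K, ContDiffAt ℝ 1 (ext w) Z.1) ∧
      ∀ Z ∈ saturation Γ K, orbitSum Γ w Z = 1 := by
  obtain ⟨L, hL, hKL⟩ := exists_compact_superset hK
  -- The bump function is nonzero exactly on the interior of `L`, which contains `K`. Its orbit sum
  -- is therefore positive on all translates of `K`.
  obtain ⟨χ, hχs, hχ, hχ01⟩ := (isOpenEmbedding_val (n := n)).isOpenMap _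
    (isOpen_interior (s := L)) |>.exists_contDiff_support_eq (n := 1)
  have hχ0 : ∀ z, 0 ≤ χ z := fun z => (hχ01 ⟨z, rfl⟩).1
  set c : HalfSpace n → ℂ := fun Z => (χ Z.1 : ℂ) with hc
  have hχL : ∀ Z : HalfSpace n, Z ∉ L → χ Z.1 = 0 := fun Z hZ => by
    by_contra h
    obtain ⟨W, hW, hWZ⟩ := hχs ▸ (show Z.1 ∈ Function.support χ from h)
    exact hZ (interior_subset (Subtype.ext hWZ ▸ hW))
  have hcL : ∀ Z : HalfSpace n, Z ∉ L → c Z = 0 := fun Z hZ => by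
    simp only [hc, hχL Z hZ, Complex.ofReal_zero]
  have hcd : ∀ Z : HalfSpace n, ContDiffAt ℝ 1 (ext c) Z.1 := fun Z =>
    contDiffAt_ext_congr (g := fun z => Complex.ofRealCLM (χ z))
      (Complex.ofRealCLM.contDiff.contDiffAt.comp Z.1 hχ.contDiffAt) fun W => rfl
  have hP0 : ∀ Z ∈ saturation Γ K, orbitSum Γ c Z ≠ 0 := by
    intro Z hZ
    obtain ⟨g, hg⟩ := Set.mem_iUnion.1 hZ
    obtain ⟨s, hs⟩ := exists_finset_translates hΓ hL hcL Z
    have hs' := hs.self_of_nhds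
    have hpos : 0 < χ (g • Z).1 := by
      refine lt_of_le_of_ne (hχ0 _) (Ne.symm ?_)
      have h : (g • Z).1 ∈ Function.support χ := hχs ▸ ⟨g • Z, hKL hg, rfl⟩
      exact h
    have hgs : g ∈ s := by
      by_contra h
      exact hpos.ne' (Complex.ofReal_eq_zero.1 (hs' g h))
    rw [orbitSum_eq_sum hs', hc, ← Complex.ofReal_sum]
    exact Complex.ofReal_ne_zero.2 (Finset.sum_pos' (fun i _ => hχ0 (i • Z).1) ⟨g, hgs, hpos⟩).ne'
  -- Off the translates of `K` the orbit sum may vanish. Regularity of the quotient is therefore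
  -- claimed on the saturation only, which is enough once it is multiplied by a form supported
  -- there.
  refine ⟨fun Z => c Z * (orbitSum Γ c Z)⁻¹, L, hL, fun Z hZ => by simp only [hcL Z hZ, zero_mul],
    fun Z hZ => contDiffAt_ext_mul (hcd Z) (contDiffAt_ext_inv
      (contDiffAt_ext_orbitSum hΓ hL hcL hcd Z) (hP0 Z hZ)), fun Z hZ => ?_⟩
  obtain ⟨s, hs⟩ := exists_finset_translates hΓ hL hcL Z
  have hs' := hs.self_of_nhds
  rw [orbitSum_eq_sum (s := s) fun g hg => by rw [hs' g hg, zero_mul]]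
  simp only [orbitSum_smul]
  rw [← Finset.sum_mul, ← orbitSum_eq_sum hs', mul_inv_cancel₀ (hP0 Z hZ)]

theorem smul_mem_saturation {Γ : Subgroup (Sp n)} {K : Set (HalfSpace n)} {Z : HalfSpace n}
    (g : transformationGroup Γ) (hZ : Z ∈ saturation Γ K) : g • Z ∈ saturation Γ K := by
  obtain ⟨h, hh⟩ := Set.mem_iUnion.1 hZ
  refine Set.mem_iUnion.2 ⟨h * g⁻¹, ?_⟩
  change (h * g⁻¹) • g • Z ∈ K
  rwa [smul_smul, inv_mul_cancel_right]

theorem opLambda_sum (β : ℝ) {ι : Type*} (s : Finset ι) {f : ι → HalfSpace n → ℂ}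
    {Z : HalfSpace n} (hf : ∀ i ∈ s, DifferentiableAt ℝ (ext (f i)) Z.1) :
    opLambda β (fun W => ∑ i ∈ s, f i W) Z = ∑ i ∈ s, opLambda β (f i) Z := by
  simp only [opLambda, (dZ_sum s hf).2, Finset.mul_sum, Finset.sum_smul,
    Finset.sum_sub_distrib]

theorem lambdaIntegrand_sum (α β : ℝ) (φ : HalfSpace n → ℂ) {ι : Type*} (s : Finset ι)
    {f : ι → HalfSpace n → ℂ} {Z : HalfSpace n}
    (hf : ∀ i ∈ s, DifferentiableAt ℝ (ext (f i)) Z.1) :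
    lambdaIntegrand α β φ (fun W => ∑ i ∈ s, f i W) Z =
      ∑ i ∈ s, lambdaIntegrand α β φ (f i) Z := by
  simp only [lambdaIntegrand]
  rw [opLambda_sum β s hf, ← Finset.mul_sum, ← Matrix.trace_sum, ← Finset.mul_sum]
  congr 3
  ext i j
  simp [Matrix.sum_apply]

theorem pairingIntegrand_sum (α β : ℝ) (φ : HalfSpace n → ℂ) {ι : Type*} (s : Finset ι)
    (f : ι → HalfSpace n → ℂ) (Z : HalfSpace n) :
    pairingIntegrand α β φ (fun W => ∑ i ∈ s, f i W) Z =
      ∑ i ∈ s, pairingIntegrand α β φ (f i) Z := by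
  simp only [pairingIntegrand, map_sum, Finset.mul_sum]

/-! ### Unfolding -/

/-- The half-space is cut into the translates of `F`. Integrability of `h` justifies exchanging sum
and integral. -/
theorem integral_eq_setIntegral_tsum {Γ : Subgroup (Sp n)} (hΓ : Γ.Commensurable (SpZ n))
    {F : Set (HalfSpace n)} (hF : IsFundDomain Γ F) {h : HalfSpace n → ℂ} (hc : Continuous h)
    (hi : Integrable h (siegelMeasure n)) :
    ∫ Z, h Z ∂(siegelMeasure n) =
      ∫ Z in F, ∑' g : transformationGroup Γ, h (g • Z) ∂(siegelMeasure n) := by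
  have := countable_transformationGroup hΓ
  rw [IsFundamentalDomain.integral_eq_tsum'' hF h hi, integral_tsum]
  · exact fun g => (hc.comp (continuous_const_smul g)).aestronglyMeasurable
  · rw [← IsFundamentalDomain.lintegral_eq_tsum'' hF fun Z => ‖h Z‖ₑ]
    exact hi.2.ne

/-- The test function by which integrals against a form are unfolded. -/
theorem exists_unfolding {Γ : Subgroup (Sp n)} (hΓ : Γ.Commensurable (SpZ n))
    {F : Set (HalfSpace n)} (hF : IsFundDomain Γ F) {ℓ : Sp n → HalfSpace n → ℂ}
    (hℓ : IsLogBranch ℓ) {α β : ℝ} {ψ : HalfSpace n → ℂ}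
    (hψ : ∀ Z : HalfSpace n, ContDiffAt ℝ 1 (ext ψ) Z.1)
    (hΓψ : ∀ γ ∈ Γ, ∀ Z, ψ (γ • Z) = autFactor ℓ α β γ Z * ψ Z) {K : Set (HalfSpace n)}
    (hK : IsCompact K) (hψK : ∀ Z, Z ∉ saturation Γ K → ψ Z = 0) :
    ∃ ψ' : HalfSpace n → ℂ, IsTest ψ' ∧
      (∀ f : HalfSpace n → ℂ, Continuous f →
        (∀ γ ∈ Γ, ∀ Z, f (γ • Z) = autFactor ℓ α β γ Z * f Z) →
        ∫ Z, pairingIntegrand α β f ψ' Z ∂(siegelMeasure n) = pairing F α β f ψ) ∧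
      ∀ f : HalfSpace n → ℂ, (∀ Z : HalfSpace n, ContDiffAt ℝ 1 (ext f) Z.1) →
        (∀ γ ∈ Γ, ∀ Z, f (γ • Z) = autFactor ℓ α β γ Z * f Z) →
        ∫ Z, lambdaIntegrand α β f ψ' Z ∂(siegelMeasure n) =
          ∫ Z in F, lambdaIntegrand α β f ψ Z ∂(siegelMeasure n) := by
  obtain ⟨w, L, hL, hwL, hwd, hw1⟩ := exists_partition hΓ hK
  have hS := isClosed_saturation hΓ hK
  -- The pieces `p g` sum to `ψ`, and `p 1 = w ψ` is the required test function.
  set p : transformationGroup Γ → HalfSpace n → ℂ := fun g Z => w (g • Z) * ψ Z with hp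
  have hpd : ∀ g, ∀ Z : HalfSpace n, ContDiffAt ℝ 1 (ext (p g)) Z.1 := by
    intro g Z
    by_cases hZ : Z ∈ saturation Γ K
    · obtain ⟨γ, -, h⟩ := exists_smul_eq g
      have h1 := hwd _ (smul_mem_saturation g hZ)
      simp only [hp, h] at h1 ⊢
      exact contDiffAt_ext_mul (contDiffAt_ext_smul γ h1) (hψ Z)
    -- Outside the closed saturation `ψ` vanishes in a neighbourhood, so the possible irregularity
    -- of `w` is harmless.
    · have h1 : p g =ᶠ[nhds Z] fun _ => 0 := eventually_eq_zero_of_notMem hS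
        (fun W hW => by simp only [hp, hψK W hW, mul_zero]) hZ
      exact (contDiffAt_ext_congr (f := fun _ => 0) (contDiffAt_const (c := 0)) fun _ => rfl)
        |>.congr_of_eventuallyEq (ext_eventuallyEq h1)
  have hpdd := fun g (Z : HalfSpace n) => (hpd g Z).differentiableAt one_ne_zero
  have hloc : ∀ Z : HalfSpace n, ∃ s : Finset (transformationGroup Γ),
      (∀ g ∉ s, p g =ᶠ[nhds Z] fun _ => 0) ∧ ψ =ᶠ[nhds Z] fun W => ∑ g ∈ s, p g W := by
    intro Z
    obtain ⟨s, hs⟩ := exists_finset_translates hΓ hL hwL Z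
    refine ⟨s, fun g hg => ?_, ?_⟩
    · filter_upwards [hs] with W hW
      simp only [hp, hW g hg, zero_mul]
    · filter_upwards [hs] with W hW
      by_cases h : W ∈ saturation Γ K
      · simp only [hp]
        rw [← Finset.sum_mul, ← orbitSum_eq_sum hW, hw1 W h, one_mul]
      · simp only [hp, hψK W h, mul_zero, Finset.sum_const_zero]
  have hp1 : (fun Z => w Z * ψ Z) = p 1 := by
    funext Z
    simp only [hp, one_smul]
  -- Transforming `p 1` by `γ` gives the piece `p g`, because `ψ` carries the automorphy factor. The
  -- integrands at `γZ` thus become those of `p g` at `Z`, and their sum is the integrand of `ψ`.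
  have hpγ : ∀ g : transformationGroup Γ, ∃ γ ∈ Γ, (∀ Z : HalfSpace n, g • Z = γ • Z) ∧
      ∀ Z, p 1 (γ • Z) = autFactor ℓ α β γ Z * p g Z := by
    intro g
    obtain ⟨γ, hγ, h⟩ := exists_smul_eq g
    refine ⟨γ, hγ, h, fun Z => ?_⟩
    simp only [hp, one_smul, hΓψ γ hγ, h]
    ring
  have hp0 : ∀ Z, Z ∉ L → p 1 Z = 0 := fun Z hZ => by
    rw [← hp1]
    simp only [hwL Z hZ, zero_mul]
  have hpc := continuous_of_contDiffAt (hpd 1)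
  refine ⟨p 1, ⟨hpd 1, L, hL, hp0⟩, fun f hf hΓf => ?_, fun f hf hΓf => ?_⟩
  · have hc := continuous_pairingIntegrand α β hf hpc
    rw [integral_eq_setIntegral_tsum hΓ hF hc (integrable_siegelMeasure hc hL fun Z hZ =>
      pairingIntegrand_eq_zero α β (hp0 Z hZ)), pairing]
    congr 1
    funext Z
    obtain ⟨s, hs, hψs⟩ := hloc Z
    have h1 : ∀ g : transformationGroup Γ, pairingIntegrand α β f (p 1) (g • Z) =
        pairingIntegrand α β f (p g) Z := by
      intro g
      obtain ⟨γ, hγ, h, hpg⟩ := hpγ g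
      rw [h]
      exact pairingIntegrand_smul hℓ (hΓf γ hγ Z) (hpg Z)
    simp only [h1]
    rw [tsum_eq_sum fun g hg => pairingIntegrand_eq_zero α β (hs g hg).eq_of_nhds,
      ← pairingIntegrand_sum]
    simp only [pairingIntegrand, hψs.eq_of_nhds]
  · have hc := continuous_lambdaIntegrand α β hf (hpd 1)
    have hfd := fun Z : HalfSpace n => (hf Z).differentiableAt one_ne_zero
    rw [integral_eq_setIntegral_tsum hΓ hF hc (integrable_siegelMeasure hc hL fun Z hZ =>
      lambdaIntegrand_eq_zero α β (eventually_eq_zero_of_notMem hL.isClosed hp0 hZ))]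
    congr 1
    funext Z
    obtain ⟨s, hs, hψs⟩ := hloc Z
    have h1 : ∀ g : transformationGroup Γ, lambdaIntegrand α β f (p 1) (g • Z) =
        lambdaIntegrand α β f (p g) Z := by
      intro g
      obtain ⟨γ, hγ, h, hpg⟩ := hpγ g
      rw [h]
      exact lambdaIntegrand_smul hℓ (hΓf γ hγ) hpg (hfd _) (hfd _) (hpdd _ _) (hpdd _ _)
    simp only [h1]
    rw [tsum_eq_sum fun g hg => lambdaIntegrand_eq_zero α β (hs g hg),
      ← lambdaIntegrand_sum α β f s fun g _ => hpdd g Z]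
    simp only [lambdaIntegrand, opLambda_eventuallyEq β hψs]

/-! ### Hermitian symmetry and the formula on the quotient -/

theorem conj_pairing {F : Set (HalfSpace n)} (α β : ℝ) (f g : HalfSpace n → ℂ) :
    conj (pairing F α β f g) = pairing F α β g f := by
  rw [pairing, pairing, ← integral_conj]
  congr 1
  funext Z
  simp only [pairingIntegrand, map_mul, Complex.conj_ofReal, Complex.conj_conj]
  ring

theorem conj_integral_lambda {F : Set (HalfSpace n)} (α β : ℝ) (f g : HalfSpace n → ℂ) :
    conj (∫ Z in F, lambdaIntegrand α β f g Z ∂(siegelMeasure n)) =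
      ∫ Z in F, lambdaIntegrand α β g f Z ∂(siegelMeasure n) := by
  rw [← integral_conj]
  congr 1
  funext Z
  simp only [lambdaIntegrand, map_mul, Complex.conj_ofReal, trace_eq_sum, map_sum,
    Matrix.map_apply, Complex.conj_conj]
  rw [Finset.sum_comm]
  simp only [mul_comm]

theorem pairing_neg {F : Set (HalfSpace n)} (α β : ℝ) (f g : HalfSpace n → ℂ) :
    pairing F α β (fun Z => -f Z) g = -pairing F α β f g := by
  rw [pairing, pairing, ← integral_neg]
  congr 1
  funext Z
  simp only [pairingIntegrand]
  ring

/-- Unfold all three integrals with the same test function and apply the identity on the half-space.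
The first unfolding uses that `-Δφ` is again automorphic, by `laplacian_smul`. -/
theorem pairing_laplacian {Γ : Subgroup (Sp n)} (hΓ : Γ.Commensurable (SpZ n))
    {F : Set (HalfSpace n)} (hF : IsFundDomain Γ F) {ℓ : Sp n → HalfSpace n → ℂ}
    (hℓ : IsLogBranch ℓ) {α β : ℝ} {φ ψ : HalfSpace n → ℂ}
    (hφ : ∀ Z : HalfSpace n, ContDiffAt ℝ 2 (ext φ) Z.1)
    (hψ : ∀ Z : HalfSpace n, ContDiffAt ℝ 1 (ext ψ) Z.1)
    (hΓφ : ∀ γ ∈ Γ, ∀ Z, φ (γ • Z) = autFactor ℓ α β γ Z * φ Z)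
    (hΓψ : ∀ γ ∈ Γ, ∀ Z, ψ (γ • Z) = autFactor ℓ α β γ Z * ψ Z) {K : Set (HalfSpace n)}
    (hK : IsCompact K) (hψK : ∀ Z, Z ∉ saturation Γ K → ψ Z = 0) :
    pairing F α β (fun Z => -laplacian α β φ Z) ψ =
      (∫ Z in F, lambdaIntegrand α β φ ψ Z ∂(siegelMeasure n)) +
        ((n * β * (α - (n + 1) / 2) : ℝ) : ℂ) * pairing F α β φ ψ := by
  obtain ⟨ψ', ht, hp, hl⟩ := exists_unfolding hΓ hF hℓ hψ hΓψ hK hψK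
  have hφ1 := fun Z : HalfSpace n => (hφ Z).of_le one_le_two
  rw [← hp (fun Z => -laplacian α β φ Z) (continuous_laplacian α β hφ).neg fun γ hγ Z => by
      rw [laplacian_smul hℓ hφ (hΓφ γ hγ), mul_neg],
    ← hp φ (continuous_of_contDiffAt hφ) hΓφ, ← hl φ hφ1 hΓφ]
  exact integral_opOmega_test α β hφ ht

end SiegelMaass

end

/-! ### The theorem -/

open SiegelMaass in
theorem mainTheorem2 (n : ℕ) (hn : 0 < n) (α β : ℝ)
    (Γ : Subgroup (SiegelMaass.Sp n)) (hΓ : Γ.Commensurable (SiegelMaass.SpZ n))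
    (F : Set (SiegelMaass.HalfSpace n)) (hF : SiegelMaass.IsFundDomain Γ F)
    (ℓ : SiegelMaass.Sp n → SiegelMaass.HalfSpace n → ℂ) (hℓ : SiegelMaass.IsLogBranch ℓ)
    (r : WithTop ℕ∞) (hr : r = ∞ ∨ r = ω)
    (φ ψ : SiegelMaass.HalfSpace n → ℂ)
    (hφ : SiegelMaass.IsAutomorphicForm r Γ F ℓ α β φ)
    (hψ : SiegelMaass.IsAutomorphicForm r Γ F ℓ α β ψ)
    (hφc : SiegelMaass.HasCompactSupportMod Γ φ)
    (hψc : SiegelMaass.HasCompactSupportMod Γ ψ) :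
    -- the Laplacian acts on the compactly supported forms
    (SiegelMaass.IsAutomorphicForm r Γ F ℓ α β (SiegelMaass.laplacian α β φ) ∧
      SiegelMaass.HasCompactSupportMod Γ (SiegelMaass.laplacian α β φ)) ∧
    -- the integrals in the formula converge
    (IntegrableOn (SiegelMaass.pairingIntegrand α β φ ψ) F (SiegelMaass.siegelMeasure n) ∧
      IntegrableOn (SiegelMaass.pairingIntegrand α β (SiegelMaass.laplacian α β φ) ψ) F
        (SiegelMaass.siegelMeasure n) ∧
      IntegrableOn (SiegelMaass.pairingIntegrand α β φ (SiegelMaass.laplacian α β ψ)) F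
        (SiegelMaass.siegelMeasure n) ∧
      IntegrableOn (SiegelMaass.lambdaIntegrand α β φ ψ) F (SiegelMaass.siegelMeasure n)) ∧
    -- the formula
    SiegelMaass.pairing F α β (fun Z => -SiegelMaass.laplacian α β φ Z) ψ =
      (∫ Z in F, SiegelMaass.lambdaIntegrand α β φ ψ Z ∂(SiegelMaass.siegelMeasure n)) +
        ((n * β * (α - (n + 1) / 2) : ℝ) : ℂ) * SiegelMaass.pairing F α β φ ψ ∧
    -- the symmetry
    SiegelMaass.pairing F α β (SiegelMaass.laplacian α β φ) ψ =
      SiegelMaass.pairing F α β φ (SiegelMaass.laplacian α β ψ) := by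
  obtain ⟨K, hK, hφK⟩ := hφc
  obtain ⟨K', hK', hψK'⟩ := hψc
  have hφ0 : ∀ Z, Z ∉ saturation Γ K → φ Z = 0 := fun Z hZ => by
    by_contra h
    exact hZ (mem_saturation.2 (hφK Z h))
  have hψ0 : ∀ Z, Z ∉ saturation Γ K' → ψ Z = 0 := fun Z hZ => by
    by_contra h
    exact hZ (mem_saturation.2 (hψK' Z h))
  have h2r : (2 : WithTop ℕ∞) ≤ r := by
    rcases hr with rfl | rfl
    · exact WithTop.coe_le_coe.2 le_top
    · exact le_top
  have hφ2 := fun Z : HalfSpace n => (contDiffOn_ext_iff.1 hφ.regular Z).of_le h2r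
  have hψ2 := fun Z : HalfSpace n => (contDiffOn_ext_iff.1 hψ.regular Z).of_le h2r
  have hφ1 := fun Z : HalfSpace n => (hφ2 Z).of_le one_le_two
  have hψ1 := fun Z : HalfSpace n => (hψ2 Z).of_le one_le_two
  have cφ := continuous_of_contDiffAt hφ1
  have cψ := continuous_of_contDiffAt hψ1
  obtain ⟨hΔφ, hΔφ0⟩ := isAutomorphicForm_laplacian hn hΓ hF hℓ hr hφ hK hφ0
  obtain ⟨hΔψ, hΔψ0⟩ := isAutomorphicForm_laplacian hn hΓ hF hℓ hr hψ hK' hψ0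
  have e1 := pairing_laplacian hΓ hF hℓ hφ2 hψ1 hφ.automorphy hψ.automorphy hK' hψ0
  -- The formula with `φ` and `ψ` exchanged, then conjugated. The `Λ`-integral and the inner product
  -- are Hermitian and the constant is real, so its right-hand side becomes that of `e1`.
  have e2 := congrArg conj
    (pairing_laplacian hΓ hF hℓ hψ2 hφ1 hψ.automorphy hφ.automorphy hK hφ0)
  rw [map_add, map_mul, Complex.conj_ofReal, conj_integral_lambda, pairing_neg, map_neg,
    conj_pairing, conj_pairing, ← e1, pairing_neg, neg_inj] at e2
  refine ⟨⟨hΔφ, K, hK, fun Z hZ => ?_⟩, ⟨?_, ?_, ?_, ?_⟩, e1, e2.symm⟩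
  · by_contra h
    exact hZ (hΔφ0 Z fun h' => h (mem_saturation.1 h'))
  · exact integrableOn_pairing hΓ hF hℓ cφ cψ hφ.automorphy hψ.automorphy hK' hψ0
  · exact integrableOn_pairing hΓ hF hℓ (continuous_laplacian α β hφ2) cψ hΔφ.automorphy
      hψ.automorphy hK' hψ0
  · exact integrableOn_pairing hΓ hF hℓ cφ (continuous_laplacian α β hψ2) hφ.automorphy
      hΔψ.automorphy hK' hΔψ0
  · exact integrableOn_lambda hΓ hF hℓ hφ1 hψ1 hφ.automorphy hψ.automorphy hK' hψ0
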